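/- **Setting.** Let $V$ be a finite set; each $\gamma\in V$ has a finite level set $\mathcal I_\gamma$ with a distinguished level $0$. For $D\subseteq V$ put $\mathcal I_D=\prod_{\gamma\in D}\mathcal I_\gamma$, $\mathcal I=\mathcal I_V$, and let $\mathcal I_D^*\subseteq\mathcal I_D$ be the cells with no component $0$; $i^*$ denotes the zero cell. Let $G$ be a decomposable graph on $V$ with cliques $C_1,\dots,C_k$ in a perfect order: with $H_l=C_1\cup\dots\cup C_l$, $S_l=H_{l-1}\cap C_l$ and $R_l=C_l\setminus S_l$, for each $l\ge2$ there is $i<l$ with $S_l\subseteq C_i$. Let $S_1=\emptyset$, $R_1=C_1$. Let $\mathcal M_G$ be the set of strictly positive probability vectors $p$ on $\mathcal I$ that are Markov with respect to $G$, and consider multinomial sampling of $N\ge1$ units with cell probabilities $p\in\mathcal M_G$. Write $p^D$ for marginal and $p^{A|i_B}$ for conditional probabilities. For a positive function $q$ on $\mathcal I_A$ and $i_D\in\mathcal I^*_D$, $\emptyset\neq D\subseteq A$, put $\theta_q(i_D)=\log\prod_{F\subseteq D}q(i_F,i^*_{A\setminus F})^{(-1)^{|D\setminus F|}}$. Define *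 $\theta^{cond}$: all $\theta^{R_l|i_{S_l}}(i_D)=\theta_{p^{R_l|i_{S_l}}}(i_D)$ with $1\le l\le k$, $i_{S_l}\in\mathcal I_{S_l}$, $\emptyset\ne D\subseteq R_l$, $i_D\in\mathcal I_D^*$, one group for each $(l,i_{S_l})$; * $\theta^{cliq}$: all $\theta^{C_l}(i_D)=\theta_{p^{C_l}}(i_D)$ with $D\subseteq C_l$, $D\cap R_l\ne\emptyset$, $i_D\in\mathcal I_D^*$, one group for each $l$; * $\theta^{mod}$: all $\theta(i_D)=\theta_p(i_D)$ with the same index set and the same $k$ groups (every non-empty complete $D$ belongs to exactly one $l$). Reference priors are those of the ordered-groups algorithm based on the Fisher information. With $m$ groups numbered $1,\dots,m$ in increasing order of inferential importance, let $h_j$ be the group-$j$ block of $\big((I^{-1})_{\ge j}\big)^{-1}$, where $(I^{-1})_{\ge j}$ is the block of the inverse information matrix belonging to groups $j,\dots,m$. On a product $K=K_1\times\dots\times K_m$ of compact sets define successively for $j=1,\dots,m$ the conditional densities of group $j$ given groups $j+1,\dots,m$, proportional on $K_j$ to $\exp(\tfrac12E[\log\det h_j])$, where the expectation is over groups $1,\dots,j-1$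 under the conditional densities already constructed; $\pi_K$ is their product. Then $\pi>0$ is the reference prior (up to a constant) if $\pi_{K^{(n)}}(\theta)/\pi_{K^{(n)}}(\theta_0)\to\pi(\theta)/\pi(\theta_0)$ for all $\theta,\theta_0$ and for every sequence $K^{(n)}$ of such products whose factors $K^{(n)}_j$ increase to the whole space of group $j$. **Theorem.** Each of $\theta^{cond},\theta^{cliq},\theta^{mod}$ is a one-to-one parametrization of $\mathcal M_G$ by a full space $\mathbb R^d$. The reference prior of * (a) $\theta^{cond}$, for every order of its groups, * (b) $\theta^{cliq}$, for every order of its groups, * (c) $\theta^{mod}$, for its groups $1,\dots,k$ listed in increasing order of inferential importance, is proportional to $$\Big(\prod_{i_{C_1}\in\mathcal I_{C_1}}p^{C_1}(i_{C_1})\Big)^{1/2}\prod_{l=2}^k\prod_{i_{S_l}\in\mathcal I_{S_l}}\Big(\prod_{i_{R_l}\in\mathcal I_{R_l}}p^{R_l|i_{S_l}}(i_{R_l})\Big)^{1/2},$$ the probabilities being expressed in the relevant parameter. More explicitly: * for $\theta^{cond}$ this density equals $$\prod_{l=1}^k\prod_{i_{S_l}}\exp\Big\{\sum_{\emptyset\ne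 D\subseteq R_l}\sum_{i_D\in\mathcal I_D^*}\theta^{R_l|i_{S_l}}(i_D)\,\tilde n(i_{S_l},i_D)-\tilde n(i_{S_l})\log\Big(1+\sum_{\emptyset\ne D\subseteq R_l}\sum_{i_D\in\mathcal I^*_D}\exp\sum_{\emptyset\ne F\subseteq D}\theta^{R_l|i_{S_l}}(i_F)\Big)\Big\}$$ with $\tilde n(i_{S_l},i_D)=|\mathcal I_{R_l\setminus D}|/2$ and $\tilde n(i_{S_l})=|\mathcal I_{R_l}|/2$ (for $l=1$: $\tilde n(i_D)=|\mathcal I_{C_1\setminus D}|/2$, $\tilde N=|\mathcal I_{C_1}|/2$); * for $\theta^{cliq}$ it equals $$\prod_{l=1}^k\exp\Big\{\sum_{F\subseteq S_l}\sum_{\emptyset\ne D\subseteq R_l}\sum_{i_F\in\mathcal I_F^*,\,i_D\in\mathcal I_D^*}\theta^{C_l}(i_F,i_D)\,\tilde n(i_F,i_D)-\sum_{F\subseteq S_l}\sum_{j_F\in\mathcal I_F^*}\tilde n(j_F)\sum_{H\subseteq F}(-1)^{|F\setminus H|}k_l(j_H)\Big\},$$ $$k_l(j_H)=\log\Big(1+\sum_{\emptyset\ne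 D\subseteq R_l}\sum_{i_D\in\mathcal I_D^*}\exp\sum_{K\subseteq H,\ \emptyset\ne E\subseteq D}\theta^{C_l}(j_K,i_E)\Big),$$ with $\tilde n(i_F,i_D)=|\mathcal I_{S_l\setminus F}||\mathcal I_{R_l\setminus D}|/2$ and $\tilde n(j_F)=|\mathcal I_{S_l\setminus F}||\mathcal I_{R_l}|/2$; * for $\theta^{mod}$ it is the expression for $\theta^{cliq}$ in which, for $D\subseteq C_l$ with $D\cap R_l\neq\emptyset$, $$\theta^{C_l}(i_D)=\theta(i_D)+\sum_{F\subseteq D}(-1)^{|D\setminus F|}\log\Big(1+\sum_{\emptyset\ne E\subseteq V\setminus H_l}\ \sum_{j_E\in\mathcal I_E^*}\exp\sum_{K\subseteq F,\ \emptyset\ne M\subseteq E}\theta(i_K,j_M)\Big)$$ is substituted ($\theta(i_D)=0$ for $D$ not complete). The likelihood $\prod_{i}p(i)^{n(i)}$ has these same forms with the observed marginal counts in place of the fictitious ones, so the priors are conjugate. All three priors are proper (integrable). -/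

import Mathlib

open MeasureTheory Filter Topology

noncomputable section

namespace RefPrior

/-! ## Reference priors (ordered-groups algorithm)

The parameter is a vector `θ : κ → ℝ` ranging over the whole of `ℝ^κ`.  Its coordinates are split
into groups by `grp : κ → ℕ`; the groups are numbered `0, …, m - 1` in increasing order of
inferential importance (group `0` is the least important one). -/

section Reference

variable {κ : Type*} [Fintype κ] [DecidableEq κ]

/-- Partial derivative in the coordinate `a`. -/
def pderiv (a : κ) (g : (κ → ℝ) → ℝ) (θ : κ → ℝ) : ℝ :=
  fderiv ℝ g θ (Pi.single a 1)

/-- Fisher information matrix `- E_θ[∂_a ∂_b log f(X; θ)]` of a family `f θ` of probability mass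
functions on a finite sample space `s`. -/
def fisherInfo {X : Type*} (s : Finset X) (f : (κ → ℝ) → X → ℝ) (θ : κ → ℝ) : Matrix κ κ ℝ :=
  fun a b => - ∑ x ∈ s, f θ x * pderiv a (pderiv b (fun η => Real.log (f η x))) θ

/-- Let `S = I⁻¹`, let `S_j` be the block of `S` belonging to the groups that are at least as
important as group `j`, and let `H_j = S_j⁻¹`.  This is `h_j`, the block of `H_j` belonging to
group `j`. -/
def infoBlock (info : Matrix κ κ ℝ) (grp : κ → ℕ) (j : ℕ) :
    Matrix {a : κ // grp a = j} {a : κ // grp a = j} ℝ :=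
  ((info⁻¹.submatrix (Subtype.val : {a : κ // j ≤ grp a} → κ) Subtype.val)⁻¹).submatrix
    (fun a : {a : κ // grp a = j} => (⟨a.1, a.2.ge⟩ : {a : κ // j ≤ grp a}))
    (fun a : {a : κ // grp a = j} => (⟨a.1, a.2.ge⟩ : {a : κ // j ≤ grp a}))

/-- Replace the coordinates of `θ` in `P` by those of `x`. -/
def override (P : κ → Prop) [DecidablePred P] (θ : κ → ℝ) (x : {a : κ // P a} → ℝ) : κ → ℝ :=
  fun a => if h : P a then x ⟨a, h⟩ else θ a

/-- `seqPrior info grp K j θ` is the conditional density of the groups `0, …, j - 1` (the `j` least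
important ones) given the more important groups, on the product of the compact sets `K i`.  It is
built starting from the least important group: given the groups `> j`, the density of group `j` is
proportional, on `K j`, to `exp (½ E[log det h_j])`, the expectation being taken over the groups
`< j` with respect to the conditional density found in the preceding steps. -/
def seqPrior (info : (κ → ℝ) → Matrix κ κ ℝ) (grp : κ → ℕ)
    (K : (j : ℕ) → Set ({a : κ // grp a = j} → ℝ)) : ℕ → (κ → ℝ) → ℝ
  | 0 => fun _ => 1
  | j + 1 =>
    let w : (κ → ℝ) → ℝ := fun θ =>
      Real.exp (1 / 2 * ∫ x : {a : κ // grp a < j} → ℝ,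
        Real.log (infoBlock (info (override (fun a => grp a < j) θ x)) grp j).det *
          seqPrior info grp K j (override (fun a => grp a < j) θ x))
    fun θ => seqPrior info grp K j θ *
      ((K j).indicator (fun _ => w θ) (fun a => θ a.1) /
        ∫ y in K j, w (override (fun a => grp a = j) θ y))

/-- For each group an increasing sequence of compact sets exhausting the space of that group. -/
structure IsExhaustion (grp : κ → ℕ)
    (K : ℕ → (j : ℕ) → Set ({a : κ // grp a = j} → ℝ)) : Prop where
  compact : ∀ n j, IsCompact (K n j)
  mono : ∀ j, Monotone fun n => K n j
  union : ∀ j, ⋃ n, K n j = Set.univ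

/-- `π` is (up to a multiplicative constant) the reference prior for a parameter with information
matrix `info`, split by `grp` into `m` groups numbered in increasing order of importance: along
every exhaustion by products of compact sets, the priors `π_n` obtained on the compact sets satisfy
`π_n θ / π_n θ₀ → π θ / π θ₀`. -/
def IsReferencePrior (info : (κ → ℝ) → Matrix κ κ ℝ) (m : ℕ) (grp : κ → Fin m)
    (π : (κ → ℝ) → ℝ) : Prop :=
  (∀ θ, 0 < π θ) ∧
  ∀ K : ℕ → (j : ℕ) → Set ({a : κ // (grp a : ℕ) = j} → ℝ),
    IsExhaustion (fun a => (grp a : ℕ)) K →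
    ∀ θ θ₀ : κ → ℝ,
      Tendsto (fun n => seqPrior info (fun a => (grp a : ℕ)) (K n) m θ /
          seqPrior info (fun a => (grp a : ℕ)) (K n) m θ₀) atTop (𝓝 (π θ / π θ₀))

end Reference

/-! ## Graphs with a perfect ordering of the cliques -/

section Graph

variable {V : Type*} [DecidableEq V] {k : ℕ}

/-- The history `H_l`, the union of the cliques up to the `l`-th one. -/
def hist (C : Fin k → Finset V) (l : Fin k) : Finset V :=
  (Finset.univ.filter (· ≤ l)).biUnion C

/-- The separator `S_l = H_{l-1} ∩ C_l`; it is empty for the first clique. -/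
def sep (C : Fin k → Finset V) (l : Fin k) : Finset V :=
  C l ∩ (Finset.univ.filter (· < l)).biUnion C

/-- The residual `R_l = C_l \ S_l`; for the first clique it is the whole clique. -/
def res (C : Fin k → Finset V) (l : Fin k) : Finset V :=
  C l \ sep C l

/-- `C` lists the (maximal) cliques of `G`, without repetition, in a perfect order.  Such a list
exists exactly when `G` is decomposable. -/
structure IsPerfectOrder (G : SimpleGraph V) (C : Fin k → Finset V) : Prop where
  injective : Function.Injective C
  mem_iff : ∀ D : Finset V,
    (∃ l, C l = D) ↔ Maximal (fun E : Finset V => G.IsClique (E : Set V)) D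
  perfect : ∀ l : Fin k, (l : ℕ) ≠ 0 → ∃ i < l, sep C l ⊆ C i

/-- Every non-empty complete set lies in exactly one of the classes
`{D | D ⊆ C_l, D ∩ R_l ≠ ∅}`. -/
theorem IsPerfectOrder.existsUnique_group {G : SimpleGraph V} [Finite V] {C : Fin k → Finset V}
    (hC : IsPerfectOrder G C) (D : Finset V) (hD : D.Nonempty) (hG : G.IsClique (D : Set V)) :
    ∃! l, D ⊆ C l ∧ (D ∩ res C l).Nonempty := by
  classical
  have hex : ∃ l, D ⊆ C l := by
    obtain ⟨E, hE, hmax⟩ := Set.Finite.exists_le_maximal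
      (Set.toFinite {E : Finset V | G.IsClique (E : Set V)}) hG
    obtain ⟨l, hl⟩ := (hC.mem_iff E).2 hmax
    exact ⟨l, hl ▸ hE⟩
  have hle : ∀ l m, D ⊆ C l → D ⊆ C m → (D ∩ res C m).Nonempty → m ≤ l := by
    intro l m h1 h2 ⟨v, hv⟩
    by_contra hlt
    rw [Finset.mem_inter, res, Finset.mem_sdiff, sep] at hv
    refine hv.2.2 (Finset.mem_inter.2 ⟨hv.2.1, Finset.mem_biUnion.2 ⟨l, ?_, h1 hv.1⟩⟩)
    simpa using hlt
  obtain ⟨l, hl, hmin⟩ : ∃ l, D ⊆ C l ∧ ∀ i, D ⊆ C i → l ≤ i := by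
    have hne : (Finset.univ.filter fun l => D ⊆ C l).Nonempty := by
      obtain ⟨l, hl⟩ := hex
      exact ⟨l, by simpa using hl⟩
    refine ⟨Finset.min' _ hne, by simpa using Finset.min'_mem _ hne, fun i hi => ?_⟩
    exact Finset.min'_le _ _ (by simpa using hi)
  have hres : (D ∩ res C l).Nonempty := by
    by_contra hcon
    have hsub : D ⊆ sep C l := by
      intro v hv
      by_contra hvs
      exact hcon ⟨v, Finset.mem_inter.2 ⟨hv, Finset.mem_sdiff.2 ⟨hl hv, hvs⟩⟩⟩
    by_cases h0 : (l : ℕ) = 0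
    · obtain ⟨v, hv⟩ := hD
      have := hsub hv
      rw [sep, Finset.mem_inter, Finset.mem_biUnion] at this
      obtain ⟨_, i, hi, _⟩ := this
      simp only [Finset.mem_filter, Finset.mem_univ, true_and, Fin.lt_def] at hi
      omega
    · obtain ⟨i, hi, his⟩ := hC.perfect l h0
      exact absurd (hmin i (hsub.trans his)) (not_le.2 hi)
  exact ⟨l, ⟨hl, hres⟩, fun m hm => le_antisymm (hle l m hl hm.1 hm.2) (hle m l hm.1 hl hres)⟩

end Graph

/-! ## Contingency tables

Each vertex `v` has a finite set `L v` of levels with a distinguished level `0`.  A marginal cell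
`i_D` is represented by the full cell `(i_D, i^*_{V∖D})` that has level `0` outside `D`.  So the
cells of `I_D` are the full cells vanishing outside `D`, the elements of `I_D^*` are the full cells
whose support is exactly `D`, and a pair `(D, i_D)` with `i_D ∈ I_D^*` is just a full cell. -/

section Table

variable {V : Type*} [Fintype V] [DecidableEq V] {L : V → Type*} [∀ v, Fintype (L v)]
  [∀ v, DecidableEq (L v)] [∀ v, Zero (L v)] {k : ℕ}

/-- The cells of the full table. -/
abbrev Cell (L : V → Type*) := (v : V) → L v

/-- The set of coordinates at which a cell has a non-zero level. -/
def supp (i : Cell L) : Finset V := Finset.univ.filter fun v => i v ≠ 0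

/-- The cell `(i_D, i^*_{V∖D})`. -/
def restrict (D : Finset V) (i : Cell L) : Cell L := fun v => if v ∈ D then i v else 0

/-- The cell `(i_A, j_{V∖A})`. -/
def glue (A : Finset V) (i j : Cell L) : Cell L := fun v => if v ∈ A then i v else j v

/-- `a` is of the form `(i_F, i^*_{V∖F})` with `F ⊆ supp i`. -/
def SubCell (a i : Cell L) : Prop := ∀ v, a v ≠ 0 → a v = i v

instance (a i : Cell L) : Decidable (SubCell a i) :=
  inferInstanceAs (Decidable (∀ v, a v ≠ 0 → a v = i v))

/-- The cells `I_D` of the `D`-marginal table. -/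
abbrev Table (L : V → Type*) [∀ v, Zero (L v)] (D : Finset V) :=
  {i : Cell L // ∀ v, v ∉ D → i v = 0}

/-- The disjoint union of the `I_F^*` over the non-empty subsets `F` of `D`. -/
abbrev NZ (L : V → Type*) [∀ v, Zero (L v)] (D : Finset V) :=
  {i : Cell L // (∀ v, v ∉ D → i v = 0) ∧ ∃ v, i v ≠ 0}

/-- The marginal `q^D(i_D)` of a function `q` on the table (probabilities or counts). -/
def marg (q : Cell L → ℝ) (D : Finset V) (i : Cell L) : ℝ :=
  ∑ j : Cell L with ∀ v ∈ D, j v = i v, q j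

/-- The conditional probability `p^{A|i_B}(i_A)`. -/
def condProb (p : Cell L → ℝ) (A B : Finset V) (i : Cell L) : ℝ :=
  marg p (A ∪ B) i / marg p B i

/-- The positive probability vectors that are (pairwise) Markov with respect to `G`: for
non-adjacent `γ ≠ δ`, the variables `X_γ` and `X_δ` are independent given all the others. -/
def markovModel (G : SimpleGraph V) : Set (Cell L → ℝ) :=
  {p | (∀ i, 0 < p i) ∧ ∑ i, p i = 1 ∧
    ∀ γ δ : V, γ ≠ δ → ¬ G.Adj γ δ → ∀ i,
      p i * marg p (Finset.univ \ {γ, δ}) i =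
        marg p (Finset.univ \ {γ}) i * marg p (Finset.univ \ {δ}) i}

/-- The multinomial probability of the table of counts `n`. -/
def multinomialPMF (p : Cell L → ℝ) (n : Cell L → ℕ) : ℝ :=
  Nat.multinomial Finset.univ n * ∏ i, p i ^ n i

/-- The information matrix of the multinomial model with sample size `N` and cell probabilities
`P θ`. -/
def multinomialInfo {κ : Type*} [Fintype κ] [DecidableEq κ] (N : ℕ) (P : (κ → ℝ) → Cell L → ℝ) :
    (κ → ℝ) → Matrix κ κ ℝ :=
  fisherInfo (Finset.piAntidiag (Finset.univ : Finset (Cell L)) N)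
    (fun θ n => multinomialPMF (P θ) n)

/-- The generalized log-odds-ratio
`log ∏_{F ⊆ D} q(i_F, i^*)^{(-1)^{|D∖F|}}` of `i_D`, where `D = supp i`. -/
def logOdds (q : Cell L → ℝ) (i : Cell L) : ℝ :=
  Real.log (∏ F ∈ (supp i).powerset, q (restrict F i) ^ ((-1 : ℤ) ^ (supp i \ F).card))

/-- `P` parametrizes the model `M` by `ℝ^κ`, and `T` is the inverse of `P`. -/
structure IsParametrization {κ : Type*} (M : Set (Cell L → ℝ)) (P : (κ → ℝ) → Cell L → ℝ)
    (T : (Cell L → ℝ) → κ → ℝ) : Prop where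
  mem : ∀ θ, P θ ∈ M
  left_inv : ∀ θ, T (P θ) = θ
  right_inv : ∀ p ∈ M, P (T p) = p

/-! ### The three parametrizations

The first clique is treated together with the others: as `S_1 = ∅` and `R_1 = C_1`, the
`i_{S_1}`-slices reduce to the `C_1`-marginal table and `p^{R_1|i_{S_1}} = p^{C_1}`. -/

/-- The groups of `θ^cond`: pairs `(l, i_{S_l})`. -/
abbrev CondGroup (L : V → Type*) [∀ v, Zero (L v)] (C : Fin k → Finset V) :=
  Σ l : Fin k, Table L (sep C l)

/-- The index set of `θ^cond`: a group `(l, i_{S_l})` together with `i_D`, where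
`∅ ≠ D ⊆ R_l`, `i_D ∈ I_D^*`. -/
abbrev CondIdx (L : V → Type*) [∀ v, Zero (L v)] (C : Fin k → Finset V) :=
  Σ g : CondGroup L C, NZ L (res C g.1)

/-- The cells `i_D ∈ I_D^*` with `D ⊆ C_l` and `D ∩ R_l ≠ ∅`; equivalently the pairs `(i_F, i_E)`
with `F ⊆ S_l` and `∅ ≠ E ⊆ R_l`. -/
abbrev CliqCell (L : V → Type*) [∀ v, Zero (L v)] (C : Fin k → Finset V) (l : Fin k) :=
  {i : Cell L // (∀ v, v ∉ C l → i v = 0) ∧ ∃ v ∈ res C l, i v ≠ 0}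

/-- The index set of `θ^cliq` and of `θ^mod`, split into the groups `l`.  By
`IsPerfectOrder.existsUnique_group` its elements correspond to the `i_D ∈ I_D^*` with `D` a
non-empty complete set. -/
abbrev CliqIdx (L : V → Type*) [∀ v, Zero (L v)] (C : Fin k → Finset V) :=
  Σ l : Fin k, CliqCell L C l

/-- `θ^{R_l|i_{S_l}}(i_D)` as functions of the cell probabilities. -/
def thetaCond (C : Fin k → Finset V) (p : Cell L → ℝ) : CondIdx L C → ℝ :=
  fun a => logOdds
    (fun j => condProb p (res C a.1.1) (sep C a.1.1) (glue (sep C a.1.1) a.1.2.1 j)) a.2.1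

/-- `θ^{C_l}(i_D)` as functions of the cell probabilities. -/
def thetaCliq (C : Fin k → Finset V) (p : Cell L → ℝ) : CliqIdx L C → ℝ :=
  fun a => logOdds (marg p (C a.1)) a.2.1

/-- `θ(i_D)` as functions of the cell probabilities. -/
def thetaMod (C : Fin k → Finset V) (p : Cell L → ℝ) : CliqIdx L C → ℝ :=
  fun a => logOdds p a.2.1

/-- `ξ^{R_l|i_{S_l}}(i_D) = ∑_{∅ ≠ F ⊆ D} θ^{R_l|i_{S_l}}(i_F)`. -/
def xi (C : Fin k → Finset V) (θ : CondIdx L C → ℝ) (g : CondGroup L C) (j : Cell L) : ℝ :=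
  ∑ a : NZ L (res C g.1) with SubCell a.1 j, θ ⟨g, a⟩

/-- The cell probabilities in terms of `θ^cond`: the product over `l` of
`p^{R_l|i_{S_l}}(i_{R_l}) = exp ξ(i_{R_l}) / (1 + ∑_j exp ξ(j))`. -/
def pCond (C : Fin k → Finset V) (θ : CondIdx L C → ℝ) (i : Cell L) : ℝ :=
  ∏ l : Fin k,
    let g : CondGroup L C :=
      ⟨l, ⟨restrict (sep C l) i, fun _ hv => if_neg hv⟩⟩
    Real.exp (xi C θ g (restrict (res C l) i)) /
      (1 + ∑ j : NZ L (res C l), Real.exp (xi C θ g j.1))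

/-- `θ^cond` in terms of `θ^cliq`:
`θ^{R_l|(i_F, i^*)}(i_D) = ∑_{K ⊆ F} θ^{C_l}(i_K, i_D)`. -/
def condOfCliq (C : Fin k → Finset V) (θ : CliqIdx L C → ℝ) : CondIdx L C → ℝ :=
  fun a => ∑ b : CliqCell L C a.1.1 with
    restrict (res C a.1.1) b.1 = a.2.1 ∧ SubCell b.1 (glue (sep C a.1.1) a.1.2.1 a.2.1),
    θ ⟨a.1.1, b⟩

/-- The cell probabilities in terms of `θ^cliq`. -/
def pCliq (C : Fin k → Finset V) (θ : CliqIdx L C → ℝ) : Cell L → ℝ :=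
  pCond C (condOfCliq C θ)

/-- The cell probabilities in terms of `θ^mod`: `p(i)` is proportional to
`exp ∑ θ(i_D)`, the sum being over the non-empty complete `D ⊆ supp i`. -/
def pMod (C : Fin k → Finset V) (θ : CliqIdx L C → ℝ) (i : Cell L) : ℝ :=
  Real.exp (∑ a : CliqIdx L C with SubCell a.2.1 i, θ a) /
    ∑ j : Cell L, Real.exp (∑ a : CliqIdx L C with SubCell a.2.1 j, θ a)

/-- `θ^cliq` in terms of `θ^mod`:
`θ^{C_l}(i_D) = θ(i_D) + ∑_{F ⊆ D} (-1)^{|D∖F|} k(θ(i_{⊆F}, 𝒟^A))`, where `A = V ∖ H_l` is the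
union of the residuals after the `l`-th one and
`k(θ(i_{⊆F}, 𝒟^A)) = log (1 + ∑_{∅ ≠ E ⊆ A} ∑_{j_E ∈ I_E^*} exp ∑_{K ⊆ F, ∅ ≠ G ⊆ E} θ(i_K, j_G))`. -/
def cliqOfMod (C : Fin k → Finset V) (θ : CliqIdx L C → ℝ) : CliqIdx L C → ℝ :=
  fun b => θ b + ∑ F ∈ (supp b.2.1).powerset, (-1) ^ (supp b.2.1 \ F).card *
    Real.log (1 + ∑ j : NZ L (Finset.univ \ hist C b.1), Real.exp
      (∑ a : CliqIdx L C with
        SubCell a.2.1 (glue (hist C b.1) (restrict F b.2.1) j.1) ∧ ∃ v ∉ hist C b.1, a.2.1 v ≠ 0,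
        θ a))

/-! ### The prior densities -/

/-- `∏_{i_{C_1}} p(i_{C_1})^{1/2} ∏_{l ≥ 2} ∏_{i_{S_l}} ∏_{i_{R_l}} p^{R_l|i_{S_l}}(i_{R_l})^{1/2}`,
the first product being the factor `l = 1` of the product below. -/
def refDensity (C : Fin k → Finset V) (p : Cell L → ℝ) : ℝ :=
  ∏ l : Fin k, ∏ s : Table L (sep C l),
    (∏ r : Table L (res C l), condProb p (res C l) (sep C l) (glue (sep C l) s.1 r.1)) ^
      (1 / 2 : ℝ)

/-- The NEF form in `θ^cond` with counts `n(i_{S_l}, i_D)` and `n(i_{S_l})`: the product of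
`exp (⟨θ(i_{S_l}, 𝒟^{R_l}), n(i_{S_l}, 𝒟^{R_l})⟩ - n(i_{S_l}) k(θ(i_{S_l}, 𝒟^{R_l})))`. -/
def nefCond (C : Fin k → Finset V) (nD : CondIdx L C → ℝ) (nS : CondGroup L C → ℝ)
    (θ : CondIdx L C → ℝ) : ℝ :=
  ∏ g : CondGroup L C, Real.exp
    ((∑ a : NZ L (res C g.1), θ ⟨g, a⟩ * nD ⟨g, a⟩) -
      nS g * Real.log (1 + ∑ j : NZ L (res C g.1), Real.exp (xi C θ g j.1)))

/-- `k(θ(h_{⊆F}, 𝒟^{R_l})) = log (1 + ∑_{j} exp ∑_{K ⊆ F, ∅ ≠ G ⊆ supp j} θ^{C_l}(h_K, j_G))`,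
where `F ⊆ S_l` is the support of `h` and `j` runs over the non-zero cells of the `R_l`-table. -/
def kCliq (C : Fin k → Finset V) (θ : CliqIdx L C → ℝ) (l : Fin k) (h : Cell L) : ℝ :=
  Real.log (1 + ∑ j : NZ L (res C l), Real.exp
    (∑ a : CliqCell L C l with SubCell a.1 (glue (sep C l) h j.1), θ ⟨l, a⟩))

/-- The NEF form in `θ^cliq` with counts `n(i_F, i_D)` and `n(j_F)`: the product over `l` of
`exp (⟨θ, n⟩ - ∑_{F ⊆ S_l} ∑_{j_F ∈ I_F^*} n(j_F) ∑_{H ⊆ F} (-1)^{|F∖H|} k(θ(j_{⊆H}, 𝒟^{R_l})))`. -/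
def nefCliq (C : Fin k → Finset V) (nD : CliqIdx L C → ℝ) (nS : CondGroup L C → ℝ)
    (θ : CliqIdx L C → ℝ) : ℝ :=
  ∏ l : Fin k, Real.exp
    ((∑ a : CliqCell L C l, θ ⟨l, a⟩ * nD ⟨l, a⟩) -
      ∑ f : Table L (sep C l), nS ⟨l, f⟩ *
        ∑ H ∈ (supp f.1).powerset,
          (-1) ^ (supp f.1 \ H).card * kCliq C θ l (restrict H f.1))

end Table

end RefPrior

end

/-!
# Reference priors for decomposable graphical models

Along the perfect order, `p = ∏_l p^{R_l | S_l}`. The parameter `θ^cond` describes each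
conditional distribution, for each level of the separator, by its log-odds ratios to the zero
cell, and Möbius inversion (`sum_subCell_mob`, `xi_of_mob`) recovers the distribution from them.
Conversely, a positive Markov distribution has no interactions on incomplete sets
(`mob_log_eq_zero`, Hammersley-Clifford), so it is a product of clique potentials and, by the
perfect order, a product of conditional probabilities (`exists_eq_pCond`). On the level `i_S`, the
conditional log-odds ratios are sums of clique interactions, so `θ^cond` is a linear function of
`θ^cliq` that respects the grouping by cliques (`condOfCliqLin`). Finally `θ^cliq` is obtained
from `θ^mod` by a shear: the parameters of a clique are shifted by a function of those of the
later cliques (`pMod_eq_pCliq`, `isShear_cliqOfMod`).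

Since the log-likelihood splits, the Fisher information of `θ^cond` is block diagonal. The block
of `(l, i_S)` is `N p^S(i_S)` times a multinomial covariance matrix, so its determinant is a
constant times `p^S(i_S)^n ∏_r p^{R | i_S}(r)` (`det_multinomialInfo_pCond`). A linear change of
coordinates inside the groups contributes a constant, and a shear has a block unitriangular
Jacobian, which does not change the matrices `h_j` (`infoBlock_transpose_mul_mul`). Thus in all
three cases `log det h_j = 2 log F_j + β_j`, where `F_j`, the product of the `(∏_r p^{R |
i_S}(r))^{1/2}` of group `j`, involves this group only, and `β_j`, which collects constants and
logs of separator probabilities, does not involve it (`GroupedCoords.log_det_infoBlock`).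

The structure `ShearModel` isolates what the ordered-groups algorithm needs. The expectation over
the less important groups leaves `log F_j` alone (`integral_mul_seqPrior`) and turns `β_j` into a
function of the more important groups, up to the shear; this function cancels when the density of
group `j` is normalized. What remains is `F_j`, divided by its integral over a compact set. That
integral converges, because `F_j` decays exponentially (`GroupedCoords.exists_logPrior_le`) while
the averages of `β_j` grow at most linearly, uniformly in the compact sets
(`exists_linGrowth_avg`), so that dominated convergence applies at each stage
(`ShearModel.tendsto_setIntegral`). The shear only translates group `j`, hence the limit of the
integral is a constant, and the reference prior is `∏_j F_j` (`ShearModel.isReferencePrior`).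

The explicit forms are rewritings of the factorization (`refDensity_pCond`, `nefCond_condOfCliq`).
The prior is proper by the exponential decay, and for `θ^mod` because a shear preserves the volume
(`IsShear.integrable_comp`).
-/

open MeasureTheory Filter Topology

set_option linter.unusedSectionVars false

noncomputable section

namespace RefPrior

/-! ### Möbius inversion over the subcells of a cell -/

section Moebius

variable {V : Type*} [DecidableEq V]

theorem sum_powerset_neg_one_pow_card_real (s : Finset V) :
    ∑ t ∈ s.powerset, (-1 : ℝ) ^ t.card = if s = ∅ then 1 else 0 := by
  have h := Finset.sum_powerset_neg_one_pow_card (x := s)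
  have h' := congrArg (Int.cast : ℤ → ℝ) h
  push_cast at h'
  simpa using h'

theorem sum_moebius_upper (D A : Finset V) (h : A ⊆ D) :
    ∑ F ∈ D.powerset with A ⊆ F, (-1 : ℝ) ^ (D \ F).card = if A = D then 1 else 0 := by
  have h1 : ∑ F ∈ D.powerset with A ⊆ F, (-1 : ℝ) ^ (D \ F).card
      = ∑ t ∈ (D \ A).powerset, (-1 : ℝ) ^ t.card := by
    refine Finset.sum_nbij' (fun F => D \ F) (fun t => D \ t) ?_ ?_ ?_ ?_ ?_
    · intro F hF; simp only [Finset.mem_filter, Finset.mem_powerset] at hF ⊢; grind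
    · intro F hF; simp only [Finset.mem_filter, Finset.mem_powerset] at hF ⊢; grind
    · intro F hF; simp only [Finset.mem_filter, Finset.mem_powerset] at hF ⊢; grind
    · intro F hF; simp only [Finset.mem_powerset] at hF ⊢; grind
    · intro F hF; rfl
  rw [h1, sum_powerset_neg_one_pow_card_real]
  congr 1
  simp only [Finset.sdiff_eq_empty_iff_subset, eq_iff_iff]
  exact ⟨fun h' => h.antisymm h', fun h' => h' ▸ subset_rfl⟩

theorem sum_moebius_lower (D A : Finset V) (h : A ⊆ D) :
    ∑ F ∈ D.powerset with A ⊆ F, (-1 : ℝ) ^ (F \ A).card = if A = D then 1 else 0 := by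
  have h1 : ∑ F ∈ D.powerset with A ⊆ F, (-1 : ℝ) ^ (F \ A).card
      = ∑ t ∈ (D \ A).powerset, (-1 : ℝ) ^ t.card := by
    refine Finset.sum_nbij' (fun F => F \ A) (fun t => t ∪ A) ?_ ?_ ?_ ?_ ?_
    · intro F hF; simp only [Finset.mem_filter, Finset.mem_powerset] at hF ⊢; grind
    · intro F hF; simp only [Finset.mem_filter, Finset.mem_powerset] at hF ⊢; grind
    · intro F hF; simp only [Finset.mem_filter, Finset.mem_powerset] at hF ⊢; grind
    · intro F hF; simp only [Finset.mem_powerset] at hF ⊢; grind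
    · intro F hF; rfl
  rw [h1, sum_powerset_neg_one_pow_card_real]
  congr 1
  simp only [Finset.sdiff_eq_empty_iff_subset, eq_iff_iff]
  exact ⟨fun h' => h.antisymm h', fun h' => h' ▸ subset_rfl⟩

theorem sum_sum_moebius (D : Finset V) (g : Finset V → ℝ) :
    ∑ A ∈ D.powerset, ∑ F ∈ A.powerset, (-1 : ℝ) ^ (A \ F).card * g F = g D := by
  have h1 : ∑ A ∈ D.powerset, ∑ F ∈ A.powerset, (-1 : ℝ) ^ (A \ F).card * g F
      = ∑ F ∈ D.powerset, ∑ A ∈ D.powerset with F ⊆ A, (-1 : ℝ) ^ (A \ F).card * g F := by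
    refine Finset.sum_comm' ?_
    intro A F
    simp only [Finset.mem_filter, Finset.mem_powerset]
    exact ⟨fun ⟨a, b⟩ => ⟨⟨a, b⟩, b.trans a⟩, fun ⟨a, _⟩ => a⟩
  rw [h1, Finset.sum_eq_single D]
  · rw [← Finset.sum_mul, sum_moebius_lower D D subset_rfl]; simp
  · intro F hF hne
    rw [← Finset.sum_mul, sum_moebius_lower D F (Finset.mem_powerset.1 hF)]; simp [hne]
  · simp

theorem sum_moebius_sum (D : Finset V) (u : Finset V → ℝ) :
    ∑ F ∈ D.powerset, (-1 : ℝ) ^ (D \ F).card * ∑ A ∈ F.powerset, u A = u D := by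
  simp_rw [Finset.mul_sum]
  have h1 : ∑ F ∈ D.powerset, ∑ A ∈ F.powerset, (-1 : ℝ) ^ (D \ F).card * u A
      = ∑ A ∈ D.powerset, ∑ F ∈ D.powerset with A ⊆ F, (-1 : ℝ) ^ (D \ F).card * u A := by
    refine Finset.sum_comm' ?_
    intro A F
    simp only [Finset.mem_filter, Finset.mem_powerset]
    exact ⟨fun ⟨a, b⟩ => ⟨⟨a, b⟩, b.trans a⟩, fun ⟨a, _⟩ => a⟩
  rw [h1, Finset.sum_eq_single D]
  · rw [← Finset.sum_mul, sum_moebius_upper D D subset_rfl]; simp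
  · intro F hF hne
    rw [← Finset.sum_mul, sum_moebius_upper D F (Finset.mem_powerset.1 hF)]; simp [hne]
  · simp

end Moebius

section Cells

variable {V : Type*} [Fintype V] [DecidableEq V] {L : V → Type*} [∀ v, Fintype (L v)]
  [∀ v, DecidableEq (L v)] [∀ v, Zero (L v)]

theorem mem_supp {i : Cell L} {v : V} : v ∈ supp i ↔ i v ≠ 0 := by simp [supp]

theorem subCell_restrict (F : Finset V) (i : Cell L) : SubCell (restrict F i) i := by
  intro v hv; simp only [restrict] at hv ⊢; split_ifs at hv ⊢ <;> simp_all

theorem SubCell.restrict_supp {a i : Cell L} (h : SubCell a i) : restrict (supp a) i = a := by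
  funext v
  by_cases hv : a v = 0
  · simp [restrict, mem_supp, hv]
  · rw [restrict, if_pos (mem_supp.2 hv), h v hv]

theorem SubCell.supp_subset {a i : Cell L} (h : SubCell a i) : supp a ⊆ supp i := by
  intro v hv; rw [mem_supp] at *; rw [← h v hv]; exact hv

theorem SubCell.trans {a b c : Cell L} (h : SubCell a b) (h' : SubCell b c) : SubCell a c := by
  intro v hv; have := h v hv; rw [this, h' v (this ▸ hv)]

theorem supp_restrict (F : Finset V) (i : Cell L) : supp (restrict F i) = supp i ∩ F := by
  ext v; simp only [mem_supp, restrict, Finset.mem_inter]; split_ifs with h <;> simp [h]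

theorem restrict_restrict (F D : Finset V) (i : Cell L) :
    restrict F (restrict D i) = restrict (F ∩ D) i := by
  funext v; by_cases h1 : v ∈ F <;> by_cases h2 : v ∈ D <;> simp [restrict, h1, h2]

theorem restrict_eq_self {D : Finset V} {i : Cell L} (h : ∀ v, v ∉ D → i v = 0) :
    restrict D i = i := by
  funext v; by_cases h1 : v ∈ D <;> simp [restrict, h1, h]

theorem restrict_congr {D : Finset V} {i j : Cell L} (h : ∀ v ∈ D, i v = j v) :
    restrict D i = restrict D j := by
  funext v; by_cases h1 : v ∈ D <;> simp [restrict, h1, h]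

theorem sum_subCell (i : Cell L) (u : Cell L → ℝ) :
    ∑ a : Cell L with SubCell a i, u a = ∑ F ∈ (supp i).powerset, u (restrict F i) := by
  refine Finset.sum_nbij' (fun a => supp a) (fun F => restrict F i) ?_ ?_ ?_ ?_ ?_
  · intro a ha; simp only [Finset.mem_filter, Finset.mem_univ, true_and] at ha
    exact Finset.mem_powerset.2 ha.supp_subset
  · intro F hF; simp [subCell_restrict]
  · intro a ha; simp only [Finset.mem_filter, Finset.mem_univ, true_and] at ha
    exact ha.restrict_supp
  · intro F hF; rw [supp_restrict]; exact Finset.inter_eq_right.2 (Finset.mem_powerset.1 hF)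
  · intro a ha; simp only [Finset.mem_filter, Finset.mem_univ, true_and] at ha
    rw [ha.restrict_supp]

/-- The Möbius transform `∑_{F ⊆ D} (-1)^{|D∖F|} φ(i_F, i^*)`, where `D = supp i`, of a function on
the cells. -/
def mob (φ : Cell L → ℝ) (i : Cell L) : ℝ :=
  ∑ F ∈ (supp i).powerset, (-1) ^ (supp i \ F).card * φ (restrict F i)

/-- Möbius inversion: `φ` is the cumulative sum of `mob φ` over subcells. -/
theorem sum_subCell_mob (φ : Cell L → ℝ) (i : Cell L) :
    ∑ a : Cell L with SubCell a i, mob φ a = φ i := by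
  rw [sum_subCell]
  have h := sum_sum_moebius (supp i) (fun F => φ (restrict F i))
  rw [restrict_eq_self (D := supp i) (i := i) (by intro v hv; simpa [mem_supp] using hv)] at h
  rw [← h]
  refine Finset.sum_congr rfl fun A hA => ?_
  have hA' := Finset.mem_powerset.1 hA
  have hs : supp (restrict A i) = A := by rw [supp_restrict]; exact Finset.inter_eq_right.2 hA'
  rw [mob, hs]
  refine Finset.sum_congr rfl fun F hF => ?_
  rw [restrict_restrict, Finset.inter_eq_left.2 (Finset.mem_powerset.1 hF)]

theorem mob_sum_subCell (u : Cell L → ℝ) (i : Cell L) :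
    mob (fun j => ∑ a : Cell L with SubCell a j, u a) i = u i := by
  have h := sum_moebius_sum (supp i) (fun F => u (restrict F i))
  rw [restrict_eq_self (D := supp i) (i := i) (by intro v hv; simpa [mem_supp] using hv)] at h
  rw [← h, mob]
  refine Finset.sum_congr rfl fun A hA => ?_
  have hA' := Finset.mem_powerset.1 hA
  have hs : supp (restrict A i) = A := by rw [supp_restrict]; exact Finset.inter_eq_right.2 hA'
  rw [sum_subCell, hs]
  congr 1
  refine Finset.sum_congr rfl fun F hF => ?_
  rw [restrict_restrict, Finset.inter_eq_left.2 (Finset.mem_powerset.1 hF)]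

/-- Möbius inversion, uniqueness: `mob φ` is the only function whose cumulative sum over subcells
is `φ`. -/
theorem mob_eq_of_eq_sum {φ u : Cell L → ℝ}
    (h : ∀ j, φ j = ∑ a : Cell L with SubCell a j, u a) (i : Cell L) : mob φ i = u i := by
  rw [← mob_sum_subCell u i]; congr 1; funext j; exact h j

theorem mob_zero_cell (φ : Cell L → ℝ) : mob φ 0 = φ 0 := by
  have : supp (0 : Cell L) = ∅ := by ext v; simp [mem_supp]
  simp only [mob, this, Finset.powerset_empty, Finset.sum_singleton, Finset.sdiff_self,
    Finset.card_empty, pow_zero, one_mul]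
  congr 1

theorem mob_add (φ ψ : Cell L → ℝ) (i : Cell L) :
    mob (fun j => φ j + ψ j) i = mob φ i + mob ψ i := by
  simp only [mob, mul_add, Finset.sum_add_distrib]

theorem mob_sub (φ ψ : Cell L → ℝ) (i : Cell L) :
    mob (fun j => φ j - ψ j) i = mob φ i - mob ψ i := by
  simp only [mob, mul_sub, Finset.sum_sub_distrib]

/-- The Möbius transform of a function that ignores a coordinate vanishes at the cells whose level
there is non-zero. -/
theorem mob_eq_zero {φ : Cell L → ℝ} {D : Finset V} (hφ : DependsOn φ (D : Set V)) {i : Cell L}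
    {v : V} (hv : i v ≠ 0) (hD : v ∉ D) : mob φ i = 0 := by
  have h : ∀ j, φ j = ∑ a : Cell L with SubCell a j, if a v = 0 then mob φ a else 0 := by
    intro j
    have h1 : φ j = φ (restrict (Finset.univ \ {v}) j) := by
      apply hφ
      intro w hw
      have : w ≠ v := fun h => hD (h ▸ hw)
      simp [restrict, this]
    rw [h1, ← sum_subCell_mob φ (restrict (Finset.univ \ {v}) j), ← Finset.sum_filter,
      Finset.filter_filter]
    refine Finset.sum_congr ?_ fun _ _ => rfl
    ext a
    simp only [Finset.mem_filter, Finset.mem_univ, true_and]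
    constructor
    · intro ha
      refine ⟨ha.trans (subCell_restrict _ _), ?_⟩
      by_contra hne
      have := ha v hne
      simp [restrict] at this
      exact hne this
    · rintro ⟨ha, h0⟩ w hw
      have : w ≠ v := fun h => hw (h ▸ h0)
      rw [ha w hw]; simp [restrict, this]
  rw [mob_eq_of_eq_sum h i, if_neg hv]

theorem logOdds_eq_mob {q : Cell L → ℝ} (hq : ∀ i, 0 < q i) (i : Cell L) :
    logOdds q i = mob (fun j => Real.log (q j)) i := by
  rw [logOdds, mob, Real.log_prod]
  · refine Finset.sum_congr rfl fun F _ => ?_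
    rw [Real.log_zpow]; push_cast; rfl
  · intro F _; exact (zpow_pos (hq _) _).ne'

/-! ### Marginals -/

theorem marg_pos {q : Cell L → ℝ} (hq : ∀ i, 0 < q i) (D : Finset V) (i : Cell L) :
    0 < marg q D i :=
  Finset.sum_pos (fun j _ => hq j) ⟨i, by simp⟩

theorem dependsOn_marg (q : Cell L → ℝ) (D : Finset V) : DependsOn (marg q D) (D : Set V) := by
  intro i j h
  rw [marg, marg]
  refine Finset.sum_congr ?_ fun _ _ => rfl
  ext a
  simp only [Finset.mem_filter, Finset.mem_univ, true_and]
  refine forall₂_congr fun v hv => ?_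
  rw [h v hv]

theorem marg_univ (q : Cell L → ℝ) (i : Cell L) : marg q Finset.univ i = q i := by
  rw [marg, Finset.sum_eq_single i]
  · intro j hj hne
    simp only [Finset.mem_filter, Finset.mem_univ, true_and, forall_const] at hj
    exact absurd (funext hj) hne
  · simp

theorem marg_empty (q : Cell L → ℝ) (i : Cell L) : marg q ∅ i = ∑ j, q j := by
  simp [marg]

/-- Functions of the retained coordinates can be taken out of a marginal. -/
theorem marg_mul {f : Cell L → ℝ} {D : Finset V} (hf : DependsOn f (D : Set V)) (q : Cell L → ℝ)
    (i : Cell L) : marg (fun j => f j * q j) D i = f i * marg q D i := by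
  rw [marg, marg, Finset.mul_sum]
  refine Finset.sum_congr rfl fun j hj => ?_
  simp only [Finset.mem_filter, Finset.mem_univ, true_and] at hj
  rw [hf (fun v hv => hj v hv)]

/-- Summing out `V∖A` and then `V∖B` is summing out `V∖(A ∩ B)` if the two sets are disjoint. -/
theorem marg_marg (q : Cell L → ℝ) {A B : Finset V} (h : A ∪ B = Finset.univ) (i : Cell L) :
    marg (marg q A) B i = marg q (A ∩ B) i := by
  simp only [marg]
  have h1 : ∀ j' : Cell L, (∀ v ∈ A ∩ B, j' v = i v) →
      (Finset.univ.filter fun j : Cell L => (∀ v ∈ B, j v = i v) ∧ ∀ v ∈ A, j' v = j v)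
        = {glue B i j'} := by
    intro j' hj'
    ext j
    simp only [Finset.mem_filter, Finset.mem_univ, true_and, Finset.mem_singleton]
    constructor
    · rintro ⟨h1, h2⟩
      funext v
      by_cases hv : v ∈ B
      · simp [glue, hv, h1]
      · have : v ∈ A := by have := Finset.mem_univ v; rw [← h] at this; simp at this; tauto
        simp [glue, hv, h2 v this]
    · rintro rfl
      refine ⟨fun v hv => by simp [glue, hv], fun v hv => ?_⟩
      by_cases hB : v ∈ B
      · simp [glue, hB, hj' v (Finset.mem_inter.2 ⟨hv, hB⟩)]
      · simp [glue, hB]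
  calc ∑ j : Cell L with ∀ v ∈ B, j v = i v, ∑ j' : Cell L with ∀ v ∈ A, j' v = j v, q j'
      = ∑ j' : Cell L with ∀ v ∈ A ∩ B, j' v = i v,
          ∑ j : Cell L with (∀ v ∈ B, j v = i v) ∧ ∀ v ∈ A, j' v = j v, q j' := by
        refine Finset.sum_comm' ?_
        intro j j'
        simp only [Finset.mem_filter, Finset.mem_univ, true_and]
        constructor
        · rintro ⟨h1, h2⟩
          refine ⟨⟨h1, h2⟩, fun v hv => ?_⟩
          rw [Finset.mem_inter] at hv
          rw [h2 v hv.1, h1 v hv.2]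
        · rintro ⟨h1, _⟩; exact h1
    _ = _ := by
        refine Finset.sum_congr rfl fun j' hj' => ?_
        simp only [Finset.mem_filter, Finset.mem_univ, true_and] at hj'
        rw [h1 j' hj', Finset.sum_singleton]

theorem dependsOn_marg_of {q : Cell L → ℝ} {A : Finset V} (hq : DependsOn q (A : Set V))
    (D : Finset V) : DependsOn (marg q D) ((A ∩ D : Finset V) : Set V) := by
  intro i j h
  have e : ∀ a : Cell L, marg q D a = ∑ b : Cell L with (∀ v ∈ D, b v = 0), q (glue D a b) := by
    intro a
    rw [marg]
    refine Finset.sum_nbij' (fun b => restrict (Finset.univ \ D) b) (fun b => glue D a b)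
      ?_ ?_ ?_ ?_ ?_
    · intro b hb; simp +contextual [restrict]
    · intro b hb; simp +contextual [glue]
    · intro b hb
      simp only [Finset.mem_filter, Finset.mem_univ, true_and] at hb
      funext v; by_cases hv : v ∈ D <;> simp [glue, restrict, hv, hb]
    · intro b hb
      simp only [Finset.mem_filter, Finset.mem_univ, true_and] at hb
      funext v; by_cases hv : v ∈ D <;> simp [glue, restrict, hv, hb]
    · intro b hb
      simp only [Finset.mem_filter, Finset.mem_univ, true_and] at hb
      congr 1
      funext v; by_cases hv : v ∈ D <;> simp [glue, restrict, hv, hb]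
  rw [e, e]
  refine Finset.sum_congr rfl fun b _ => hq fun v hv => ?_
  by_cases hD : v ∈ D
  · simp only [glue, hD, if_true]; exact h v (Finset.mem_inter.2 ⟨hv, hD⟩)
  · simp [glue, hD]

/-! ### Sums over marginal tables -/

/-- Summing over the levels of the coordinates in `R`, the others being fixed. -/
theorem sum_agree_compl (R : Finset V) (i : Cell L) (f : Cell L → ℝ) :
    ∑ j : Cell L with ∀ v ∈ Finset.univ \ R, j v = i v, f j =
      ∑ t : Table L R, f (glue R t.1 i) := by
  refine Finset.sum_bij' (fun j _ => (⟨restrict R j, fun v hv => if_neg hv⟩ : Table L R))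
    (fun t _ => glue R t.1 i) ?_ ?_ ?_ ?_ ?_
  · simp
  · intro t _; simp +contextual [glue]
  · intro j hj
    simp only [Finset.mem_filter, Finset.mem_univ, true_and, Finset.mem_sdiff] at hj
    funext v; by_cases hv : v ∈ R <;> simp [glue, restrict, hv, hj]
  · intro t _
    apply Subtype.ext
    funext v; by_cases hv : v ∈ R <;> simp [glue, restrict, hv, t.2]
  · intro j hj
    simp only [Finset.mem_filter, Finset.mem_univ, true_and, Finset.mem_sdiff] at hj
    congr 1
    funext v; by_cases hv : v ∈ R <;> simp [glue, restrict, hv, hj]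

/-- The zero cell of a marginal table. -/
def zeroTable (R : Finset V) : Table L R := ⟨0, fun _ _ => rfl⟩

theorem sum_table_eq (R : Finset V) (f : Cell L → ℝ) :
    ∑ t : Table L R, f t.1 = f 0 + ∑ t : NZ L R, f t.1 := by
  rw [← Finset.add_sum_erase _ _ (Finset.mem_univ (zeroTable R))]
  congr 1
  refine Finset.sum_bij' (fun t ht => (⟨t.1, t.2, ?_⟩ : NZ L R))
    (fun t _ => (⟨t.1, t.2.1⟩ : Table L R)) ?_ ?_ ?_ ?_ ?_
  · by_contra hcon
    push Not at hcon
    exact (Finset.mem_erase.1 ht).1 (Subtype.ext (funext hcon))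
  · simp
  · intro t _
    refine Finset.mem_erase.2 ⟨?_, Finset.mem_univ _⟩
    intro h
    obtain ⟨v, hv⟩ := t.2.2
    exact hv (congrFun (congrArg Subtype.val h) v)
  · intros; rfl
  · intros; rfl
  · intros; rfl

end Cells

/-! ### Factorization along a perfect order -/

section Factor

variable {V : Type*} [Fintype V] [DecidableEq V] {L : V → Type*} [∀ v, Fintype (L v)]
  [∀ v, DecidableEq (L v)] [∀ v, Zero (L v)] {k : ℕ}

/-- The first `m` indices. -/
abbrev before (k m : ℕ) : Finset (Fin k) := Finset.univ.filter fun l => l.1 < m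

/-- The union of the first `m` cliques. -/
def hlt (C : Fin k → Finset V) (m : ℕ) : Finset V := (before k m).biUnion C

theorem before_self : before k k = Finset.univ := by ext l; simp

theorem before_zero : before k 0 = ∅ := by ext l; simp

theorem sep_eq (C : Fin k → Finset V) (l : Fin k) : sep C l = C l ∩ hlt C l := rfl

theorem hist_eq (C : Fin k → Finset V) (l : Fin k) : hist C l = hlt C (l + 1) := by
  rw [hist, hlt]; congr 1; ext i
  simp only [Finset.mem_filter, Finset.mem_univ, true_and, Fin.le_def]; omega

theorem mem_hlt {C : Fin k → Finset V} {m : ℕ} {v : V} :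
    v ∈ hlt C m ↔ ∃ l : Fin k, (l : ℕ) < m ∧ v ∈ C l := by
  simp [hlt]

theorem mem_sep {C : Fin k → Finset V} {l : Fin k} {v : V} :
    v ∈ sep C l ↔ v ∈ C l ∧ v ∈ hlt C l := by rw [sep_eq, Finset.mem_inter]

theorem mem_res {C : Fin k → Finset V} {l : Fin k} {v : V} :
    v ∈ res C l ↔ v ∈ C l ∧ v ∉ hlt C l := by rw [res, Finset.mem_sdiff, mem_sep]; tauto

theorem mem_hlt_succ {C : Fin k → Finset V} {l : Fin k} {v : V} :
    v ∈ hlt C (l + 1) ↔ v ∈ hlt C l ∨ v ∈ C l := by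
  simp only [mem_hlt]
  constructor
  · rintro ⟨j, hj, hv⟩
    rcases Nat.lt_succ_iff_lt_or_eq.1 hj with h | h
    · exact Or.inl ⟨j, h, hv⟩
    · exact Or.inr (Fin.ext h ▸ hv)
  · rintro (⟨j, hj, hv⟩ | hv)
    · exact ⟨j, by omega, hv⟩
    · exact ⟨l, by omega, hv⟩

theorem disjoint_sep_res (C : Fin k → Finset V) (l : Fin k) {v : V} (h : v ∈ sep C l) :
    v ∉ res C l := by rw [mem_sep] at h; rw [mem_res]; tauto

theorem mem_clique_iff {C : Fin k → Finset V} {l : Fin k} {v : V} :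
    v ∈ C l ↔ v ∈ sep C l ∨ v ∈ res C l := by rw [mem_sep, mem_res]; tauto

theorem res_union_sep (C : Fin k → Finset V) (l : Fin k) : res C l ∪ sep C l = C l := by
  ext v; rw [Finset.mem_union, mem_clique_iff (C := C) (l := l)]; tauto

theorem IsPerfectOrder.hlt_eq_univ {G : SimpleGraph V} {C : Fin k → Finset V}
    (hC : IsPerfectOrder G C) : hlt C k = Finset.univ := by
  ext v
  simp only [Finset.mem_univ, iff_true, mem_hlt]
  obtain ⟨l, hl, _⟩ := hC.existsUnique_group {v} ⟨v, by simp⟩ (by simp)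
  exact ⟨l, l.2, hl.1 (by simp)⟩

theorem IsPerfectOrder.isClique {G : SimpleGraph V} {C : Fin k → Finset V}
    (hC : IsPerfectOrder G C) (l : Fin k) : G.IsClique (C l : Set V) :=
  ((hC.mem_iff _).1 ⟨l, rfl⟩).1

variable (C : Fin k → Finset V)

/-- The group `(l, i_{S_l})` to which the cell `i` belongs. -/
def slice (l : Fin k) (i : Cell L) : CondGroup L C :=
  ⟨l, ⟨restrict (sep C l) i, fun _ hv => if_neg hv⟩⟩

/-- The cumulant function of the group `g`. -/
def cumulant (θ : CondIdx L C → ℝ) (g : CondGroup L C) : ℝ :=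
  Real.log (1 + ∑ j : NZ L (res C g.1), Real.exp (xi C θ g j.1))

/-- `log p^{R_l|i_{S_l}}(i_{R_l})` in terms of `θ^cond`. -/
def logFactor (θ : CondIdx L C → ℝ) (l : Fin k) (i : Cell L) : ℝ :=
  xi C θ (slice C l i) (restrict (res C l) i) - cumulant C θ (slice C l i)

/-- The product of the first `m` conditional probabilities. -/
def partialProd (θ : CondIdx L C → ℝ) (m : ℕ) (i : Cell L) : ℝ :=
  ∏ l ∈ before k m, Real.exp (logFactor C θ l i)

variable {C}

theorem one_add_sum_exp_pos {ι : Type*} (s : Finset ι) (f : ι → ℝ) :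
    0 < 1 + ∑ j ∈ s, Real.exp (f j) := by positivity

theorem exp_logFactor (θ : CondIdx L C → ℝ) (l : Fin k) (i : Cell L) :
    Real.exp (logFactor C θ l i) = Real.exp (xi C θ (slice C l i) (restrict (res C l) i)) /
      (1 + ∑ j : NZ L (res C l), Real.exp (xi C θ (slice C l i) j.1)) := by
  rw [logFactor, Real.exp_sub, cumulant, Real.exp_log (one_add_sum_exp_pos _ _)]; rfl

theorem pCond_eq_prod (θ : CondIdx L C → ℝ) (i : Cell L) :
    pCond C θ i = ∏ l, Real.exp (logFactor C θ l i) := by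
  rw [pCond]; refine Finset.prod_congr rfl fun l _ => ?_
  rw [exp_logFactor]; rfl

theorem pCond_pos (θ : CondIdx L C → ℝ) (i : Cell L) : 0 < pCond C θ i := by
  rw [pCond_eq_prod]; exact Finset.prod_pos fun _ _ => Real.exp_pos _

theorem log_pCond (θ : CondIdx L C → ℝ) (i : Cell L) :
    Real.log (pCond C θ i) = ∑ l, logFactor C θ l i := by
  rw [pCond_eq_prod, ← Real.exp_sum, Real.log_exp]

theorem pCond_eq_partialProd (θ : CondIdx L C → ℝ) : pCond C θ = partialProd C θ k := by
  funext i
  rw [pCond_eq_prod, partialProd, before_self]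

theorem partialProd_pos (θ : CondIdx L C → ℝ) (m : ℕ) (i : Cell L) : 0 < partialProd C θ m i :=
  Finset.prod_pos fun _ _ => Real.exp_pos _

theorem prod_filter_lt_succ (f : Fin k → ℝ) (l : Fin k) :
    ∏ j ∈ before k (l + 1), f j = (∏ j ∈ before k l, f j) * f l := by
  have : before k (l + 1)
      = insert l (before k l) := by
    ext j; simp only [Finset.mem_filter, Finset.mem_univ, true_and, Finset.mem_insert, Fin.ext_iff]
    omega
  rw [this, Finset.prod_insert (by simp), mul_comm]

theorem partialProd_succ (θ : CondIdx L C → ℝ) (l : Fin k) (i : Cell L) :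
    partialProd C θ (l + 1) i = partialProd C θ l i * Real.exp (logFactor C θ l i) :=
  prod_filter_lt_succ _ l

theorem slice_congr {l : Fin k} {i j : Cell L} (h : ∀ v ∈ sep C l, i v = j v) :
    slice C l i = slice C l j := by
  unfold slice
  congr 2
  exact restrict_congr h

theorem dependsOn_logFactor (θ : CondIdx L C → ℝ) (l : Fin k) :
    DependsOn (logFactor C θ l) (C l : Set V) := by
  intro i j h
  have h1 : slice C l i = slice C l j := slice_congr fun v hv => h v (mem_sep.1 hv).1
  have h2 : restrict (res C l) i = restrict (res C l) j :=
    restrict_congr fun v hv => h v (mem_res.1 hv).1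
  rw [logFactor, logFactor, h1, h2]

theorem dependsOn_partialProd (θ : CondIdx L C → ℝ) (m : ℕ) :
    DependsOn (partialProd C θ m) (hlt C m : Set V) := by
  intro i j h
  refine Finset.prod_congr rfl fun l hl => ?_
  rw [dependsOn_logFactor θ l fun v hv => h v (mem_hlt.2 ⟨l, (Finset.mem_filter.1 hl).2, hv⟩)]

theorem xi_zero (θ : CondIdx L C → ℝ) (g : CondGroup L C) : xi C θ g 0 = 0 := by
  refine Finset.sum_eq_zero fun a ha => ?_
  obtain ⟨v, hv⟩ := a.2.2
  exact absurd ((Finset.mem_filter.1 ha).2 v hv) hv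

theorem slice_glue {l : Fin k} (s : Table L (sep C l)) (j : Cell L) :
    slice C l (glue (sep C l) s.1 j) = ⟨l, s⟩ := by
  unfold slice
  congr 1
  apply Subtype.ext
  funext v; by_cases hv : v ∈ sep C l <;> simp [restrict, glue, hv, s.2]

theorem restrict_res_glue {l : Fin k} (s j : Cell L) :
    restrict (res C l) (glue (sep C l) s j) = restrict (res C l) j := by
  refine restrict_congr fun v hv => ?_
  have : v ∉ sep C l := fun h => disjoint_sep_res C l h hv
  simp [glue, this]

theorem sum_exp_logFactor (θ : CondIdx L C → ℝ) (g : CondGroup L C) :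
    ∑ r : Table L (res C g.1), Real.exp (xi C θ g r.1 - cumulant C θ g) = 1 := by
  simp_rw [Real.exp_sub, ← Finset.sum_div]
  rw [sum_table_eq (res C g.1) fun j => Real.exp (xi C θ g j), xi_zero, Real.exp_zero, cumulant,
    Real.exp_log (one_add_sum_exp_pos _ _), div_self (one_add_sum_exp_pos _ _).ne']

/-- The `l`-th factor of `pCond` is a conditional density of the coordinates in `R_l`. -/
theorem marg_exp_logFactor (θ : CondIdx L C → ℝ) (l : Fin k) (i : Cell L) :
    marg (fun j => Real.exp (logFactor C θ l j)) (Finset.univ \ res C l) i = 1 := by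
  rw [marg, sum_agree_compl, ← sum_exp_logFactor θ (slice C l i)]
  refine Finset.sum_congr rfl fun t _ => ?_
  have h1 : slice C l (glue (res C l) t.1 i) = slice C l i := by
    refine slice_congr fun v hv => ?_
    simp [glue, disjoint_sep_res C l hv]
  have h2 : restrict (res C l) (glue (res C l) t.1 i) = t.1 := by
    funext v; by_cases hv : v ∈ res C l <;> simp [restrict, glue, hv, t.2]
  rw [logFactor, h1, h2]

/-- The residuals `R_k, …, R_{m+1}` are summed out one by one; each time the last conditional
probability sums to one. -/
theorem marg_pCond_hlt (hk : hlt C k = Finset.univ) (θ : CondIdx L C → ℝ) {m : ℕ} (hm : m ≤ k) :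
    marg (pCond C θ) (hlt C m) = partialProd C θ m := by
  induction hm using Nat.decreasingInduction with
  | self => funext i; rw [hk, marg_univ, pCond_eq_partialProd]
  | of_succ m hm ih =>
    funext i
    have h1 : hlt C m = hlt C (m + 1) ∩ (Finset.univ \ res C ⟨m, hm⟩) := by
      ext v
      have := mem_hlt_succ (C := C) (l := ⟨m, hm⟩) (v := v)
      simp only [Finset.mem_inter, Finset.mem_sdiff, Finset.mem_univ, true_and, mem_res]
      simp only at this
      tauto
    have h2 : hlt C (m + 1) ∪ (Finset.univ \ res C ⟨m, hm⟩) = Finset.univ := by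
      ext v
      have := mem_hlt_succ (C := C) (l := ⟨m, hm⟩) (v := v)
      simp only [Finset.mem_union, Finset.mem_sdiff, Finset.mem_univ, true_and, mem_res, iff_true]
      simp only at this
      tauto
    rw [h1, ← marg_marg _ h2, ih]
    have h3 : partialProd C θ (m + 1) = fun j => partialProd C θ m j *
        Real.exp (logFactor C θ ⟨m, hm⟩ j) := funext fun j => partialProd_succ θ ⟨m, hm⟩ j
    rw [h3, marg_mul, marg_exp_logFactor, mul_one]
    refine (dependsOn_partialProd θ m).mono ?_
    intro v hv
    simp only [Finset.coe_sdiff, Finset.coe_univ, Set.mem_sdiff, Set.mem_univ, true_and,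
      Finset.mem_coe, mem_res]
    exact fun h => h.2 hv

theorem sum_pCond (hk : hlt C k = Finset.univ) (θ : CondIdx L C → ℝ) : ∑ i, pCond C θ i = 1 := by
  have h := congrFun (marg_pCond_hlt hk θ (Nat.zero_le k)) 0
  have h0 : hlt C 0 = ∅ := by ext v; simp [mem_hlt]
  rw [h0, marg_empty] at h
  rw [h]; simp [partialProd, before_zero]

/-- The separator probabilities of group `l` involve the factors of the earlier cliques only. -/
theorem marg_pCond_sep (hk : hlt C k = Finset.univ) (θ : CondIdx L C → ℝ) (l : Fin k) :
    marg (pCond C θ) (sep C l) =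
      marg (partialProd C θ l) (Finset.univ \ (hlt C l \ sep C l)) := by
  funext i
  rw [← marg_pCond_hlt hk θ l.2.le, marg_marg]
  · congr 1; ext v; simp only [Finset.mem_inter, Finset.mem_sdiff, Finset.mem_univ, mem_sep]; tauto
  · ext v; simp only [Finset.mem_union, Finset.mem_sdiff, Finset.mem_univ, mem_sep]; tauto

theorem marg_pCond_clique (hk : hlt C k = Finset.univ) (θ : CondIdx L C → ℝ) (l : Fin k)
    (i : Cell L) :
    marg (pCond C θ) (C l) i = Real.exp (logFactor C θ l i) * marg (pCond C θ) (sep C l) i := by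
  have h1 : C l = hlt C (l + 1) ∩ (Finset.univ \ (hlt C l \ sep C l)) := by
    ext v
    simp only [Finset.mem_inter, Finset.mem_sdiff, Finset.mem_univ, mem_sep, mem_hlt_succ]; tauto
  have h2 : hlt C (l + 1) ∪ (Finset.univ \ (hlt C l \ sep C l)) = Finset.univ := by
    ext v
    simp only [Finset.mem_union, Finset.mem_sdiff, Finset.mem_univ, mem_sep, mem_hlt_succ]; tauto
  conv_lhs => rw [h1]
  rw [← marg_marg _ h2, marg_pCond_hlt hk θ l.2, marg_pCond_sep hk]
  have h3 : partialProd C θ (l + 1) = fun j =>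
      Real.exp (logFactor C θ l j) * partialProd C θ l j :=
    funext fun j => by rw [partialProd_succ, mul_comm]
  rw [h3, marg_mul]
  intro a b h
  simp only
  rw [dependsOn_logFactor θ l]
  intro v hv
  refine h v ?_
  have hv' : v ∈ C l := hv
  simp only [Finset.mem_coe, Finset.mem_sdiff, Finset.mem_univ, mem_sep]; tauto

theorem condProb_pCond (hk : hlt C k = Finset.univ) (θ : CondIdx L C → ℝ) (l : Fin k)
    (i : Cell L) :
    condProb (pCond C θ) (res C l) (sep C l) i = Real.exp (logFactor C θ l i) := by
  rw [condProb, res_union_sep, marg_pCond_clique hk,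
    mul_div_cancel_right₀ _ (marg_pos (pCond_pos θ) _ _).ne']

theorem sum_subtype_eq {P : Cell L → Prop} [DecidablePred P] (Q : Cell L → Prop)
    [DecidablePred Q] (θ : {i : Cell L // P i} → ℝ) :
    ∑ a : {i : Cell L // P i} with Q a.1, θ a =
      ∑ a : Cell L with Q a, if h : P a then θ ⟨a, h⟩ else 0 := by
  rw [Finset.sum_filter, Finset.sum_filter,
    ← Finset.sum_subset (Finset.filter_subset P Finset.univ)]
  · rw [Finset.sum_subtype (p := P) _ (by simp)]
    refine Finset.sum_congr rfl fun a _ => ?_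
    simp [a.2]
  · intro a _ ha
    simp only [Finset.mem_filter, Finset.mem_univ, true_and] at ha
    simp [ha]

theorem subCell_restrict_iff {a j : Cell L} {D : Finset V} (ha : ∀ v, v ∉ D → a v = 0) :
    SubCell a (restrict D j) ↔ SubCell a j := by
  refine forall_congr' fun v => forall_congr' fun hv => ?_
  have : v ∈ D := by by_contra h; exact hv (ha v h)
  simp [restrict, this]

theorem xi_restrict (θ : CondIdx L C → ℝ) (g : CondGroup L C) (j : Cell L) :
    xi C θ g (restrict (res C g.1) j) = xi C θ g j := by
  rw [xi, xi]
  refine Finset.sum_congr (Finset.filter_congr fun a _ => subCell_restrict_iff a.2.1) fun _ _ => rfl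

theorem logFactor_glue (θ : CondIdx L C → ℝ) (g : CondGroup L C) (j : Cell L) :
    logFactor C θ g.1 (glue (sep C g.1) g.2.1 j) = xi C θ g j - cumulant C θ g := by
  rw [logFactor, slice_glue, restrict_res_glue, xi_restrict]

theorem mob_xi (θ : CondIdx L C → ℝ) (g : CondGroup L C) (a : NZ L (res C g.1)) :
    mob (xi C θ g) a.1 = θ ⟨g, a⟩ := by
  exact (mob_eq_of_eq_sum (fun j => sum_subtype_eq (fun b => SubCell b j) fun b => θ ⟨g, b⟩)
    a.1).trans (dif_pos a.2)

theorem mob_const (c : ℝ) {i : Cell L} (hi : ∃ v, i v ≠ 0) : mob (fun _ => c) i = 0 := by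
  obtain ⟨v, hv⟩ := hi
  exact mob_eq_zero (D := ∅) (fun _ _ _ => rfl) hv (by simp)

theorem thetaCond_pCond (hk : hlt C k = Finset.univ) (θ : CondIdx L C → ℝ) :
    thetaCond C (pCond C θ) = θ := by
  funext ⟨g, a⟩
  simp only [thetaCond, condProb_pCond hk]
  rw [logOdds_eq_mob fun i => Real.exp_pos _]
  simp_rw [Real.log_exp, logFactor_glue]
  rw [mob_sub, mob_const _ a.2.2, sub_zero, mob_xi]

/-- Möbius inversion within a group: `ξ` recovers the log-ratios to the zero cell. -/
theorem xi_of_mob (θ : CondIdx L C → ℝ) (g : CondGroup L C) (φ : Cell L → ℝ)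
    (h : ∀ a, θ ⟨g, a⟩ = mob φ a.1) {j : Cell L} (hj : ∀ v, v ∉ res C g.1 → j v = 0) :
    xi C θ g j = φ j - φ 0 := by
  have h0 : mob φ 0 = φ 0 := mob_zero_cell φ
  have h1 : φ j = ∑ a : Cell L with SubCell a j,
      ((if h : (∀ v, v ∉ res C g.1 → a v = 0) ∧ ∃ v, a v ≠ 0 then θ ⟨g, ⟨a, h⟩⟩ else 0) +
        if a = 0 then φ 0 else 0) := by
    conv_lhs => rw [← sum_subCell_mob φ j]
    refine Finset.sum_congr rfl fun a ha => ?_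
    simp only [Finset.mem_filter, Finset.mem_univ, true_and] at ha
    by_cases ha0 : a = 0
    · subst ha0; simp [h0]
    · have hne : ∃ v, a v ≠ 0 := by
        by_contra hcon; push Not at hcon; exact ha0 (funext hcon)
      have hsub : ∀ v, v ∉ res C g.1 → a v = 0 := by
        intro v hv; by_contra hav; exact hav ((ha v hav).trans (hj v hv))
      rw [dif_pos ⟨hsub, hne⟩, if_neg ha0, add_zero, h]
  rw [Finset.sum_add_distrib, ← sum_subtype_eq (fun a => SubCell a j) fun b => θ ⟨g, b⟩] at h1
  have h2 : ∑ a : Cell L with SubCell a j, (if a = 0 then φ 0 else 0) = φ 0 := by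
    rw [Finset.sum_eq_single 0]
    · simp
    · intro a _ ha; simp [ha]
    · intro h; exact absurd (Finset.mem_filter.2 ⟨Finset.mem_univ _, fun v hv => absurd rfl hv⟩) h
  rw [h2] at h1
  rw [xi, h1]; ring

theorem xi_congr {θ θ' : CondIdx L C → ℝ} {g : CondGroup L C} (h : ∀ a, θ ⟨g, a⟩ = θ' ⟨g, a⟩) :
    xi C θ g = xi C θ' g := by
  funext j; exact Finset.sum_congr rfl fun a _ => h a

theorem logFactor_congr {θ θ' : CondIdx L C → ℝ} {l : Fin k}
    (h : ∀ s a, θ ⟨⟨l, s⟩, a⟩ = θ' ⟨⟨l, s⟩, a⟩) : logFactor C θ l = logFactor C θ' l := by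
  funext i
  have : xi C θ (slice C l i) = xi C θ' (slice C l i) := xi_congr (h _)
  rw [logFactor, logFactor, cumulant, cumulant, this]

/-- A positive function of the coordinates in `C_l` is a function of those in `S_l` times a factor
of the form occurring in `pCond`. -/
theorem eq_marg_mul_exp_logFactor {l : Fin k} {ψ : Cell L → ℝ} (hpos : ∀ i, 0 < ψ i)
    (hψ : DependsOn ψ (C l : Set V)) (θ : CondIdx L C → ℝ)
    (hθ : ∀ s a, θ ⟨⟨l, s⟩, a⟩ = logOdds (fun j => ψ (glue (sep C l) s.1 j)) a.1) (i : Cell L) :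
    ψ i = marg ψ (Finset.univ \ res C l) i * Real.exp (logFactor C θ l i) := by
  have key : ∀ j : Cell L, (∀ v, v ∉ res C l → j v = 0) → Real.exp (xi C θ (slice C l i) j) =
      ψ (glue (sep C l) i j) / ψ (glue (sep C l) i 0) := by
    intro j hj
    have hg : ∀ j, glue (sep C l) (restrict (sep C l) i) j = glue (sep C l) i j := by
      intro j; funext v; by_cases hv : v ∈ sep C l <;> simp [glue, restrict, hv]
    rw [xi_of_mob θ (slice C l i) (fun j => Real.log (ψ (glue (sep C l) i j))) ?_ hj,
      Real.exp_sub, Real.exp_log (hpos _), Real.exp_log (hpos _)]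
    intro a
    refine (hθ _ a).trans ?_
    rw [logOdds_eq_mob fun _ => hpos _]
    simp only [slice, hg]
  have e1 : ∀ t : Table L (res C l), ψ (glue (res C l) t.1 i) = ψ (glue (sep C l) i t.1) := by
    intro t
    refine hψ fun v hv => ?_
    rcases mem_clique_iff.1 hv with h | h
    · simp [glue, h, disjoint_sep_res C l h]
    · have : v ∉ sep C l := fun h' => disjoint_sep_res C l h' h
      simp [glue, h, this]
  have e2 : ψ (glue (sep C l) i (restrict (res C l) i)) = ψ i := by
    refine hψ fun v hv => ?_
    rcases mem_clique_iff.1 hv with h | h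
    · simp [glue, h]
    · have : v ∉ sep C l := fun h' => disjoint_sep_res C l h' h
      simp [glue, h, this, restrict]
  have e3 : marg ψ (Finset.univ \ res C l) i = ψ (glue (sep C l) i 0) *
      (1 + ∑ j : NZ L (res C l), Real.exp (xi C θ (slice C l i) j.1)) := by
    rw [marg, sum_agree_compl]
    simp_rw [e1]
    rw [sum_table_eq (res C l) fun j => ψ (glue (sep C l) i j), mul_add, mul_one, Finset.mul_sum]
    congr 1
    refine Finset.sum_congr rfl fun j _ => ?_
    rw [key _ j.2.1, mul_div_cancel₀ _ (hpos _).ne']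
  rw [exp_logFactor, key (restrict (res C l) i) (fun v hv => if_neg hv), e2, e3]
  have := (hpos (glue (sep C l) i 0)).ne'
  have := (one_add_sum_exp_pos Finset.univ
    fun j : NZ L (res C l) => xi C θ (slice C l i) j.1).ne'
  field_simp

/-- A product of positive clique potentials is, up to a constant, a product of conditional
probabilities. The residual of the last clique is summed out of its potential; what is left over is a
function on the separator, which the perfect order lets an earlier potential absorb. -/
theorem exists_eq_partialProd (hperf : ∀ l : Fin k, (l : ℕ) ≠ 0 → ∃ i < l, sep C l ⊆ C i)
    {m : ℕ} (hm : m ≤ k) (ψ : Fin k → Cell L → ℝ) (hpos : ∀ l i, 0 < ψ l i)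
    (hψ : ∀ l, DependsOn (ψ l) (C l : Set V)) :
    ∃ θ : CondIdx L C → ℝ, ∃ c : ℝ, ∀ i,
      ∏ l ∈ before k m, ψ l i = c * partialProd C θ m i := by
  induction m generalizing ψ with
  | zero => exact ⟨0, 1, by simp [partialProd, before_zero]⟩
  | succ m ih =>
    set l : Fin k := ⟨m, hm⟩ with hl
    set θ0 : CondIdx L C → ℝ := fun a =>
      logOdds (fun j => ψ a.1.1 (glue (sep C a.1.1) a.1.2.1 j)) a.2.1 with hθ0
    have hfac := eq_marg_mul_exp_logFactor (hpos l) (hψ l) θ0 (fun s a => rfl)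
    set n := marg (ψ l) (Finset.univ \ res C l) with hn
    have hnpos : ∀ i, 0 < n i := marg_pos (hpos l) _
    have hndep : DependsOn n (sep C l : Set V) := by
      refine (dependsOn_marg_of (hψ l) _).mono ?_
      intro v hv
      simp only [Finset.mem_coe, Finset.mem_inter, Finset.mem_sdiff, mem_res, mem_sep] at hv ⊢
      tauto
    have hmerge : ∃ θ1 : CondIdx L C → ℝ, ∃ c : ℝ, ∀ i,
        (∏ l' ∈ before k m, ψ l' i) * n i = c * partialProd C θ1 m i := by
      by_cases hm0 : m = 0
      · subst hm0
        refine ⟨0, n 0, fun i => ?_⟩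
        have : n i = n 0 := hndep (fun v hv => by
          have := (mem_sep.1 hv).2
          simp [mem_hlt, hl] at this)
        simp [partialProd, before_zero, this]
      · obtain ⟨i0, hi0, hsub⟩ := hperf l hm0
        have hpos' : ∀ l' i, 0 < (if l' = i0 then fun i => ψ l' i * n i else ψ l') i := by
          intro l' i
          split_ifs
          · exact mul_pos (hpos _ _) (hnpos _)
          · exact hpos _ _
        have hψ' : ∀ l', DependsOn (if l' = i0 then fun i => ψ l' i * n i else ψ l')
            (C l' : Set V) := by
          intro l'
          split_ifs with hh
          · subst hh
            intro i j hij
            simp only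
            rw [hψ l' hij, hndep fun v hv => hij v (hsub hv)]
          · exact hψ l'
        obtain ⟨θ1, c, h⟩ := ih (by omega) _ hpos' hψ'
        refine ⟨θ1, c, fun i => ?_⟩
        rw [← h]
        have hmem : i0 ∈ before k m := by
          simpa [hl, Fin.lt_def] using hi0
        rw [← Finset.mul_prod_erase _ _ hmem, ← Finset.mul_prod_erase _ _ hmem, if_pos rfl]
        have : ∏ l' ∈ (before k m).erase i0,
            (if l' = i0 then fun i => ψ l' i * n i else ψ l') i =
            ∏ l' ∈ (before k m).erase i0, ψ l' i :=
          Finset.prod_congr rfl fun l' hl' => by rw [if_neg (Finset.ne_of_mem_erase hl')]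
        rw [this]
        ring
    obtain ⟨θ1, c, h1⟩ := hmerge
    refine ⟨fun a => if a.1.1 = l then θ0 a else θ1 a, c, fun i => ?_⟩
    have e := prod_filter_lt_succ (fun l' => ψ l' i) l
    have e' := partialProd_succ (fun a => if a.1.1 = l then θ0 a else θ1 a) l i
    simp only [hl] at e e'
    rw [e, e', hfac i, ← mul_assoc, h1, mul_assoc]
    congr 2
    · refine Finset.prod_congr rfl fun l' hl' => ?_
      rw [logFactor_congr]
      intro s a
      have : l' ≠ l := by
        rintro rfl; simp [hl] at hl'
      exact (if_neg this).symm
    · rw [logFactor_congr]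
      intro s a; simp [hl]

/-- A positive probability vector that factorizes over the cliques of a perfect order is of the
form `pCond C θ`: the normalizing function of the last residual depends only on the last
separator, and is absorbed into an earlier clique. -/
theorem exists_eq_pCond {G : SimpleGraph V} (hC : IsPerfectOrder G C) (ψ : Fin k → Cell L → ℝ)
    (hpos : ∀ l i, 0 < ψ l i) (hψ : ∀ l, DependsOn (ψ l) (C l : Set V)) (c : ℝ)
    {q : Cell L → ℝ} (hq : ∀ i, q i = c * ∏ l, ψ l i) (hsum : ∑ i, q i = 1) :
    ∃ θ, q = pCond C θ := by
  obtain ⟨θ, d, h⟩ := exists_eq_partialProd hC.perfect le_rfl ψ hpos hψ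
  have h' : ∀ i, q i = c * d * pCond C θ i := by
    intro i
    have := h i
    rw [before_self, ← pCond_eq_partialProd] at this
    rw [hq, this, mul_assoc]
  have h1 : c * d = 1 := by
    simp_rw [h', ← Finset.mul_sum, sum_pCond hC.hlt_eq_univ θ] at hsum
    simpa using hsum
  exact ⟨θ, funext fun i => by rw [h', h1, one_mul]⟩

/-- Factorization over the cliques implies the pairwise Markov property. -/
theorem mem_markovModel_of_prod {G : SimpleGraph V} (hC : IsPerfectOrder G C)
    (ψ : Fin k → Cell L → ℝ) (hpos : ∀ l i, 0 < ψ l i)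
    (hψ : ∀ l, DependsOn (ψ l) (C l : Set V)) {q : Cell L → ℝ} (hq : ∀ i, q i = ∏ l, ψ l i)
    (hsum : ∑ i, q i = 1) : q ∈ markovModel G := by
  refine ⟨fun i => by rw [hq]; exact Finset.prod_pos fun l _ => hpos l i, hsum, ?_⟩
  intro γ δ hne hadj i
  set a : Cell L → ℝ := fun i => ∏ l with γ ∉ C l, ψ l i with ha
  set b : Cell L → ℝ := fun i => ∏ l with ¬ γ ∉ C l, ψ l i with hb
  have hab : q = fun i => a i * b i := by
    funext i; rw [hq, ha, hb]; exact (Finset.prod_filter_mul_prod_filter_not _ _ _).symm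
  have hba : q = fun i => b i * a i := by rw [hab]; funext i; ring
  have hda : DependsOn a ((Finset.univ \ {γ} : Finset V) : Set V) := by
    intro x y h
    refine Finset.prod_congr rfl fun l hl => hψ l fun v hv => h v ?_
    simp only [Finset.mem_filter, Finset.mem_univ, true_and] at hl
    simp only [Finset.mem_coe, Finset.mem_sdiff, Finset.mem_univ, true_and, Finset.mem_singleton]
    rintro rfl; exact hl hv
  have hdb : DependsOn b ((Finset.univ \ {δ} : Finset V) : Set V) := by
    intro x y h
    refine Finset.prod_congr rfl fun l hl => hψ l fun v hv => h v ?_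
    simp only [Finset.mem_filter, Finset.mem_univ, true_and, not_not] at hl
    simp only [Finset.mem_coe, Finset.mem_sdiff, Finset.mem_univ, true_and, Finset.mem_singleton]
    rintro rfl
    exact hadj (hC.isClique l hl hv hne)
  have h1 : marg q (Finset.univ \ {γ}) = fun i => a i * marg b (Finset.univ \ {γ}) i := by
    funext i; rw [hab, marg_mul hda]
  have h2 : marg q (Finset.univ \ {δ}) i = b i * marg a (Finset.univ \ {δ}) i := by
    rw [hba, marg_mul hdb]
  have h3 : marg q (Finset.univ \ {γ, δ}) i =
      marg b (Finset.univ \ {γ}) i * marg a (Finset.univ \ {δ}) i := by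
    have e1 : (Finset.univ \ {γ, δ} : Finset V) = (Finset.univ \ {γ}) ∩ (Finset.univ \ {δ}) := by
      ext v; simp
    have e2 : (Finset.univ \ {γ} : Finset V) ∪ (Finset.univ \ {δ}) = Finset.univ := by
      ext v
      simp only [Finset.mem_union, Finset.mem_sdiff, Finset.mem_univ, true_and,
        Finset.mem_singleton, iff_true]
      by_contra hcon; push Not at hcon; exact hne (hcon.1.symm.trans hcon.2)
    rw [e1, ← marg_marg _ e2, h1]
    have e3 : (fun i => a i * marg b (Finset.univ \ {γ}) i) =
        fun i => marg b (Finset.univ \ {γ}) i * a i := by funext i; ring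
    rw [e3, marg_mul]
    refine (dependsOn_marg_of hdb _).mono ?_
    intro v hv
    simp only [Finset.mem_coe, Finset.mem_inter] at hv ⊢
    exact hv.1
  rw [h1, h2, h3, hab]; ring

theorem pCond_mem {G : SimpleGraph V} (hC : IsPerfectOrder G C) (θ : CondIdx L C → ℝ) :
    pCond C θ ∈ markovModel G := by
  refine mem_markovModel_of_prod hC (fun l i => Real.exp (logFactor C θ l i))
    (fun _ _ => Real.exp_pos _) (fun l x y h => ?_) (pCond_eq_prod θ)
    (sum_pCond hC.hlt_eq_univ θ)
  simp only
  rw [dependsOn_logFactor θ l h]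

end Factor

/-! ### The three parametrizations -/

section Param

variable {V : Type*} [Fintype V] [DecidableEq V] {L : V → Type*} [∀ v, Fintype (L v)]
  [∀ v, DecidableEq (L v)] [∀ v, Zero (L v)] {k : ℕ} {C : Fin k → Finset V} {G : SimpleGraph V}

theorem CliqCell.exists_ne {l : Fin k} (b : CliqCell L C l) : ∃ v, b.1 v ≠ 0 := by
  obtain ⟨v, _, hv⟩ := b.2.2; exact ⟨v, hv⟩

/-- An element of the common index set of `θ^cliq` and `θ^mod` is determined by its cell. -/
theorem cliqIdx_injective (hC : IsPerfectOrder G C) :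
    Function.Injective fun a : CliqIdx L C => a.2.1 := by
  rintro ⟨l, b⟩ ⟨l', b'⟩ h
  simp only at h
  have hb : ∀ {l : Fin k} (b : CliqCell L C l),
      supp b.1 ⊆ C l ∧ (supp b.1 ∩ res C l).Nonempty := by
    intro l b
    refine ⟨fun v hv => ?_, ?_⟩
    · by_contra hcon; exact mem_supp.1 hv (b.2.1 v hcon)
    · obtain ⟨v, hv, hv'⟩ := b.2.2
      exact ⟨v, Finset.mem_inter.2 ⟨mem_supp.2 hv', hv⟩⟩
  have hne : (supp b.1).Nonempty := by
    obtain ⟨v, hv⟩ := CliqCell.exists_ne b; exact ⟨v, mem_supp.2 hv⟩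
  have hcl : G.IsClique (supp b.1 : Set V) := (hC.isClique l).subset (hb b).1
  have hl : l = l' := (hC.existsUnique_group _ hne hcl).unique (hb b) (h ▸ hb b')
  subst hl
  congr 1
  exact Subtype.ext h

theorem exists_cliqIdx (hC : IsPerfectOrder G C) {a : Cell L} (ha : a ≠ 0)
    (hcl : G.IsClique (supp a : Set V)) : ∃ c : CliqIdx L C, c.2.1 = a := by
  have hne : (supp a).Nonempty := by
    by_contra hcon
    rw [Finset.not_nonempty_iff_eq_empty] at hcon
    refine ha (funext fun v => ?_)
    by_contra hv
    have := mem_supp.2 hv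
    simp [hcon] at this
  obtain ⟨l, ⟨h1, v, hv⟩, -⟩ := hC.existsUnique_group _ hne hcl
  rw [Finset.mem_inter] at hv
  refine ⟨⟨l, ⟨a, fun v hv => ?_, v, hv.2, mem_supp.1 hv.1⟩⟩, rfl⟩
  by_contra hcon; exact hv (h1 (mem_supp.2 hcon))

/-- The exponent `∑ θ(i_D)`, over the non-empty complete `D ⊆ supp i`, in `pMod`. -/
def modExponent (C : Fin k → Finset V) (θ : CliqIdx L C → ℝ) (i : Cell L) : ℝ :=
  ∑ a : CliqIdx L C with SubCell a.2.1 i, θ a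

theorem modExponent_eq_sum (θ : CliqIdx L C → ℝ) (i : Cell L) :
    modExponent C θ i = ∑ l, ∑ b : CliqCell L C l with SubCell b.1 i, θ ⟨l, b⟩ := by
  rw [modExponent, Finset.sum_filter, Fintype.sum_sigma]
  refine Finset.sum_congr rfl fun l _ => ?_
  rw [Finset.sum_filter]

theorem dependsOn_cliqSum (θ : CliqIdx L C → ℝ) (l : Fin k) :
    DependsOn (fun i => ∑ b : CliqCell L C l with SubCell b.1 i, θ ⟨l, b⟩) (C l : Set V) := by
  intro i j h
  refine Finset.sum_congr (Finset.filter_congr fun b _ => ?_) fun _ _ => rfl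
  rw [← subCell_restrict_iff b.2.1, restrict_congr (i := i) (j := j) h, subCell_restrict_iff b.2.1]

theorem sum_exp_pos (f : Cell L → ℝ) : 0 < ∑ j : Cell L, Real.exp (f j) :=
  Finset.sum_pos (fun _ _ => Real.exp_pos _) ⟨0, Finset.mem_univ _⟩

theorem pMod_pos (θ : CliqIdx L C → ℝ) (i : Cell L) : 0 < pMod C θ i :=
  div_pos (Real.exp_pos _) (sum_exp_pos _)

theorem sum_pMod (θ : CliqIdx L C → ℝ) : ∑ i, pMod C θ i = 1 := by
  simp_rw [pMod, ← Finset.sum_div]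
  exact div_self (sum_exp_pos _).ne'

theorem log_pMod (θ : CliqIdx L C → ℝ) (i : Cell L) : Real.log (pMod C θ i) =
    modExponent C θ i - Real.log (∑ j : Cell L, Real.exp (modExponent C θ j)) := by
  rw [pMod, Real.log_div (Real.exp_pos _).ne' (sum_exp_pos _).ne', Real.log_exp]; rfl

theorem pMod_eq_prod (θ : CliqIdx L C → ℝ) (i : Cell L) :
    pMod C θ i = (∑ j : Cell L, Real.exp (modExponent C θ j))⁻¹ *
      ∏ l, Real.exp (∑ b : CliqCell L C l with SubCell b.1 i, θ ⟨l, b⟩) := by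
  rw [← Real.exp_sum, ← modExponent_eq_sum, pMod, div_eq_inv_mul]; rfl

theorem exists_pMod_eq_pCond (hC : IsPerfectOrder G C) (θ : CliqIdx L C → ℝ) :
    ∃ θ', pMod C θ = pCond C θ' := by
  have h : ∀ l, DependsOn
      (fun i => Real.exp (∑ b : CliqCell L C l with SubCell b.1 i, θ ⟨l, b⟩)) (C l : Set V) := by
    intro l x y h
    exact congrArg Real.exp (dependsOn_cliqSum θ l h)
  exact exists_eq_pCond hC _ (fun _ _ => Real.exp_pos _) h _ (pMod_eq_prod θ) (sum_pMod θ)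

/-- Hammersley–Clifford: under the pairwise Markov property the log-odds-ratios belonging to
incomplete sets vanish. -/
theorem mob_log_eq_zero {p : Cell L → ℝ} (hp : p ∈ markovModel G) {a : Cell L}
    (ha : ¬ G.IsClique (supp a : Set V)) : mob (fun j => Real.log (p j)) a = 0 := by
  obtain ⟨hpos, -, hM⟩ := hp
  simp only [SimpleGraph.IsClique, Set.Pairwise] at ha
  push Not at ha
  obtain ⟨γ, hγ, δ, hδ, hne, hadj⟩ := ha
  have e : (fun j => Real.log (p j)) = fun j =>
      (Real.log (marg p (Finset.univ \ {γ}) j) + Real.log (marg p (Finset.univ \ {δ}) j)) -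
        Real.log (marg p (Finset.univ \ {γ, δ}) j) := by
    funext j
    have h := congrArg Real.log (hM γ δ hne hadj j)
    rw [Real.log_mul (hpos _).ne' (marg_pos hpos _ _).ne',
      Real.log_mul (marg_pos hpos _ _).ne' (marg_pos hpos _ _).ne'] at h
    linarith
  have hlog : ∀ D : Finset V, DependsOn (fun j => Real.log (marg p D j)) (D : Set V) := by
    intro D x y h; simp only; rw [dependsOn_marg p D h]
  have hγ' : a γ ≠ 0 := mem_supp.1 hγ
  have hδ' : a δ ≠ 0 := mem_supp.1 hδ
  rw [e, mob_sub, mob_add, mob_eq_zero (hlog _) hγ' (by simp), mob_eq_zero (hlog _) hδ' (by simp),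
    mob_eq_zero (hlog _) hγ' (by simp)]
  simp

theorem modExponent_eq_sum_cell (θ : CliqIdx L C → ℝ) (i : Cell L) :
    modExponent C θ i =
      ∑ a : Cell L with SubCell a i, ∑ c : CliqIdx L C with c.2.1 = a, θ c := by
  rw [modExponent]
  symm
  have h := Finset.sum_fiberwise_of_maps_to (s := Finset.univ.filter fun c : CliqIdx L C =>
      SubCell c.2.1 i) (t := Finset.univ.filter fun a : Cell L => SubCell a i)
      (g := fun c => c.2.1) (fun c hc => by simpa using hc) θ
  rw [← h]
  refine Finset.sum_congr rfl fun a ha => Finset.sum_congr ?_ fun _ _ => rfl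
  ext c
  simp only [Finset.mem_filter, Finset.mem_univ, true_and] at ha ⊢
  exact ⟨fun h => ⟨h ▸ ha, h⟩, fun h => h.2⟩

theorem sum_cliqIdx_eq (hC : IsPerfectOrder G C) (θ : CliqIdx L C → ℝ) (c : CliqIdx L C) :
    ∑ c' : CliqIdx L C with c'.2.1 = c.2.1, θ c' = θ c := by
  rw [Finset.sum_eq_single c]
  · intro c' hc' hne
    exact absurd (cliqIdx_injective hC (Finset.mem_filter.1 hc').2) hne
  · simp

theorem mob_modExponent (hC : IsPerfectOrder G C) (θ : CliqIdx L C → ℝ) (c : CliqIdx L C) :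
    mob (modExponent C θ) c.2.1 = θ c := by
  rw [mob_eq_of_eq_sum (modExponent_eq_sum_cell θ), sum_cliqIdx_eq hC]

theorem thetaMod_pMod (hC : IsPerfectOrder G C) (θ : CliqIdx L C → ℝ) :
    thetaMod C (pMod C θ) = θ := by
  funext c
  rw [thetaMod, logOdds_eq_mob (pMod_pos θ)]
  simp_rw [log_pMod]
  rw [mob_sub, mob_modExponent hC, mob_const _ (CliqCell.exists_ne c.2), sub_zero]

/-- The log-linear expansion of a Markov probability: the interactions of incomplete sets vanish. -/
theorem log_eq_modExponent (hC : IsPerfectOrder G C) {p : Cell L → ℝ} (hp : p ∈ markovModel G)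
    (i : Cell L) : Real.log (p i) = Real.log (p 0) + modExponent C (thetaMod C p) i := by
  have h1 := sum_subCell_mob (fun j => Real.log (p j)) i
  rw [← h1, modExponent_eq_sum_cell]
  have h2 : ∑ a : Cell L with SubCell a i, (if a = 0 then Real.log (p 0) else 0)
      = Real.log (p 0) := by
    rw [Finset.sum_eq_single 0]
    · simp
    · intro a _ ha; simp [ha]
    · intro h
      exact absurd (Finset.mem_filter.2 ⟨Finset.mem_univ _, fun v hv => absurd rfl hv⟩) h
  conv_rhs => rw [← h2]
  rw [← Finset.sum_add_distrib]
  refine Finset.sum_congr rfl fun a _ => ?_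
  by_cases ha : a = 0
  · subst ha
    rw [if_pos rfl, mob_zero_cell, Finset.sum_eq_zero, add_zero]
    intro c hc
    obtain ⟨v, hv⟩ := CliqCell.exists_ne c.2
    exact absurd (congrFun (Finset.mem_filter.1 hc).2 v) hv
  · rw [if_neg ha, zero_add]
    by_cases hcl : G.IsClique (supp a : Set V)
    · obtain ⟨c, rfl⟩ := exists_cliqIdx hC ha hcl
      rw [sum_cliqIdx_eq hC, thetaMod, logOdds_eq_mob hp.1]
    · rw [mob_log_eq_zero hp hcl, Finset.sum_eq_zero]
      intro c hc
      have hc' := (Finset.mem_filter.1 hc).2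
      refine absurd ((hC.isClique c.1).subset fun v hv => ?_) hcl
      by_contra hcon
      rw [← hc'] at hv
      exact mem_supp.1 hv (c.2.2.1 v hcon)

theorem pMod_thetaMod (hC : IsPerfectOrder G C) {p : Cell L → ℝ} (hp : p ∈ markovModel G) :
    pMod C (thetaMod C p) = p := by
  have h : ∀ i, Real.exp (modExponent C (thetaMod C p) i) = p i / p 0 := by
    intro i
    have := log_eq_modExponent hC hp i
    rw [← Real.exp_log (div_pos (hp.1 i) (hp.1 0)), Real.log_div (hp.1 i).ne' (hp.1 0).ne', this]
    congr 1; ring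
  funext i
  change Real.exp (modExponent C (thetaMod C p) i) /
    ∑ j, Real.exp (modExponent C (thetaMod C p) j) = p i
  simp_rw [h, ← Finset.sum_div, hp.2.1]
  have := (hp.1 0).ne'
  field_simp

theorem isParametrization_pMod (hC : IsPerfectOrder G C) :
    IsParametrization (L := L) (markovModel G) (pMod C) (thetaMod C) where
  mem θ := by obtain ⟨θ', h⟩ := exists_pMod_eq_pCond hC θ; rw [h]; exact pCond_mem hC θ'
  left_inv := thetaMod_pMod hC
  right_inv _ hp := pMod_thetaMod hC hp

theorem isParametrization_pCond (hC : IsPerfectOrder G C) :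
    IsParametrization (L := L) (markovModel G) (pCond C) (thetaCond C) where
  mem := pCond_mem hC
  left_inv := thetaCond_pCond hC.hlt_eq_univ
  right_inv p hp := by
    obtain ⟨θ, h⟩ := exists_pMod_eq_pCond hC (thetaMod C p)
    rw [pMod_thetaMod hC hp] at h
    rw [h, thetaCond_pCond hC.hlt_eq_univ]

/-- On the slice `i_S`, the log-ratio to the zero cell collects the clique interactions of all the
subcells of `(i_S, r)` that meet the residual. -/
theorem xi_condOfCliq (θ : CliqIdx L C → ℝ) (g : CondGroup L C) (r : Cell L) :
    xi C (condOfCliq C θ) g r =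
      ∑ b : CliqCell L C g.1 with SubCell b.1 (glue (sep C g.1) g.2.1 r), θ ⟨g.1, b⟩ := by
  rw [xi]
  simp only [condOfCliq]
  have h : ∀ b : CliqCell L C g.1,
      (∀ v, v ∉ res C g.1 → restrict (res C g.1) b.1 v = 0) ∧
        ∃ v, restrict (res C g.1) b.1 v ≠ 0 := by
    intro b
    refine ⟨fun v hv => if_neg hv, ?_⟩
    obtain ⟨v, hv, hv'⟩ := b.2.2
    exact ⟨v, by simpa [restrict, hv] using hv'⟩
  rw [Finset.sum_comm' (t' := Finset.univ.filter fun b : CliqCell L C g.1 =>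
    SubCell b.1 (glue (sep C g.1) g.2.1 r)) (s' := fun b => {⟨restrict (res C g.1) b.1, h b⟩})]
  · simp
  · intro a b
    simp only [Finset.mem_filter, Finset.mem_univ, true_and, Finset.mem_singleton]
    constructor
    · rintro ⟨h1, h2, h3⟩
      refine ⟨Subtype.ext h2.symm, fun v hv => ?_⟩
      rw [h3 v hv]
      by_cases hs : v ∈ sep C g.1
      · simp [glue, hs]
      · have hav := h3 v hv
        simp only [glue, hs, if_false] at hav ⊢
        exact h1 v (hav ▸ hv)
    · rintro ⟨h1, h2⟩
      subst h1
      refine ⟨fun v hv => ?_, rfl, fun v hv => ?_⟩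
      · by_cases hr : v ∈ res C g.1
        · have hs : v ∉ sep C g.1 := fun h' => disjoint_sep_res C _ h' hr
          simp only [restrict, hr, if_true] at hv ⊢
          rw [h2 v hv]; simp [glue, hs]
        · simp [restrict, hr] at hv
      · by_cases hs : v ∈ sep C g.1
        · rw [h2 v hv]; simp [glue, hs]
        · have hr : v ∈ res C g.1 := by
            by_contra hr
            refine hv (b.2.1 v fun hc => ?_)
            rcases mem_clique_iff.1 hc with h' | h'
            · exact hs h'
            · exact hr h'
          simp [glue, hs, restrict, hr]

theorem logFactor_condOfCliq (θ : CliqIdx L C → ℝ) (l : Fin k) (i : Cell L) :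
    logFactor C (condOfCliq C θ) l i =
      (∑ b : CliqCell L C l with SubCell b.1 i, θ ⟨l, b⟩) -
        cumulant C (condOfCliq C θ) (slice C l i) := by
  rw [logFactor, xi_condOfCliq]
  congr 1
  refine Finset.sum_congr (Finset.filter_congr fun b _ => ?_) fun _ _ => rfl
  rw [← subCell_restrict_iff b.2.1]
  conv_rhs => rw [← subCell_restrict_iff b.2.1]
  have : restrict (C l) (glue (sep C (slice C l i).1) (slice C l i).2.1 (restrict (res C l) i)) =
      restrict (C l) i := by
    refine restrict_congr fun v hv => ?_
    rcases mem_clique_iff.1 hv with h | h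
    · simp [slice, glue, h, restrict]
    · have : v ∉ sep C l := fun h' => disjoint_sep_res C _ h' h
      simp [slice, glue, h, this, restrict]
  change _ ↔ SubCell b.1 (restrict (C l) i)
  rw [← this]; rfl

theorem mob_logFactor_cliq (θ : CliqIdx L C → ℝ) (l : Fin k) (b : CliqCell L C l) :
    mob (logFactor C (condOfCliq C θ) l) b.1 = θ ⟨l, b⟩ := by
  obtain ⟨v, hv, hv'⟩ := b.2.2
  have h1 : DependsOn (fun i : Cell L => cumulant C (condOfCliq C θ) (slice C l i))
      (sep C l : Set V) := by
    intro i j h; simp only; rw [slice_congr h]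
  have h2 : logFactor C (condOfCliq C θ) l = fun i =>
      (∑ b : CliqCell L C l with SubCell b.1 i, θ ⟨l, b⟩) -
        cumulant C (condOfCliq C θ) (slice C l i) := funext (logFactor_condOfCliq θ l)
  rw [h2, mob_sub, mob_eq_zero h1 hv' (fun h => disjoint_sep_res C _ h hv), sub_zero]
  exact (mob_eq_of_eq_sum (fun j => sum_subtype_eq (fun c => SubCell c j) fun c => θ ⟨l, c⟩)
    b.1).trans (dif_pos b.2)

/-- `θ^{C_l}(i_D)` only involves the `l`-th conditional probability, as `D` meets `R_l`. -/
theorem thetaCliq_pCond (hk : hlt C k = Finset.univ) (θ : CondIdx L C → ℝ) (c : CliqIdx L C) :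
    thetaCliq C (pCond C θ) c = mob (logFactor C θ c.1) c.2.1 := by
  rw [thetaCliq, logOdds_eq_mob (marg_pos (pCond_pos θ) _)]
  simp_rw [marg_pCond_clique hk,
    fun j => Real.log_mul (Real.exp_pos (logFactor C θ c.1 j)).ne'
      (marg_pos (pCond_pos θ) (sep C c.1) j).ne', Real.log_exp]
  obtain ⟨v, hv, hv'⟩ := c.2.2.2
  rw [mob_add, mob_eq_zero (D := sep C c.1) (φ := fun j => Real.log (marg (pCond C θ) (sep C c.1) j))
    (fun x y h => by simp only; rw [dependsOn_marg _ _ h]) hv'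
    (fun h => disjoint_sep_res C _ h hv), add_zero]

theorem thetaCliq_pCliq (hk : hlt C k = Finset.univ) (θ : CliqIdx L C → ℝ) :
    thetaCliq C (pCliq C θ) = θ := by
  funext c
  rw [pCliq, thetaCliq_pCond hk, mob_logFactor_cliq]

/-- The correspondence `(i_F, i_E) ↔ (l, i_F), i_E` between the two index sets. -/
def cliqEquivCond (C : Fin k → Finset V) (l : Fin k) :
    CliqCell L C l ≃ Table L (sep C l) × NZ L (res C l) where
  toFun b := (⟨restrict (sep C l) b.1, fun _ hv => if_neg hv⟩,
    ⟨restrict (res C l) b.1, fun _ hv => if_neg hv, by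
      obtain ⟨v, hv, hv'⟩ := b.2.2
      exact ⟨v, by simpa [restrict, hv] using hv'⟩⟩)
  invFun x := ⟨glue (sep C l) x.1.1 x.2.1, fun v hv => by
      have h1 : v ∉ sep C l := fun h => hv (mem_clique_iff.2 (Or.inl h))
      have h2 : v ∉ res C l := fun h => hv (mem_clique_iff.2 (Or.inr h))
      simp [glue, h1, x.2.2.1 v h2], by
      obtain ⟨v, hv⟩ := x.2.2.2
      have h2 : v ∈ res C l := by by_contra h; exact hv (x.2.2.1 v h)
      have h1 : v ∉ sep C l := fun h => disjoint_sep_res C l h h2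
      exact ⟨v, h2, by simpa [glue, h1] using hv⟩⟩
  left_inv b := by
    apply Subtype.ext
    funext v
    by_cases h1 : v ∈ sep C l
    · simp [glue, restrict, h1]
    · by_cases h2 : v ∈ res C l
      · simp [glue, restrict, h1, h2]
      · have : v ∉ C l := fun h => (mem_clique_iff.1 h).elim h1 h2
        simp [glue, restrict, h1, h2, b.2.1 v this]
  right_inv x := by
    refine Prod.ext (Subtype.ext (funext fun v => ?_)) (Subtype.ext (funext fun v => ?_))
    · by_cases h1 : v ∈ sep C l
      · simp [glue, restrict, h1]
      · simp [restrict, h1, x.1.2 v h1]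
    · by_cases h2 : v ∈ res C l
      · have h1 : v ∉ sep C l := fun h => disjoint_sep_res C l h h2
        simp [glue, restrict, h1, h2]
      · simp [restrict, h2, x.2.2.1 v h2]

/-- The bijection between the index set of `θ^cliq` and that of `θ^cond`. -/
def idxEquiv (C : Fin k → Finset V) : CliqIdx L C ≃ CondIdx L C where
  toFun c := ⟨⟨c.1, (cliqEquivCond C c.1 c.2).1⟩, (cliqEquivCond C c.1 c.2).2⟩
  invFun a := ⟨a.1.1, (cliqEquivCond C a.1.1).symm (a.1.2, a.2)⟩
  left_inv c := by obtain ⟨l, b⟩ := c; simp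
  right_inv a := by obtain ⟨⟨l, s⟩, a⟩ := a; simp

/-- `condOfCliq` as a linear map. -/
def condOfCliqLin (L : V → Type*) [∀ v, Fintype (L v)] [∀ v, DecidableEq (L v)] [∀ v, Zero (L v)]
    (C : Fin k → Finset V) : (CliqIdx L C → ℝ) →ₗ[ℝ] (CondIdx L C → ℝ) where
  toFun := condOfCliq C
  map_add' x y := by funext a; simp [condOfCliq, Finset.sum_add_distrib]
  map_smul' c x := by funext a; simp [condOfCliq, Finset.mul_sum]

theorem condOfCliq_injective (hk : hlt C k = Finset.univ) :
    Function.Injective (condOfCliq (L := L) C) := by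
  intro x y h
  have : pCliq C x = pCliq C y := by rw [pCliq, pCliq, h]
  rw [← thetaCliq_pCliq hk x, ← thetaCliq_pCliq hk y, this]

theorem condOfCliq_surjective (hk : hlt C k = Finset.univ) :
    Function.Surjective (condOfCliq (L := L) C) := by
  have hd : Module.finrank ℝ (CliqIdx L C → ℝ) = Module.finrank ℝ (CondIdx L C → ℝ) := by
    rw [Module.finrank_fintype_fun_eq_card, Module.finrank_fintype_fun_eq_card]
    exact Fintype.card_congr (idxEquiv C)
  exact (LinearMap.injective_iff_surjective_of_finrank_eq_finrank
    (f := condOfCliqLin L C) hd).1 (condOfCliq_injective hk)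

theorem isParametrization_pCliq (hC : IsPerfectOrder G C) :
    IsParametrization (L := L) (markovModel G) (pCliq C) (thetaCliq C) where
  mem θ := pCond_mem hC _
  left_inv := thetaCliq_pCliq hC.hlt_eq_univ
  right_inv p hp := by
    obtain ⟨θ, h⟩ := condOfCliq_surjective hC.hlt_eq_univ (thetaCond C p)
    have h1 : p = pCliq C θ := by
      rw [pCliq, h, (isParametrization_pCond hC).right_inv p hp]
    rw [h1, thetaCliq_pCliq hC.hlt_eq_univ]

/-- Summing out the coordinates outside `H_l`: the terms of the exponent supported in `H_l` factor
out, and the remaining sum is the argument of the logarithm in `cliqOfMod`. -/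
theorem log_marg_pMod (θ : CliqIdx L C → ℝ) (l : Fin k) (i : Cell L) :
    Real.log (marg (pMod C θ) (hist C l) i) =
      (∑ a : Cell L with SubCell a i, ∑ c : CliqIdx L C with
          c.2.1 = a ∧ ∀ v, v ∉ hist C l → c.2.1 v = 0, θ c) +
        Real.log (1 + ∑ j : NZ L (Finset.univ \ hist C l), Real.exp
          (∑ a : CliqIdx L C with
            SubCell a.2.1 (glue (hist C l) i j.1) ∧ ∃ v ∉ hist C l, a.2.1 v ≠ 0, θ a)) -
        Real.log (∑ j : Cell L, Real.exp (modExponent C θ j)) := by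
  set H := hist C l
  set Z := ∑ j : Cell L, Real.exp (modExponent C θ j)
  have hZ : 0 < Z := sum_exp_pos _
  set E := ∑ a : Cell L with SubCell a i, ∑ c : CliqIdx L C with
          c.2.1 = a ∧ ∀ v, v ∉ H → c.2.1 v = 0, θ c with hE
  set W : Cell L → ℝ := fun j => ∑ a : CliqIdx L C with
            SubCell a.2.1 (glue H i j) ∧ ∃ v ∉ H, a.2.1 v ≠ 0, θ a with hW
  have hE' : E = ∑ c : CliqIdx L C with SubCell c.2.1 i ∧ ∀ v, v ∉ H → c.2.1 v = 0, θ c := by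
    have h := Finset.sum_fiberwise_of_maps_to (s := Finset.univ.filter fun c : CliqIdx L C =>
      SubCell c.2.1 i ∧ ∀ v, v ∉ H → c.2.1 v = 0)
      (t := Finset.univ.filter fun a : Cell L => SubCell a i)
      (g := fun c => c.2.1) (fun c hc => by
        simp only [Finset.mem_filter, Finset.mem_univ, true_and] at hc ⊢; exact hc.1) θ
    rw [hE, ← h]
    refine Finset.sum_congr rfl fun a ha => Finset.sum_congr ?_ fun _ _ => rfl
    ext c
    simp only [Finset.mem_filter, Finset.mem_univ, true_and] at ha ⊢
    exact ⟨fun h => ⟨⟨h.1 ▸ ha, h.2⟩, h.1⟩, fun h => ⟨h.2, h.1.2⟩⟩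
  have hexp : ∀ t : Cell L, modExponent C θ (glue H i t) = E + W t := by
    intro t
    rw [hE', hW, modExponent, ← Finset.sum_filter_add_sum_filter_not
      (Finset.univ.filter fun c : CliqIdx L C => SubCell c.2.1 (glue H i t))
      (fun c => ∀ v, v ∉ H → c.2.1 v = 0)]
    rw [Finset.filter_filter, Finset.filter_filter]
    congr 1
    · refine Finset.sum_congr (Finset.filter_congr fun c _ => ?_) fun _ _ => rfl
      refine and_congr_left fun hc => ?_
      rw [← subCell_restrict_iff hc]
      conv_rhs => rw [← subCell_restrict_iff hc]
      rw [restrict_congr (i := glue H i t) (j := i)]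
      intro v hv; simp [glue, hv]
    · refine Finset.sum_congr (Finset.filter_congr fun c _ => ?_) fun _ _ => rfl
      push Not
      rfl
  have hW0 : W 0 = 0 := by
    refine Finset.sum_eq_zero fun c hc => ?_
    obtain ⟨h1, v, hv, hv'⟩ := (Finset.mem_filter.1 hc).2
    have := h1 v hv'
    simp [glue, hv] at this
    exact absurd this hv'
  have key : marg (pMod C θ) H i = Real.exp E *
      (1 + ∑ j : NZ L (Finset.univ \ H), Real.exp (W j.1)) / Z := by
    have hH : H = Finset.univ \ (Finset.univ \ H) := by simp
    rw [marg]
    conv_lhs => rw [hH]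
    rw [sum_agree_compl]
    have : ∀ t : Table L (Finset.univ \ H), pMod C θ (glue (Finset.univ \ H) t.1 i) =
        Real.exp E * Real.exp (W t.1) / Z := by
      intro t
      have e : glue (Finset.univ \ H) t.1 i = glue H i t.1 := by
        funext v; by_cases hv : v ∈ H <;> simp [glue, hv]
      rw [e, ← Real.exp_add, ← hexp]; rfl
    simp_rw [this, ← Finset.sum_div, ← Finset.mul_sum]
    rw [sum_table_eq _ fun t => Real.exp (W t), hW0, Real.exp_zero]
  rw [key, Real.log_div (mul_pos (Real.exp_pos _) (one_add_sum_exp_pos _ _)).ne' hZ.ne',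
    Real.log_mul (Real.exp_pos _).ne' (one_add_sum_exp_pos _ _).ne', Real.log_exp]

/-- Summing out the residuals of the later cliques changes the interactions of a clique by the
Möbius transform of the log of the normalizing sums. -/
theorem thetaCliq_pMod (hC : IsPerfectOrder G C) (θ : CliqIdx L C → ℝ) :
    thetaCliq C (pMod C θ) = cliqOfMod C θ := by
  funext c
  obtain ⟨θ', hθ'⟩ := exists_pMod_eq_pCond hC θ
  obtain ⟨v, hv, hv'⟩ := c.2.2.2
  have h1 : thetaCliq C (pMod C θ) c =
      mob (fun j => Real.log (marg (pMod C θ) (hist C c.1) j)) c.2.1 := by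
    rw [hθ', thetaCliq_pCond hC.hlt_eq_univ, hist_eq, marg_pCond_hlt hC.hlt_eq_univ θ' c.1.2]
    simp_rw [partialProd_succ, fun j => Real.log_mul (partialProd_pos θ' c.1 j).ne'
      (Real.exp_pos (logFactor C θ' c.1 j)).ne', Real.log_exp]
    rw [mob_add, mob_eq_zero (D := hlt C c.1)
      (φ := fun j => Real.log (partialProd C θ' c.1 j))
      (fun x y h => by simp only; rw [dependsOn_partialProd _ _ h]) hv'
      (mem_res.1 hv).2, zero_add]
  rw [h1]
  simp_rw [log_marg_pMod]
  rw [mob_sub, mob_const _ (CliqCell.exists_ne c.2), sub_zero, mob_add, mob_sum_subCell, cliqOfMod]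
  congr 1
  rw [← sum_cliqIdx_eq hC θ c]
  refine Finset.sum_congr (Finset.filter_congr fun c' _ => ?_) fun _ _ => rfl
  refine ⟨fun h => h.1, fun h => ⟨h, fun v hv => ?_⟩⟩
  rw [h]
  refine c.2.2.1 v fun hc => hv ?_
  rw [hist_eq, mem_hlt_succ]; exact Or.inr hc

theorem pMod_eq_pCliq (hC : IsPerfectOrder G C) (θ : CliqIdx L C → ℝ) :
    pMod C θ = pCliq C (cliqOfMod C θ) := by
  rw [← thetaCliq_pMod hC, (isParametrization_pCliq hC).right_inv _
    ((isParametrization_pMod hC).mem θ)]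

end Param

/-! ### Explicit forms of the prior and of the likelihood -/

section Explicit

variable {V : Type*} [Fintype V] [DecidableEq V] {L : V → Type*} [∀ v, Fintype (L v)]
  [∀ v, DecidableEq (L v)] [∀ v, Zero (L v)] {k : ℕ} {C : Fin k → Finset V} {G : SimpleGraph V}

theorem nefCond_eq_exp (nD : CondIdx L C → ℝ) (nS : CondGroup L C → ℝ) (θ : CondIdx L C → ℝ) :
    nefCond C nD nS θ = Real.exp (∑ l, ∑ s : Table L (sep C l),
      ((∑ a : NZ L (res C l), θ ⟨⟨l, s⟩, a⟩ * nD ⟨⟨l, s⟩, a⟩) -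
        nS ⟨l, s⟩ * cumulant C θ ⟨l, s⟩)) := by
  rw [nefCond, ← Real.exp_sum, Fintype.sum_sigma]; rfl

theorem kCliq_eq_cumulant (θ : CliqIdx L C → ℝ) (l : Fin k) (s : Table L (sep C l)) :
    kCliq C θ l s.1 = cumulant C (condOfCliq C θ) ⟨l, s⟩ := by
  rw [kCliq, cumulant]; simp_rw [xi_condOfCliq]

theorem subCell_glue_iff {l : Fin k} (c : CliqCell L C l) (s : Cell L) :
    SubCell c.1 (glue (sep C l) s (restrict (res C l) c.1)) ↔
      SubCell (restrict (sep C l) c.1) s := by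
  refine forall_congr' fun v => ?_
  by_cases h1 : v ∈ sep C l
  · simp [glue, restrict, h1]
  · by_cases h2 : v ∈ res C l
    · simp [glue, restrict, h1, h2]
    · have : v ∉ C l := fun h => (mem_clique_iff.1 h).elim h1 h2
      simp [restrict, h1, c.2.1 v this]

/-- Rewriting the exponential family form in terms of `θ^cliq`: counts are summed over the cells
`i_{S_l}` lying above a given `i_F`. -/
theorem nefCond_condOfCliq (nD : CondIdx L C → ℝ) (nS : CondGroup L C → ℝ)
    (nD' : CliqIdx L C → ℝ) (nS' : CondGroup L C → ℝ)
    (hD : ∀ c : CliqIdx L C, nD' c = ∑ s : Table L (sep C c.1) with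
      SubCell (restrict (sep C c.1) c.2.1) s.1, nD ⟨⟨c.1, s⟩, (cliqEquivCond C c.1 c.2).2⟩)
    (hS : ∀ g : CondGroup L C, nS' g = ∑ s : Table L (sep C g.1) with SubCell g.2.1 s.1,
      nS ⟨g.1, s⟩) (θ : CliqIdx L C → ℝ) :
    nefCond C nD nS (condOfCliq C θ) = nefCliq C nD' nS' θ := by
  rw [nefCond_eq_exp, nefCliq, ← Real.exp_sum]
  congr 1
  refine Finset.sum_congr rfl fun l _ => ?_
  rw [Finset.sum_sub_distrib]
  congr 1
  · calc ∑ s : Table L (sep C l), ∑ a : NZ L (res C l),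
          condOfCliq C θ ⟨⟨l, s⟩, a⟩ * nD ⟨⟨l, s⟩, a⟩
        = ∑ s : Table L (sep C l), ∑ a : NZ L (res C l), ∑ c : CliqCell L C l,
            if restrict (res C l) c.1 = a.1 ∧ SubCell c.1 (glue (sep C l) s.1 a.1) then
              θ ⟨l, c⟩ * nD ⟨⟨l, s⟩, a⟩ else 0 := by
          refine Finset.sum_congr rfl fun s _ => Finset.sum_congr rfl fun a _ => ?_
          rw [condOfCliq, Finset.sum_mul, Finset.sum_filter]
      _ = ∑ c : CliqCell L C l, ∑ s : Table L (sep C l), ∑ a : NZ L (res C l),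
            if restrict (res C l) c.1 = a.1 ∧ SubCell c.1 (glue (sep C l) s.1 a.1) then
              θ ⟨l, c⟩ * nD ⟨⟨l, s⟩, a⟩ else 0 := by
          rw [Finset.sum_comm]
          conv_rhs => rw [Finset.sum_comm]
          simp_rw [Finset.sum_comm (s := Finset.univ (α := NZ L (res C l)))]
      _ = _ := by
          refine Finset.sum_congr rfl fun c _ => ?_
          rw [hD, Finset.mul_sum, Finset.sum_filter]
          refine Finset.sum_congr rfl fun s _ => ?_
          rw [Finset.sum_eq_single (cliqEquivCond C l c).2]
          · have : (cliqEquivCond C l c).2.1 = restrict (res C l) c.1 := rfl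
            rw [this]
            simp only [true_and, subCell_glue_iff]
          · intro a _ hne
            rw [if_neg]
            rintro ⟨h, -⟩
            exact hne (Subtype.ext h.symm)
          · simp
  · have h1 : ∀ s : Table L (sep C l), cumulant C (condOfCliq C θ) ⟨l, s⟩ =
        ∑ f : Table L (sep C l) with SubCell f.1 s.1, mob (kCliq C θ l) f.1 := by
      intro s
      rw [← kCliq_eq_cumulant, ← sum_subCell_mob (kCliq C θ l) s.1,
        sum_subtype_eq (fun f => SubCell f s.1) fun f : Table L (sep C l) =>
          mob (kCliq C θ l) f.1]
      refine Finset.sum_congr rfl fun f hf => ?_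
      rw [dif_pos]
      intro v hv
      by_contra hne
      exact hne (((Finset.mem_filter.1 hf).2 v hne).trans (s.2 v hv))
    simp_rw [h1, Finset.mul_sum]
    rw [Finset.sum_comm' (t' := Finset.univ) (s' := fun f => Finset.univ.filter fun s :
      Table L (sep C l) => SubCell f.1 s.1) (by simp)]
    refine Finset.sum_congr rfl fun f _ => ?_
    rw [hS, ← Finset.sum_mul]
    rw [mob, ← Finset.mul_sum]

theorem card_superCell (D : Finset V) (a : Cell L) (ha : ∀ v, v ∉ D → a v = 0) :
    (Finset.univ.filter fun r : Table L D => SubCell a r.1).card =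
      Fintype.card (Table L (D \ supp a)) := by
  rw [← Finset.card_univ]
  refine Finset.card_bij' (fun r _ => ⟨restrict (D \ supp a) r.1, fun v hv => if_neg hv⟩)
    (fun t _ => ⟨glue (supp a) a t.1, fun v hv => ?_⟩) ?_ ?_ ?_ ?_
  · have h1 := ha v hv
    have h2 : v ∉ supp a := by simpa [mem_supp] using h1
    simp only [glue, h2, if_false]
    exact t.2 v (by simp [hv])
  · simp
  · intro t _
    simp only [Finset.mem_filter, Finset.mem_univ, true_and]
    intro v hv
    simp [glue, mem_supp.2 hv]
  · intro r hr
    simp only [Finset.mem_filter, Finset.mem_univ, true_and] at hr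
    apply Subtype.ext
    funext v
    by_cases h : v ∈ supp a
    · simp [glue, h, hr v (mem_supp.1 h)]
    · by_cases hD : v ∈ D
      · simp [glue, restrict, h, hD]
      · simp [glue, restrict, h, hD, r.2 v hD]
  · intro t _
    apply Subtype.ext
    funext v
    by_cases h : v ∈ D \ supp a
    · have := (Finset.mem_sdiff.1 h).2
      simp only [restrict, h, if_true, glue, this, if_false]
    · simp only [restrict, h, if_false]; exact (t.2 v h).symm

theorem refDensity_pCond_eq_exp (hk : hlt C k = Finset.univ) (θ : CondIdx L C → ℝ) :
    refDensity C (pCond C θ) = Real.exp (∑ l, ∑ s : Table L (sep C l), ∑ r : Table L (res C l),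
      1 / 2 * (xi C θ ⟨l, s⟩ r.1 - cumulant C θ ⟨l, s⟩)) := by
  rw [refDensity, Real.exp_sum]
  refine Finset.prod_congr rfl fun l _ => ?_
  rw [Real.exp_sum]
  refine Finset.prod_congr rfl fun s _ => ?_
  rw [← Finset.mul_sum, mul_comm, Real.exp_mul, Real.exp_sum]
  congr 1
  refine Finset.prod_congr rfl fun r _ => ?_
  rw [condProb_pCond hk]
  congr 1
  exact logFactor_glue θ ⟨l, s⟩ r.1

theorem refDensity_pCond (hk : hlt C k = Finset.univ) (θ : CondIdx L C → ℝ) :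
    refDensity C (pCond C θ) = nefCond C
      (fun a => (Fintype.card (Table L (res C a.1.1 \ supp a.2.1)) : ℝ) / 2)
      (fun g => (Fintype.card (Table L (res C g.1)) : ℝ) / 2) θ := by
  rw [refDensity_pCond_eq_exp hk, nefCond_eq_exp]
  congr 1
  refine Finset.sum_congr rfl fun l _ => Finset.sum_congr rfl fun s _ => ?_
  simp_rw [mul_sub]
  rw [Finset.sum_sub_distrib]
  congr 1
  · simp_rw [xi, Finset.mul_sum]
    rw [Finset.sum_comm' (t' := Finset.univ) (s' := fun a => Finset.univ.filter fun r :
      Table L (res C l) => SubCell a.1 r.1) (by simp)]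
    refine Finset.sum_congr rfl fun a _ => ?_
    rw [Finset.sum_const, card_superCell _ _ a.2.1, nsmul_eq_mul]
    ring
  · rw [Finset.sum_const, Finset.card_univ, nsmul_eq_mul]; ring

theorem supp_restrict_sep_sdiff {l : Fin k} (c : CliqCell L C l) :
    sep C l \ supp (restrict (sep C l) c.1) = sep C l \ supp c.1 := by
  rw [supp_restrict]; ext v; simp only [Finset.mem_sdiff, Finset.mem_inter]; tauto

theorem supp_restrict_res_sdiff {l : Fin k} (c : CliqCell L C l) :
    res C l \ supp (restrict (res C l) c.1) = res C l \ supp c.1 := by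
  rw [supp_restrict]; ext v; simp only [Finset.mem_sdiff, Finset.mem_inter]; tauto

theorem refDensity_pCliq (hk : hlt C k = Finset.univ) (θ : CliqIdx L C → ℝ) :
    refDensity C (pCliq C θ) = nefCliq C
      (fun a => (Fintype.card (Table L (sep C a.1 \ supp a.2.1)) : ℝ) *
        (Fintype.card (Table L (res C a.1 \ supp a.2.1)) : ℝ) / 2)
      (fun g => (Fintype.card (Table L (sep C g.1 \ supp g.2.1)) : ℝ) *
        (Fintype.card (Table L (res C g.1)) : ℝ) / 2) θ := by
  rw [pCliq, refDensity_pCond hk]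
  refine nefCond_condOfCliq _ _ _ _ (fun c => ?_) (fun g => ?_) θ
  · change _ = ∑ s : Table L (sep C c.1) with SubCell (restrict (sep C c.1) c.2.1) s.1,
      ((Fintype.card (Table L (res C c.1 \ supp (restrict (res C c.1) c.2.1))) : ℝ) / 2)
    rw [Finset.sum_const, card_superCell _ (restrict (sep C c.1) c.2.1) (fun v hv => if_neg hv),
      nsmul_eq_mul, supp_restrict_sep_sdiff, supp_restrict_res_sdiff, mul_div_assoc]
  · change _ = ∑ s : Table L (sep C g.1) with SubCell g.2.1 s.1,
      ((Fintype.card (Table L (res C g.1)) : ℝ) / 2)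
    rw [Finset.sum_const, card_superCell _ _ g.2.2, nsmul_eq_mul, mul_div_assoc]

/-- Splitting a sum over the cells according to their `i_{S}`-slices. -/
theorem sum_eq_sum_slice (S : Finset V) (f : Cell L → ℝ) :
    ∑ i, f i = ∑ s : Table L S, ∑ i : Cell L with ∀ v ∈ S, i v = s.1 v, f i := by
  rw [Finset.sum_comm' (t' := Finset.univ)
    (s' := fun i => {(⟨restrict S i, fun v hv => if_neg hv⟩ : Table L S)})]
  · simp
  · intro s i
    simp only [Finset.mem_filter, Finset.mem_univ, true_and, Finset.mem_singleton, and_true]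
    constructor
    · intro h
      apply Subtype.ext
      funext v
      by_cases hv : v ∈ S
      · simp [restrict, hv, h v hv]
      · simp [restrict, hv, s.2 v hv]
    · rintro rfl v hv
      simp [restrict, hv]

theorem prod_pCond_pow (n : Cell L → ℕ) (θ : CondIdx L C → ℝ) :
    ∏ i, pCond C θ i ^ n i = nefCond C
      (fun a => marg (fun i => (n i : ℝ)) (sep C a.1.1 ∪ supp a.2.1)
        (glue (sep C a.1.1) a.1.2.1 a.2.1))
      (fun g => marg (fun i => (n i : ℝ)) (sep C g.1) g.2.1) θ := by
  have h1 : ∏ i, pCond C θ i ^ n i = Real.exp (∑ l, ∑ i, (n i : ℝ) * logFactor C θ l i) := by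
    rw [Finset.sum_comm, Real.exp_sum]
    refine Finset.prod_congr rfl fun i _ => ?_
    rw [← Finset.mul_sum, ← log_pCond, mul_comm, Real.exp_mul, Real.exp_log (pCond_pos θ i),
      Real.rpow_natCast]
  rw [h1, nefCond_eq_exp]
  congr 1
  refine Finset.sum_congr rfl fun l _ => ?_
  rw [sum_eq_sum_slice (sep C l)]
  refine Finset.sum_congr rfl fun s _ => ?_
  have h2 : ∀ i : Cell L, (∀ v ∈ sep C l, i v = s.1 v) →
      logFactor C θ l i = xi C θ ⟨l, s⟩ i - cumulant C θ ⟨l, s⟩ := by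
    intro i hi
    have : slice C l i = ⟨l, s⟩ := by
      rw [← slice_glue s 0]
      refine slice_congr fun v hv => ?_
      simp [glue, hv, hi]
    rw [logFactor, this, ← xi_restrict θ ⟨l, s⟩ i]
  have h3 : ∑ i : Cell L with ∀ v ∈ sep C l, i v = s.1 v, (n i : ℝ) * logFactor C θ l i =
      ∑ i : Cell L with ∀ v ∈ sep C l, i v = s.1 v,
        ((n i : ℝ) * xi C θ ⟨l, s⟩ i - (n i : ℝ) * cumulant C θ ⟨l, s⟩) := by
    refine Finset.sum_congr rfl fun i hi => ?_
    rw [h2 i (Finset.mem_filter.1 hi).2, mul_sub]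
  rw [h3, Finset.sum_sub_distrib, ← Finset.sum_mul]
  congr 1
  simp_rw [xi, Finset.mul_sum]
  rw [Finset.sum_comm' (t' := Finset.univ) (s' := fun a => Finset.univ.filter fun i :
      Cell L => (∀ v ∈ sep C l, i v = s.1 v) ∧ SubCell a.1 i) (by simp)]
  refine Finset.sum_congr rfl fun a _ => ?_
  rw [marg, Finset.mul_sum]
  refine Finset.sum_congr (Finset.filter_congr fun i _ => ?_) fun _ _ => mul_comm _ _
  constructor
  · rintro ⟨h4, h5⟩ v hv
    by_cases hs : v ∈ sep C l
    · simp [glue, hs, h4]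
    · have hv' : v ∈ supp a.1 := by simpa [hs] using hv
      simp [glue, hs, h5 v (mem_supp.1 hv')]
  · intro h
    refine ⟨fun v hv => ?_, fun v hv => ?_⟩
    · rw [h v (Finset.mem_union_left _ hv)]; simp [glue, hv]
    · have hr : v ∈ res C l := by by_contra hcon; exact hv (a.2.1 v hcon)
      have hs : v ∉ sep C l := fun h' => disjoint_sep_res C l h' hr
      rw [h v (Finset.mem_union_right _ (mem_supp.2 hv))]; simp [glue, hs]

theorem sum_superCell_marg (q : Cell L → ℝ) (S : Finset V) (f : Table L S) (Q : Cell L → Prop)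
    [DecidablePred Q] :
    ∑ s : Table L S with SubCell f.1 s.1, ∑ j : Cell L with (∀ v ∈ S, j v = s.1 v) ∧ Q j, q j =
      ∑ j : Cell L with SubCell f.1 j ∧ Q j, q j := by
  rw [Finset.sum_comm' (t' := Finset.univ.filter fun j : Cell L => SubCell f.1 j ∧ Q j)
    (s' := fun i => {(⟨restrict S i, fun v hv => if_neg hv⟩ : Table L S)})]
  · simp
  · intro s i
    simp only [Finset.mem_filter, Finset.mem_univ, true_and, Finset.mem_singleton]
    constructor
    · rintro ⟨h, h1, h2⟩
      have e : s.1 = restrict S i := by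
        funext v
        by_cases hv : v ∈ S
        · simp [restrict, hv, h1 v hv]
        · simp [restrict, hv, s.2 v hv]
      refine ⟨Subtype.ext e, ?_, h2⟩
      rw [e] at h
      exact h.trans (subCell_restrict S i)
    · rintro ⟨rfl, h, h2⟩
      refine ⟨(subCell_restrict_iff f.2).2 h, fun v hv => by simp [restrict, hv], h2⟩

theorem prod_pCliq_pow (n : Cell L → ℕ) (θ : CliqIdx L C → ℝ) :
    ∏ i, pCliq C θ i ^ n i = nefCliq C
      (fun a => marg (fun i => (n i : ℝ)) (supp a.2.1) a.2.1)
      (fun g => marg (fun i => (n i : ℝ)) (supp g.2.1) g.2.1) θ := by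
  have hsub : ∀ a j : Cell L, (∀ v ∈ supp a, j v = a v) ↔ SubCell a j := by
    intro a j
    refine forall_congr' fun v => ?_
    rw [mem_supp]; exact forall_congr' fun _ => eq_comm
  rw [pCliq, prod_pCond_pow]
  refine nefCond_condOfCliq _ _ _ _ (fun c => ?_) (fun g => ?_) θ
  · have h := sum_superCell_marg (fun i => (n i : ℝ)) (sep C c.1) (cliqEquivCond C c.1 c.2).1
      (fun j => SubCell (restrict (res C c.1) c.2.1) j)
    have e1 : (cliqEquivCond C c.1 c.2).1.1 = restrict (sep C c.1) c.2.1 := rfl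
    have e2 : (cliqEquivCond C c.1 c.2).2.1 = restrict (res C c.1) c.2.1 := rfl
    rw [e1] at h
    dsimp only
    rw [e2]
    simp only [marg]
    calc _ = ∑ j : Cell L with SubCell (restrict (sep C c.1) c.2.1) j ∧
            SubCell (restrict (res C c.1) c.2.1) j, (n j : ℝ) := by
          refine Finset.sum_congr (Finset.filter_congr fun j _ => ?_) fun _ _ => rfl
          rw [hsub]
          constructor
          · intro h; exact ⟨(subCell_restrict _ _).trans h, (subCell_restrict _ _).trans h⟩
          · rintro ⟨h1, h2⟩ v hv
            have hc : v ∈ C c.1 := by by_contra hcon; exact hv (c.2.2.1 v hcon)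
            rcases mem_clique_iff.1 hc with hs | hr
            · have := h1 v; simp only [restrict, hs, if_true] at this; exact this hv
            · have := h2 v; simp only [restrict, hr, if_true] at this; exact this hv
      _ = _ := by
          rw [← h]
          refine Finset.sum_congr rfl fun s _ =>
            Finset.sum_congr (Finset.filter_congr fun j _ => ?_) fun _ _ => rfl
          rw [← hsub]
          constructor
          · rintro ⟨h1, h2⟩ v hv
            by_cases hs : v ∈ sep C c.1
            · simp [glue, hs, h1]
            · simp only [glue, hs, if_false]
              exact h2 v (by simpa [hs] using hv)
          · intro h3
            refine ⟨fun v hv => ?_, fun v hv => ?_⟩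
            · rw [h3 v (Finset.mem_union_left _ hv)]; simp [glue, hv]
            · have hr : v ∈ res C c.1 := by
                rw [supp_restrict] at hv; exact (Finset.mem_inter.1 hv).2
              have hs : v ∉ sep C c.1 := fun h' => disjoint_sep_res C _ h' hr
              rw [h3 v (Finset.mem_union_right _ hv)]; simp [glue, hs]
  · have h := sum_superCell_marg (fun i => (n i : ℝ)) (sep C g.1) g.2 (fun _ => True)
    simp only [and_true] at h
    simp only [marg, hsub]
    exact h.symm

end Explicit

/-! ### Exponential tails -/

section Tails

variable {ι : Type*} [Fintype ι]

theorem integrable_exp_neg_mul_norm {ε : ℝ} (hε : 0 < ε) :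
    Integrable fun y : ι → ℝ => Real.exp (-(ε * ‖y‖)) := by
  set n := Module.finrank ℝ (ι → ℝ) + 1 with hn
  have h0 : Integrable fun y : ι → ℝ => (1 + ‖y‖) ^ (-(n : ℝ)) :=
    integrable_one_add_norm (by rw [hn]; push_cast; linarith)
  refine (h0.const_mul (n.factorial * Real.exp ε / ε ^ n)).mono'
    (by fun_prop) (Eventually.of_forall fun y => ?_)
  have h1 : 0 < 1 + ‖y‖ := by positivity
  have h2 := Real.pow_div_factorial_le_exp (ε * (1 + ‖y‖)) (by positivity) n
  rw [Real.norm_of_nonneg (Real.exp_pos _).le, Real.rpow_neg h1.le, Real.rpow_natCast]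
  have h3 : Real.exp (ε * (1 + ‖y‖)) = Real.exp ε * Real.exp (ε * ‖y‖) := by
    rw [← Real.exp_add]; ring_nf
  rw [h3, mul_pow, div_le_iff₀ (by positivity)] at h2
  rw [Real.exp_neg]
  have h4 : 0 < Real.exp (ε * ‖y‖) := Real.exp_pos _
  rw [inv_le_iff_one_le_mul₀ h4]
  have h5 : 0 < ε ^ n * (1 + ‖y‖) ^ n := by positivity
  calc (1 : ℝ) = ε ^ n * (1 + ‖y‖) ^ n / (ε ^ n * (1 + ‖y‖) ^ n) := (div_self h5.ne').symm
    _ ≤ (Real.exp ε * Real.exp (ε * ‖y‖) * n.factorial) / (ε ^ n * (1 + ‖y‖) ^ n) := by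
        gcongr
    _ = _ := by field_simp

theorem one_add_le_mul_exp {δ t : ℝ} (hδ : 0 < δ) (ht : 0 ≤ t) :
    1 + t ≤ (1 + 1 / δ) * Real.exp (δ * t) := by
  have h1 : δ * t + 1 ≤ Real.exp (δ * t) := Real.add_one_le_exp _
  have h2 : 1 ≤ Real.exp (δ * t) := Real.one_le_exp (by positivity)
  have h3 : t ≤ 1 / δ * Real.exp (δ * t) := by
    rw [div_mul_eq_mul_div, le_div_iff₀ hδ]; linarith
  linarith

/-- A density with exponential tails, truncated to a set of fixed minimal mass, has a first moment
that grows at most linearly in the logarithm of the constants: this is Jensen's inequality for the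
exponential moment, in the form `t ≤ a - 1 + e^{-a} e^t`. -/
theorem setIntegral_norm_mul_le {K K₀ : Set (ι → ℝ)} (hK₀ : IsCompact K₀)
    (hsub : K₀ ⊆ K) {ρ : ℝ} (hρ : ∀ y ∈ K₀, ‖y‖ ≤ ρ) (hvol : volume K₀ ≠ 0) {ε A M : ℝ}
    (hε : 0 < ε) (hM : 0 ≤ M) {g : (ι → ℝ) → ℝ} (hg : Measurable g)
    (hlow : ∀ y, Real.exp (-(A + M * ‖y‖)) ≤ g y) (hup : ∀ y, g y ≤ Real.exp (A - ε * ‖y‖)) :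
    ∫ y in K, ‖y‖ * g y ≤ (2 / ε) * (2 * A + M * ρ +
      Real.log ((∫ y : ι → ℝ, Real.exp (-(ε / 2 * ‖y‖))) / (volume K₀).toReal)) *
        ∫ y in K, g y := by
  set I := ∫ y : ι → ℝ, Real.exp (-(ε / 2 * ‖y‖)) with hI
  set v := (volume K₀).toReal with hv
  have hint := integrable_exp_neg_mul_norm (ι := ι) (half_pos hε)
  have hIpos : 0 < I := integral_exp_pos hint
  have hvpos : 0 < v := ENNReal.toReal_pos hvol hK₀.measure_lt_top.ne
  have hgpos : ∀ y, 0 < g y := fun y => (Real.exp_pos _).trans_le (hlow y)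
  have hEg : ∀ y, Real.exp (ε / 2 * ‖y‖) * g y ≤ Real.exp A * Real.exp (-(ε / 2 * ‖y‖)) := by
    intro y
    refine (mul_le_mul_of_nonneg_left (hup y) (Real.exp_pos _).le).trans_eq ?_
    rw [← Real.exp_add, ← Real.exp_add]; congr 1; ring
  have hEgint : Integrable fun y => Real.exp (ε / 2 * ‖y‖) * g y := by
    refine (hint.const_mul (Real.exp A)).mono' (by fun_prop) (Eventually.of_forall fun y => ?_)
    rw [Real.norm_of_nonneg (mul_pos (Real.exp_pos _) (hgpos y)).le]
    exact hEg y
  have hgint : Integrable g := by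
    refine hEgint.mono' hg.aestronglyMeasurable (Eventually.of_forall fun y => ?_)
    rw [Real.norm_of_nonneg (hgpos y).le]
    exact le_mul_of_one_le_left (hgpos y).le (Real.one_le_exp (by positivity))
  have hNgint : Integrable fun y => ‖y‖ * g y := by
    refine (hEgint.const_mul (2 / ε)).mono' (by fun_prop) (Eventually.of_forall fun y => ?_)
    rw [Real.norm_of_nonneg (mul_nonneg (norm_nonneg _) (hgpos y).le), ← mul_assoc]
    refine mul_le_mul_of_nonneg_right ?_ (hgpos y).le
    have := Real.add_one_le_exp (ε / 2 * ‖y‖)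
    rw [div_mul_eq_mul_div, le_div_iff₀ hε]; linarith
  set a := 2 * A + M * ρ + Real.log (I / v) with ha
  have hlowint : v * Real.exp (-(A + M * ρ)) ≤ ∫ y in K, g y := by
    calc v * Real.exp (-(A + M * ρ)) = ∫ _ in K₀, Real.exp (-(A + M * ρ)) := by
          rw [setIntegral_const]; rfl
      _ ≤ ∫ y in K₀, g y := by
          refine setIntegral_mono_on (integrableOn_const hK₀.measure_lt_top.ne)
            hgint.integrableOn hK₀.measurableSet fun y hy => ?_
          refine le_trans (Real.exp_le_exp.2 ?_) (hlow y)
          have := mul_le_mul_of_nonneg_left (hρ y hy) hM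
          linarith
      _ ≤ ∫ y in K, g y := setIntegral_mono_set hgint.integrableOn
          (Eventually.of_forall fun y => (hgpos y).le) hsub.eventuallyLE
  have hEint : Real.exp (-a) * ∫ y in K, Real.exp (ε / 2 * ‖y‖) * g y ≤ ∫ y in K, g y := by
    have h1 : ∫ y in K, Real.exp (ε / 2 * ‖y‖) * g y ≤ Real.exp A * I := by
      calc _ ≤ ∫ y, Real.exp (ε / 2 * ‖y‖) * g y := setIntegral_le_integral hEgint
            (Eventually.of_forall fun y => (mul_pos (Real.exp_pos _) (hgpos y)).le)
        _ ≤ ∫ y, Real.exp A * Real.exp (-(ε / 2 * ‖y‖)) :=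
            integral_mono hEgint (hint.const_mul _) hEg
        _ = _ := integral_const_mul _ _
    refine le_trans (mul_le_mul_of_nonneg_left h1 (Real.exp_pos _).le) (le_trans (le_of_eq ?_) hlowint)
    have : Real.exp (-a) = Real.exp (-(2 * A + M * ρ)) * (v / I) := by
      rw [ha, neg_add, Real.exp_add, Real.exp_neg (Real.log _), Real.exp_log (div_pos hIpos hvpos),
        inv_div]
    rw [this]
    have e : Real.exp (-(A + M * ρ)) = Real.exp (-(2 * A + M * ρ)) * Real.exp A := by
      rw [← Real.exp_add]; congr 1; ring
    rw [e]; field_simp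
  have hJ : ∀ y, ε / 2 * (‖y‖ * g y) ≤
      (a - 1) * g y + Real.exp (-a) * (Real.exp (ε / 2 * ‖y‖) * g y) := by
    intro y
    have h1 := Real.add_one_le_exp (ε / 2 * ‖y‖ - a)
    have h2 : Real.exp (ε / 2 * ‖y‖ - a) = Real.exp (-a) * Real.exp (ε / 2 * ‖y‖) := by
      rw [← Real.exp_add]; congr 1; ring
    rw [h2] at h1
    have := mul_le_mul_of_nonneg_right h1 (hgpos y).le
    linarith
  have h3 : ε / 2 * ∫ y in K, ‖y‖ * g y ≤ a * ∫ y in K, g y := by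
    calc ε / 2 * ∫ y in K, ‖y‖ * g y = ∫ y in K, ε / 2 * (‖y‖ * g y) :=
          (integral_const_mul _ _).symm
      _ ≤ ∫ y in K, ((a - 1) * g y + Real.exp (-a) * (Real.exp (ε / 2 * ‖y‖) * g y)) :=
          integral_mono (hNgint.const_mul _).integrableOn
            ((hgint.const_mul _).add (hEgint.const_mul _)).integrableOn hJ
      _ = (a - 1) * (∫ y in K, g y) +
          Real.exp (-a) * ∫ y in K, Real.exp (ε / 2 * ‖y‖) * g y := by
          rw [integral_add (hgint.const_mul _).integrableOn (hEgint.const_mul _).integrableOn,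
            integral_const_mul, integral_const_mul]
      _ ≤ _ := by linarith
  calc ∫ y in K, ‖y‖ * g y = 2 / ε * (ε / 2 * ∫ y in K, ‖y‖ * g y) := by field_simp
    _ ≤ 2 / ε * (a * ∫ y in K, g y) := by gcongr
    _ = _ := by ring

end Tails

/-! ### Averaging over one group of coordinates -/

section Average

variable {κ : Type*} [Fintype κ] [DecidableEq κ] (gr : κ → ℕ)

/-- The coordinates in group `j`. -/
abbrev GroupSpace (j : ℕ) := {a : κ // gr a = j} → ℝ

/-- Replace the coordinates in group `j`. -/
abbrev ovEq (j : ℕ) (θ : κ → ℝ) (y : GroupSpace gr j) : κ → ℝ :=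
  override (fun a => gr a = j) θ y

/-- Replace the coordinates in the groups less important than `j`. -/
abbrev ovLt (j : ℕ) (θ : κ → ℝ) (x : {a : κ // gr a < j} → ℝ) : κ → ℝ :=
  override (fun a => gr a < j) θ x

variable {gr}

theorem override_of {P : κ → Prop} [DecidablePred P] {θ : κ → ℝ} {x : {a : κ // P a} → ℝ} {a : κ}
    (h : P a) : override P θ x a = x ⟨a, h⟩ := dif_pos h

theorem override_of_not {P : κ → Prop} [DecidablePred P] {θ : κ → ℝ} {x : {a : κ // P a} → ℝ}
    {a : κ} (h : ¬ P a) : override P θ x a = θ a := dif_neg h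

theorem ovEq_of {j : ℕ} {θ : κ → ℝ} {y : GroupSpace gr j} {a : κ} (h : gr a = j) :
    ovEq gr j θ y a = y ⟨a, h⟩ := dif_pos h

theorem ovEq_of_ne {j : ℕ} {θ : κ → ℝ} {y : GroupSpace gr j} {a : κ} (h : gr a ≠ j) :
    ovEq gr j θ y a = θ a := dif_neg h

theorem ovLt_of {j : ℕ} {θ : κ → ℝ} {x : {a : κ // gr a < j} → ℝ} {a : κ} (h : gr a < j) :
    ovLt gr j θ x a = x ⟨a, h⟩ := dif_pos h

theorem ovLt_of_not {j : ℕ} {θ : κ → ℝ} {x : {a : κ // gr a < j} → ℝ} {a : κ} (h : ¬ gr a < j) :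
    ovLt gr j θ x a = θ a := dif_neg h

theorem continuous_override (P : κ → Prop) [DecidablePred P] :
    Continuous fun p : (κ → ℝ) × ({a : κ // P a} → ℝ) => override P p.1 p.2 := by
  refine continuous_pi fun a => ?_
  by_cases h : P a
  · simp only [override_of h]; fun_prop
  · simp only [override_of_not h]; fun_prop

theorem norm_override_le (P : κ → Prop) [DecidablePred P] (θ : κ → ℝ) (x : {a : κ // P a} → ℝ) :
    ‖override P θ x‖ ≤ ‖θ‖ + ‖x‖ := by
  refine (pi_norm_le_iff_of_nonneg (by positivity)).2 fun a => ?_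
  by_cases h : P a
  · rw [override_of h]
    exact (norm_le_pi_norm x _).trans (le_add_of_nonneg_left (norm_nonneg _))
  · rw [override_of_not h]
    exact (norm_le_pi_norm θ _).trans (le_add_of_nonneg_right (norm_nonneg _))

theorem ovEq_ovEq (j : ℕ) (θ : κ → ℝ) (y y' : GroupSpace gr j) :
    ovEq gr j (ovEq gr j θ y) y' = ovEq gr j θ y' := by
  funext a; by_cases h : gr a = j <;> simp [override, h]

/-- Measurable functions of at most linear growth. -/
structure LinGrowth (M : ℝ) (φ : (κ → ℝ) → ℝ) : Prop where
  meas : Measurable φ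
  nonneg : 0 ≤ M
  le : ∀ θ, |φ θ| ≤ M * (1 + ‖θ‖)

/-- Positive weights with exponential tails in the coordinates of group `j`. -/
structure WeightBound (gr : κ → ℕ) (j : ℕ) (M ε : ℝ) (w : (κ → ℝ) → ℝ) : Prop where
  meas : Measurable w
  nonneg : 0 ≤ M
  eps_pos : 0 < ε
  lower : ∀ θ, Real.exp (-(M * (1 + ‖θ‖))) ≤ w θ
  upper : ∀ θ (y : GroupSpace gr j), w (ovEq gr j θ y) ≤ Real.exp (M * (1 + ‖θ‖) - ε * ‖y‖)

/-- The mean of `φ` over group `j`, restricted to `K`, with respect to the density proportional to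
`w`, the other coordinates being fixed. -/
def avg (j : ℕ) (K : Set (GroupSpace gr j)) (w φ : (κ → ℝ) → ℝ) (θ : κ → ℝ) : ℝ :=
  (∫ y in K, w (ovEq gr j θ y) * φ (ovEq gr j θ y)) / ∫ y in K, w (ovEq gr j θ y)

theorem measurable_ovEq (j : ℕ) (θ : κ → ℝ) : Measurable (ovEq gr j θ) :=
  ((continuous_override fun a => gr a = j).comp (by fun_prop : Continuous fun y => (θ, y))).measurable

theorem measurable_integral_ovEq (j : ℕ) (K : Set (GroupSpace gr j)) {f : (κ → ℝ) → ℝ}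
    (hf : Measurable f) : Measurable fun θ => ∫ y in K, f (ovEq gr j θ y) := by
  have h : StronglyMeasurable fun p : (κ → ℝ) × GroupSpace gr j => f (ovEq gr j p.1 p.2) :=
    (hf.comp (continuous_override fun a => gr a = j).measurable).stronglyMeasurable
  exact h.integral_prod_right'.measurable

theorem measurable_avg (j : ℕ) (K : Set (GroupSpace gr j)) {w φ : (κ → ℝ) → ℝ} (hw : Measurable w)
    (hφ : Measurable φ) : Measurable (avg j K w φ) :=
  (measurable_integral_ovEq j K (hw.mul hφ)).div (measurable_integral_ovEq j K hw)

theorem WeightBound.pos {j : ℕ} {M ε : ℝ} {w : (κ → ℝ) → ℝ} (h : WeightBound gr j M ε w)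
    (θ : κ → ℝ) : 0 < w θ := (Real.exp_pos _).trans_le (h.lower θ)

/-- The integrable function dominating `w φ` along group `j`. -/
def dominating (M M' ε : ℝ) (θ : κ → ℝ) {ι : Type*} [Fintype ι] (y : ι → ℝ) : ℝ :=
  Real.exp (M * (1 + ‖θ‖)) * (M' * (1 + ‖θ‖) * (1 + 1 / (ε / 2))) * Real.exp (-(ε / 2 * ‖y‖))

theorem abs_weight_mul_le {j : ℕ} {M ε M' : ℝ} {w φ : (κ → ℝ) → ℝ} (hw : WeightBound gr j M ε w)
    (hφ : LinGrowth M' φ) (θ : κ → ℝ) (y : GroupSpace gr j) :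
    |w (ovEq gr j θ y) * φ (ovEq gr j θ y)| ≤ dominating M M' ε θ y := by
  rw [abs_mul, abs_of_pos (hw.pos _)]
  have hε := hw.eps_pos
  have hM' := hφ.nonneg
  have h1 : |φ (ovEq gr j θ y)| ≤ M' * (1 + ‖θ‖) * ((1 + 1 / (ε / 2)) * Real.exp (ε / 2 * ‖y‖)) := by
    refine (hφ.le _).trans ?_
    rw [mul_assoc]
    refine mul_le_mul_of_nonneg_left ?_ hM'
    have h2 := norm_override_le (fun a => gr a = j) θ y
    have h3 := one_add_le_mul_exp (half_pos hε) (norm_nonneg y)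
    calc 1 + ‖ovEq gr j θ y‖ ≤ (1 + ‖θ‖) * (1 + ‖y‖) := by
          have := mul_nonneg (norm_nonneg θ) (norm_nonneg y)
          nlinarith
      _ ≤ _ := by gcongr
  calc w (ovEq gr j θ y) * |φ (ovEq gr j θ y)| ≤ Real.exp (M * (1 + ‖θ‖) - ε * ‖y‖) *
        (M' * (1 + ‖θ‖) * ((1 + 1 / (ε / 2)) * Real.exp (ε / 2 * ‖y‖))) := by
        refine mul_le_mul (hw.upper θ y) h1 (abs_nonneg _) (Real.exp_pos _).le
    _ = _ := by
        have : Real.exp (M * (1 + ‖θ‖) - ε * ‖y‖) = Real.exp (M * (1 + ‖θ‖)) *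
            (Real.exp (-(ε / 2 * ‖y‖)) * Real.exp (-(ε / 2 * ‖y‖))) := by
          rw [← Real.exp_add, ← Real.exp_add]; congr 1; ring
        have h4 : Real.exp (-(ε / 2 * ‖y‖)) * Real.exp (ε / 2 * ‖y‖) = 1 := by
          rw [← Real.exp_add]; simp
        rw [this, dominating]
        linear_combination (Real.exp (M * (1 + ‖θ‖)) * (M' * (1 + ‖θ‖)) * (1 + 1 / (ε / 2)) *
          Real.exp (-(ε / 2 * ‖y‖))) * h4

theorem integrable_dominating (M M' : ℝ) {ε : ℝ} (hε : 0 < ε) (θ : κ → ℝ) {ι : Type*} [Fintype ι] :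
    Integrable fun y : ι → ℝ => dominating M M' ε θ y :=
  (integrable_exp_neg_mul_norm (half_pos hε)).const_mul _

theorem integrable_weight_mul {j : ℕ} {M ε M' : ℝ} {w φ : (κ → ℝ) → ℝ}
    (hw : WeightBound gr j M ε w) (hφ : LinGrowth M' φ) (θ : κ → ℝ) :
    Integrable fun y => w (ovEq gr j θ y) * φ (ovEq gr j θ y) :=
  (integrable_dominating M M' hw.eps_pos θ).mono'
    ((hw.meas.comp (measurable_ovEq j θ)).mul (hφ.meas.comp (measurable_ovEq j θ))).aestronglyMeasurable
    (Eventually.of_forall fun y => abs_weight_mul_le hw hφ θ y)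

theorem linGrowth_const (c : ℝ) : LinGrowth (κ := κ) |c| (fun _ => c) where
  meas := measurable_const
  nonneg := abs_nonneg c
  le θ := le_mul_of_one_le_right (abs_nonneg c) (by linarith [norm_nonneg θ])

theorem integrable_weight {j : ℕ} {M ε : ℝ} {w : (κ → ℝ) → ℝ}
    (hw : WeightBound gr j M ε w) (θ : κ → ℝ) : Integrable fun y => w (ovEq gr j θ y) := by
  simpa using integrable_weight_mul hw (linGrowth_const 1) θ

theorem setIntegral_weight_pos {j : ℕ} {M ε : ℝ} {w : (κ → ℝ) → ℝ} (hw : WeightBound gr j M ε w)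
    {K : Set (GroupSpace gr j)} (hvol : volume K ≠ 0) (θ : κ → ℝ) :
    0 < ∫ y in K, w (ovEq gr j θ y) := by
  have : NeZero (volume.restrict K) := ⟨fun h => hvol (Measure.restrict_eq_zero.1 h)⟩
  rw [integral_pos_iff_support_of_nonneg (fun y => (hw.pos _).le) (integrable_weight hw θ).integrableOn]
  have : Function.support (fun y => w (ovEq gr j θ y)) = Set.univ := by
    ext y; simp [(hw.pos (ovEq gr j θ y)).ne']
  rw [this, Measure.restrict_apply_univ]
  exact pos_iff_ne_zero.2 hvol

/-- Averaging preserves linear growth, uniformly over the sets `K` containing a fixed compact set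
of positive volume. -/
theorem exists_linGrowth_avg {j : ℕ} {M ε M' : ℝ} {K₀ : Set (GroupSpace gr j)}
    (hK₀ : IsCompact K₀) (hvol : volume K₀ ≠ 0) (hM' : 0 ≤ M') :
    ∃ M'', ∀ K : Set (GroupSpace gr j), K₀ ⊆ K → ∀ w φ : (κ → ℝ) → ℝ,
      WeightBound gr j M ε w → LinGrowth M' φ → LinGrowth M'' (avg j K w φ) := by
  obtain ⟨ρ, hρ⟩ := hK₀.isBounded.exists_norm_le
  set ρ' := max ρ 0
  set Λ := |Real.log ((∫ y : GroupSpace gr j, Real.exp (-(ε / 2 * ‖y‖))) / (volume K₀).toReal)|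
  refine ⟨|M' * (1 + 2 / ε * (2 * M + M * ρ' + Λ))|, fun K hsub w φ hw hφ =>
    ⟨measurable_avg j K hw.meas hφ.meas, abs_nonneg _, fun θ => ?_⟩⟩
  have hε := hw.eps_pos
  have hM := hw.nonneg
  have hvolK : volume K ≠ 0 := fun h => hvol (measure_mono_null hsub h)
  have hpos := setIntegral_weight_pos hw hvolK θ
  have hmom := setIntegral_norm_mul_le hK₀ hsub (ρ := ρ')
    (fun y hy => (hρ y hy).trans (le_max_left _ _)) hvol hε hM (A := M * (1 + ‖θ‖))
    (hw.meas.comp (measurable_ovEq j θ))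
    (fun y => (Real.exp_le_exp.2 (by
      have := mul_le_mul_of_nonneg_left (norm_override_le (fun a => gr a = j) θ y) hM
      linarith)).trans (hw.lower _)) (hw.upper θ)
  simp only [Function.comp_apply] at hmom
  have hint1 : Integrable fun y => (1 + ‖θ‖ + ‖y‖) * w (ovEq gr j θ y) := by
    have : LinGrowth (κ := κ) 1 (fun η => ‖η‖) :=
      ⟨measurable_norm, zero_le_one, fun η => by rw [abs_norm]; linarith⟩
    have e : ∀ y : GroupSpace gr j, ‖y‖ ≤ ‖ovEq gr j θ y‖ := fun y =>
      (pi_norm_le_iff_of_nonneg (norm_nonneg _)).2 fun a => by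
        have := norm_le_pi_norm (ovEq gr j θ y) a.1
        have e2 : ovEq gr j θ y a.1 = y a := ovEq_of a.2
        rwa [e2] at this
    refine (((integrable_weight hw θ).const_mul (1 + ‖θ‖)).add
      (integrable_weight_mul hw this θ)).mono' ?_ (Eventually.of_forall fun y => ?_)
    · exact (Measurable.mul (by fun_prop)
        (hw.meas.comp (measurable_ovEq j θ))).aestronglyMeasurable
    · rw [Real.norm_of_nonneg (mul_nonneg (by positivity) (hw.pos _).le)]
      have := mul_le_mul_of_nonneg_right (e y) (hw.pos (ovEq gr j θ y)).le
      simp only [Pi.add_apply]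
      linarith
  have hint2 : Integrable fun y => ‖y‖ * w (ovEq gr j θ y) := by
    refine (hint1.sub ((integrable_weight hw θ).const_mul (1 + ‖θ‖))).congr
      (Eventually.of_forall fun y => ?_)
    simp only [Pi.sub_apply]; ring
  have h1 : |∫ y in K, w (ovEq gr j θ y) * φ (ovEq gr j θ y)| ≤
      M' * ((1 + ‖θ‖) * ∫ y in K, w (ovEq gr j θ y)) + M' * ∫ y in K, ‖y‖ * w (ovEq gr j θ y) := by
    calc _ ≤ ∫ y in K, |w (ovEq gr j θ y) * φ (ovEq gr j θ y)| := abs_integral_le_integral_abs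
      _ ≤ ∫ y in K, M' * ((1 + ‖θ‖ + ‖y‖) * w (ovEq gr j θ y)) := by
          refine integral_mono (integrable_weight_mul hw hφ θ).abs.integrableOn
            (hint1.const_mul M').integrableOn fun y => ?_
          simp only
          rw [abs_mul, abs_of_pos (hw.pos _), mul_comm, ← mul_assoc]
          refine mul_le_mul_of_nonneg_right ((hφ.le _).trans ?_) (hw.pos _).le
          have := mul_le_mul_of_nonneg_left (norm_override_le (fun a => gr a = j) θ y) hM'
          linarith
      _ = _ := by
          have e : ∀ y, (1 + ‖θ‖ + ‖y‖) * w (ovEq gr j θ y) =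
              (1 + ‖θ‖) * w (ovEq gr j θ y) + ‖y‖ * w (ovEq gr j θ y) := fun y => by ring
          simp_rw [e]
          rw [integral_const_mul, integral_add ((integrable_weight hw θ).const_mul _).integrableOn
            hint2.integrableOn, integral_const_mul, mul_add]
  rw [avg, abs_div, abs_of_pos hpos, div_le_iff₀ hpos]
  refine h1.trans ?_
  have hΛ := le_abs_self (Real.log ((∫ y : GroupSpace gr j, Real.exp (-(ε / 2 * ‖y‖))) /
    (volume K₀).toReal))
  have h2 : 2 / ε * (2 * (M * (1 + ‖θ‖)) + M * ρ' + Real.log ((∫ y : GroupSpace gr j,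
      Real.exp (-(ε / 2 * ‖y‖))) / (volume K₀).toReal)) ≤
      2 / ε * (2 * M + M * ρ' + Λ) * (1 + ‖θ‖) := by
    rw [mul_assoc]
    refine mul_le_mul_of_nonneg_left ?_ (by positivity)
    have hρ0 : 0 ≤ M * ρ' := mul_nonneg hM (le_max_right _ _)
    have hΛ0 : 0 ≤ Λ := abs_nonneg _
    have hn := norm_nonneg θ
    nlinarith [mul_nonneg hρ0 hn, mul_nonneg hΛ0 hn]
  have h3 : ∫ y in K, ‖y‖ * w (ovEq gr j θ y) ≤ 2 / ε * (2 * M + M * ρ' + Λ) * (1 + ‖θ‖) *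
      ∫ y in K, w (ovEq gr j θ y) :=
    hmom.trans (mul_le_mul_of_nonneg_right h2 hpos.le)
  calc _ ≤ M' * ((1 + ‖θ‖) * ∫ y in K, w (ovEq gr j θ y)) + M' *
        (2 / ε * (2 * M + M * ρ' + Λ) * (1 + ‖θ‖) * ∫ y in K, w (ovEq gr j θ y)) := by gcongr
    _ = M' * (1 + 2 / ε * (2 * M + M * ρ' + Λ)) * (1 + ‖θ‖) * ∫ y in K, w (ovEq gr j θ y) := by
        ring
    _ ≤ _ := by gcongr; exact le_abs_self _

theorem avg_le {j : ℕ} {M ε M' B : ℝ} {w φ : (κ → ℝ) → ℝ} (hw : WeightBound gr j M ε w)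
    (hφ : LinGrowth M' φ) {K : Set (GroupSpace gr j)} (hvol : volume K ≠ 0)
    (hB : ∀ θ, φ θ ≤ B) (θ : κ → ℝ) : avg j K w φ θ ≤ B := by
  rw [avg, div_le_iff₀ (setIntegral_weight_pos hw hvol θ), ← integral_const_mul]
  refine integral_mono (integrable_weight_mul hw hφ θ).integrableOn
    ((integrable_weight hw θ).const_mul B).integrableOn fun y => ?_
  simp only
  rw [mul_comm]
  exact mul_le_mul_of_nonneg_right (hB _) (hw.pos _).le

theorem avg_add {j : ℕ} {M ε M₁ M₂ : ℝ} {w h φ : (κ → ℝ) → ℝ} (hw : WeightBound gr j M ε w)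
    (hh : LinGrowth M₁ h) (hφ : LinGrowth M₂ φ) {K : Set (GroupSpace gr j)} (hvol : volume K ≠ 0)
    (hdep : ∀ θ y, h (ovEq gr j θ y) = h θ) (θ : κ → ℝ) :
    avg j K w (fun η => h η + φ η) θ = h θ + avg j K w φ θ := by
  have hpos := (setIntegral_weight_pos hw hvol θ).ne'
  rw [avg, avg, div_eq_iff hpos, add_mul, div_mul_cancel₀ _ hpos]
  simp_rw [mul_add]
  rw [integral_add (integrable_weight_mul hw hh θ).integrableOn
    (integrable_weight_mul hw hφ θ).integrableOn]
  congr 1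
  simp_rw [hdep, mul_comm _ (h θ)]
  rw [integral_const_mul]

end Average

/-! ### Reference priors as iterated averages -/

section Iterate

variable {κ : Type*} [Fintype κ] [DecidableEq κ] {gr : κ → ℕ}

/-- Averaging successively over the groups `0, …, j - 1`. -/
def iterAvg (K : (j : ℕ) → Set (GroupSpace gr j)) (w : ℕ → (κ → ℝ) → ℝ) :
    ℕ → ((κ → ℝ) → ℝ) → (κ → ℝ) → ℝ
  | 0, φ => φ
  | j + 1, φ => avg j (K j) (w j) (iterAvg K w j φ)

/-- Iterated averages over compact sets containing fixed ones preserve linear growth, with a constant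
that does not depend on the compact sets. -/
theorem exists_linGrowth_iterAvg {K₀ : (j : ℕ) → Set (GroupSpace gr j)} {M ε : ℕ → ℝ} (j : ℕ)
    (hK₀ : ∀ i < j, IsCompact (K₀ i)) (hvol : ∀ i < j, volume (K₀ i) ≠ 0) {M' : ℝ} :
    ∃ M'', ∀ (K : (j : ℕ) → Set (GroupSpace gr j)), (∀ i < j, K₀ i ⊆ K i) →
      ∀ w : ℕ → (κ → ℝ) → ℝ, (∀ i < j, WeightBound gr i (M i) (ε i) (w i)) →
      ∀ φ, LinGrowth M' φ → LinGrowth M'' (iterAvg K w j φ) := by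
  induction j with
  | zero => exact ⟨M', fun _ _ _ _ _ h => h⟩
  | succ j ih =>
    obtain ⟨M₁, h₁⟩ := ih (fun i hi => hK₀ i (by omega)) (fun i hi => hvol i (by omega))
    by_cases hM₁ : 0 ≤ M₁
    · obtain ⟨M₂, h₂⟩ := exists_linGrowth_avg (gr := gr) (M := M j) (ε := ε j)
        (hK₀ j (by omega)) (hvol j (by omega)) hM₁
      exact ⟨M₂, fun K hK w hw φ hφ => h₂ _ (hK j (by omega)) _ _ (hw j (by omega))
        (h₁ K (fun i hi => hK i (by omega)) w (fun i hi => hw i (by omega)) φ hφ)⟩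
    · exact ⟨0, fun K hK w hw φ hφ => absurd
        (h₁ K (fun i hi => hK i (by omega)) w (fun i hi => hw i (by omega)) φ hφ).nonneg hM₁⟩

section Fixed

variable {K : (j : ℕ) → Set (GroupSpace gr j)} {w : ℕ → (κ → ℝ) → ℝ} {M ε : ℕ → ℝ} {j : ℕ}

theorem linGrowth_iterAvg (hK : ∀ i < j, IsCompact (K i)) (hvol : ∀ i < j, volume (K i) ≠ 0)
    (hw : ∀ i < j, WeightBound gr i (M i) (ε i) (w i)) {M' : ℝ} {φ : (κ → ℝ) → ℝ}
    (hφ : LinGrowth M' φ) : ∃ M'', LinGrowth M'' (iterAvg K w j φ) := by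
  obtain ⟨M'', h⟩ := exists_linGrowth_iterAvg (gr := gr) (M := M) (ε := ε) j hK hvol (M' := M')
  exact ⟨M'', h K (fun _ _ => subset_rfl) w hw φ hφ⟩

theorem iterAvg_le (hK : ∀ i < j, IsCompact (K i)) (hvol : ∀ i < j, volume (K i) ≠ 0)
    (hw : ∀ i < j, WeightBound gr i (M i) (ε i) (w i)) {M' B : ℝ} {φ : (κ → ℝ) → ℝ}
    (hφ : LinGrowth M' φ) (hB : ∀ θ, φ θ ≤ B) (θ : κ → ℝ) : iterAvg K w j φ θ ≤ B := by
  induction j generalizing θ with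
  | zero => exact hB θ
  | succ j ih =>
    obtain ⟨M'', h⟩ := linGrowth_iterAvg (fun i hi => hK i (Nat.lt_succ_of_lt hi))
      (fun i hi => hvol i (Nat.lt_succ_of_lt hi)) (fun i hi => hw i (Nat.lt_succ_of_lt hi)) hφ
    exact avg_le (hw j (Nat.lt_succ_self j)) h (hvol j (Nat.lt_succ_self j))
      (ih (fun i hi => hK i (Nat.lt_succ_of_lt hi))
      (fun i hi => hvol i (Nat.lt_succ_of_lt hi)) (fun i hi => hw i (Nat.lt_succ_of_lt hi))) θ

theorem iterAvg_add (hK : ∀ i < j, IsCompact (K i)) (hvol : ∀ i < j, volume (K i) ≠ 0)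
    (hw : ∀ i < j, WeightBound gr i (M i) (ε i) (w i)) {M₁ M₂ : ℝ} {h φ : (κ → ℝ) → ℝ}
    (hh : LinGrowth M₁ h) (hφ : LinGrowth M₂ φ)
    (hdep : ∀ i < j, ∀ θ y, h (ovEq gr i θ y) = h θ) :
    iterAvg K w j (fun η => h η + φ η) = fun η => h η + iterAvg K w j φ η := by
  induction j with
  | zero => rfl
  | succ j ih =>
    obtain ⟨M'', h'⟩ := linGrowth_iterAvg (fun i hi => hK i (Nat.lt_succ_of_lt hi))
      (fun i hi => hvol i (Nat.lt_succ_of_lt hi)) (fun i hi => hw i (Nat.lt_succ_of_lt hi)) hφ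
    funext θ
    rw [iterAvg, ih (fun i hi => hK i (Nat.lt_succ_of_lt hi))
      (fun i hi => hvol i (Nat.lt_succ_of_lt hi)) (fun i hi => hw i (Nat.lt_succ_of_lt hi))
      (fun i hi => hdep i (Nat.lt_succ_of_lt hi))]
    exact avg_add (hw j (Nat.lt_succ_self j)) hh h' (hvol j (Nat.lt_succ_self j))
      (hdep j (Nat.lt_succ_self j)) θ

end Fixed

/-- The factor `exp (½ E[log det h_j])` in the definition of `seqPrior`. -/
def stepWeight (info : (κ → ℝ) → Matrix κ κ ℝ) (gr : κ → ℕ)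
    (K : (j : ℕ) → Set (GroupSpace gr j)) (j : ℕ) (θ : κ → ℝ) : ℝ :=
  Real.exp (1 / 2 * ∫ x : {a : κ // gr a < j} → ℝ,
    Real.log (infoBlock (info (ovLt gr j θ x)) gr j).det *
      seqPrior info gr K j (ovLt gr j θ x))

variable {info : (κ → ℝ) → Matrix κ κ ℝ} {K : (j : ℕ) → Set (GroupSpace gr j)}

theorem seqPrior_succ (j : ℕ) (θ : κ → ℝ) : seqPrior info gr K (j + 1) θ =
    seqPrior info gr K j θ * ((K j).indicator (fun _ => stepWeight info gr K j θ)
      (fun a => θ a.1) / ∫ y in K j, stepWeight info gr K j (ovEq gr j θ y)) := rfl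

theorem stepWeight_pos (j : ℕ) (θ : κ → ℝ) : 0 < stepWeight info gr K j θ := Real.exp_pos _

theorem seqPrior_nonneg (j : ℕ) (θ : κ → ℝ) : 0 ≤ seqPrior info gr K j θ := by
  induction j with
  | zero => exact zero_le_one
  | succ j ih =>
    rw [seqPrior_succ]
    exact mul_nonneg ih (div_nonneg
      (Set.indicator_nonneg (fun _ _ => (stepWeight_pos j θ).le) _)
      (integral_nonneg fun _ => (stepWeight_pos j _).le))

theorem measurable_seqPrior {j : ℕ} (hK : ∀ i < j, MeasurableSet (K i))
    (hw : ∀ i < j, Measurable (stepWeight info gr K i)) : Measurable (seqPrior info gr K j) := by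
  induction j with
  | zero => exact measurable_const
  | succ j ih =>
    have e : seqPrior info gr K (j + 1) = fun θ => seqPrior info gr K j θ *
        ({η : κ → ℝ | (fun a : {a : κ // gr a = j} => η a.1) ∈ K j}.indicator
          (stepWeight info gr K j) θ /
          ∫ y in K j, stepWeight info gr K j (ovEq gr j θ y)) := by
      funext θ; rw [seqPrior_succ]; rfl
    rw [e]
    refine (ih (fun i hi => hK i (by omega)) fun i hi => hw i (by omega)).mul
      (Measurable.div ?_ (measurable_integral_ovEq j _ (hw j (by omega))))
    refine (hw j (by omega)).indicator ?_
    exact (hK j (by omega)).preimage (by fun_prop :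
      Measurable fun η : κ → ℝ => fun a : {a : κ // gr a = j} => η a.1)

theorem ovLt_ovLt (j : ℕ) (θ : κ → ℝ) (x x' : {a : κ // gr a < j} → ℝ) :
    ovLt gr j (ovLt gr j θ x) x' = ovLt gr j θ x' := by
  funext a; by_cases h : gr a < j <;> simp [override, h]

theorem ovEq_ovLt (j : ℕ) (θ : κ → ℝ) (x : {a : κ // gr a < j} → ℝ) (y : GroupSpace gr j) :
    ovEq gr j (ovLt gr j θ x) y = ovLt gr j (ovEq gr j θ y) x := by
  funext a
  by_cases h : gr a < j
  · have h' : gr a ≠ j := h.ne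
    simp [override, h, h']
  · by_cases h' : gr a = j <;> simp [override, h']

theorem stepWeight_ovLt (j : ℕ) (θ : κ → ℝ) (x : {a : κ // gr a < j} → ℝ) :
    stepWeight info gr K j (ovLt gr j θ x) = stepWeight info gr K j θ := by
  simp only [stepWeight, ovLt_ovLt]

/-- The index equivalence behind Fubini's theorem for the groups `≤ j`. -/
def groupSumEquiv (gr : κ → ℕ) (j : ℕ) :
    {a : κ // gr a = j} ⊕ {a : κ // gr a < j} ≃ {a : κ // gr a < j + 1} where
  toFun := Sum.elim (fun a => ⟨a.1, by have := a.2; omega⟩) (fun a => ⟨a.1, by have := a.2; omega⟩)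
  invFun a := if h : gr a.1 = j then Sum.inl ⟨a.1, h⟩
    else Sum.inr ⟨a.1, by have := a.2; omega⟩
  left_inv := by
    rintro (a | a)
    · simp [a.2]
    · simp [a.2.ne]
  right_inv a := by by_cases h : gr a.1 = j <;> simp [h]

/-- Joining the coordinates of group `j` with those of the less important groups. -/
def joinGroups (gr : κ → ℕ) (j : ℕ) :
    GroupSpace gr j × ({a : κ // gr a < j} → ℝ) ≃ᵐ ({a : κ // gr a < j + 1} → ℝ) :=
  (MeasurableEquiv.sumPiEquivProdPi fun _ => ℝ).symm.trans
    (MeasurableEquiv.piCongrLeft (fun _ => ℝ) (groupSumEquiv gr j))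

theorem measurePreserving_joinGroups (j : ℕ) :
    MeasurePreserving (joinGroups gr j) (volume.prod volume) volume :=
  (volume_measurePreserving_piCongrLeft (fun _ => ℝ) (groupSumEquiv gr j)).comp
    (volume_measurePreserving_sumPiEquivProdPi_symm fun _ => ℝ)

theorem ovLt_joinGroups (j : ℕ) (θ : κ → ℝ) (p : GroupSpace gr j × ({a : κ // gr a < j} → ℝ)) :
    ovLt gr (j + 1) θ (joinGroups gr j p) = ovLt gr j (ovEq gr j θ p.1) p.2 := by
  have key : ∀ s, joinGroups gr j p (groupSumEquiv gr j s) = Sum.elim p.1 p.2 s := by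
    intro s
    have := Equiv.piCongrLeft_apply_apply (P := fun _ : {a : κ // gr a < j + 1} => ℝ)
      (groupSumEquiv gr j) ((MeasurableEquiv.sumPiEquivProdPi fun _ => ℝ).symm p) s
    refine Eq.trans this ?_
    rcases s with a | a <;> rfl
  funext a
  rcases lt_trichotomy (gr a) j with h | h | h
  · have h1 : gr a < j + 1 := by omega
    rw [ovLt_of h1, ovLt_of h]
    exact key (Sum.inr ⟨a, h⟩)
  · have h1 : gr a < j + 1 := by omega
    have h2 : ¬ gr a < j := by omega
    rw [ovLt_of h1, ovLt_of_not h2,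
      ovEq_of h]
    exact key (Sum.inl ⟨a, h⟩)
  · have h1 : ¬ gr a < j + 1 := by omega
    have h2 : ¬ gr a < j := by omega
    have h3 : ¬ gr a = j := by omega
    rw [ovLt_of_not h1,
      ovLt_of_not h2, ovEq_of_ne h3]

theorem LinGrowth.abs {M : ℝ} {φ : (κ → ℝ) → ℝ} (h : LinGrowth M φ) : LinGrowth M fun θ => |φ θ| :=
  ⟨h.meas.abs, h.nonneg, fun θ => by rw [abs_abs]; exact h.le θ⟩

/-- Fubini: the expectation with respect to the conditional density of the groups `< j` is the
iterated average. -/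
theorem integral_mul_seqPrior {M ε : ℕ → ℝ} {j : ℕ} (hK : ∀ i < j, IsCompact (K i))
    (hvol : ∀ i < j, volume (K i) ≠ 0)
    (hw : ∀ i < j, WeightBound gr i (M i) (ε i) (stepWeight info gr K i)) {M' : ℝ}
    {φ : (κ → ℝ) → ℝ} (hφ : LinGrowth M' φ) (θ : κ → ℝ) :
    Integrable (fun x => φ (ovLt gr j θ x) * seqPrior info gr K j (ovLt gr j θ x)) ∧
      ∫ x, φ (ovLt gr j θ x) * seqPrior info gr K j (ovLt gr j θ x) =
        iterAvg K (stepWeight info gr K) j φ θ := by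
  induction j generalizing θ M' φ with
  | zero =>
    have : IsEmpty {a : κ // gr a < 0} := ⟨fun a => absurd a.2 (Nat.not_lt_zero _)⟩
    have e : ∀ x, ovLt gr 0 θ x = θ := fun x => by funext a; simp [override]
    have hv : (volume : Measure ({a : κ // gr a < 0} → ℝ)) = Measure.dirac isEmptyElim :=
      Measure.volume_pi_eq_dirac _
    simp only [e]
    rw [hv]
    exact ⟨integrable_const _, by simp [seqPrior, iterAvg]⟩
  | succ j ih =>
    have hK' : ∀ i < j, IsCompact (K i) := fun i hi => hK i (by omega)
    have hvol' : ∀ i < j, volume (K i) ≠ 0 := fun i hi => hvol i (by omega)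
    have hw' : ∀ i < j, WeightBound gr i (M i) (ε i) (stepWeight info gr K i) :=
      fun i hi => hw i (by omega)
    have hwj := hw j (by omega)
    set D := ∫ y in K j, stepWeight info gr K j (ovEq gr j θ y) with hD
    have hDpos : 0 < D := setIntegral_weight_pos hwj (hvol j (by omega)) θ
    set G : GroupSpace gr j → ℝ := fun y =>
      (K j).indicator (fun y => stepWeight info gr K j (ovEq gr j θ y)) y / D with hG
    have hGnn : ∀ y, 0 ≤ G y := fun y =>
      div_nonneg (Set.indicator_nonneg (fun _ _ => (hwj.pos _).le) _) hDpos.le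
    -- the density of group `j` does not involve the less important groups
    have hform : ∀ (φ : (κ → ℝ) → ℝ) (p : GroupSpace gr j × ({a : κ // gr a < j} → ℝ)),
        φ (ovLt gr (j + 1) θ (joinGroups gr j p)) *
          seqPrior info gr K (j + 1) (ovLt gr (j + 1) θ (joinGroups gr j p)) =
        G p.1 * (φ (ovLt gr j (ovEq gr j θ p.1) p.2) *
          seqPrior info gr K j (ovLt gr j (ovEq gr j θ p.1) p.2)) := by
      intro φ p
      rw [ovLt_joinGroups, seqPrior_succ, stepWeight_ovLt]
      have h1 : (fun a : {a : κ // gr a = j} => ovLt gr j (ovEq gr j θ p.1) p.2 a.1) = p.1 := by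
        funext a
        have h2 : ¬ gr a.1 < j := by have := a.2; omega
        rw [ovLt_of_not h2, ovEq_of a.2]
      have h3 : ∀ y, stepWeight info gr K j (ovEq gr j (ovLt gr j (ovEq gr j θ p.1) p.2) y) =
          stepWeight info gr K j (ovEq gr j θ y) := by
        intro y; rw [ovEq_ovLt, stepWeight_ovLt, ovEq_ovEq]
      rw [h1]
      simp_rw [h3]
      rw [← hD, hG]
      simp only
      by_cases hp : p.1 ∈ K j
      · simp only [Set.indicator_of_mem hp]; ring
      · simp only [Set.indicator_of_notMem hp]; ring
    have hmeasF : ∀ {φ : (κ → ℝ) → ℝ}, Measurable φ → Measurable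
        fun x => φ (ovLt gr (j + 1) θ x) * seqPrior info gr K (j + 1) (ovLt gr (j + 1) θ x) := by
      intro φ hφ
      have h1 : Measurable (ovLt gr (j + 1) θ) :=
        ((continuous_override fun a => gr a < j + 1).comp
          (by fun_prop : Continuous fun y => (θ, y))).measurable
      exact (hφ.comp h1).mul ((measurable_seqPrior (fun i hi => (hK i hi).measurableSet)
        fun i hi => (hw i hi).meas).comp h1)
    have hGint : ∀ {φ : (κ → ℝ) → ℝ} {M' : ℝ}, LinGrowth M' φ →
        Integrable fun y => G y * iterAvg K (stepWeight info gr K) j φ (ovEq gr j θ y) := by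
      intro φ M' hφ
      obtain ⟨M'', h⟩ := linGrowth_iterAvg hK' hvol' hw' hφ
      have h1 := ((integrable_weight_mul hwj h θ).indicator
        (hK j (by omega)).measurableSet).div_const D
      refine h1.congr (Eventually.of_forall fun y => ?_)
      simp only [hG]
      by_cases hp : y ∈ K j
      · simp only [Set.indicator_of_mem hp]; ring
      · simp only [Set.indicator_of_notMem hp]; ring
    have hint : Integrable (fun p : GroupSpace gr j × ({a : κ // gr a < j} → ℝ) =>
        G p.1 * (φ (ovLt gr j (ovEq gr j θ p.1) p.2) *
          seqPrior info gr K j (ovLt gr j (ovEq gr j θ p.1) p.2))) (volume.prod volume) := by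
      have hm : AEStronglyMeasurable (fun p : GroupSpace gr j × ({a : κ // gr a < j} → ℝ) =>
          G p.1 * (φ (ovLt gr j (ovEq gr j θ p.1) p.2) *
            seqPrior info gr K j (ovLt gr j (ovEq gr j θ p.1) p.2))) (volume.prod volume) := by
        have h1 := ((hmeasF hφ.meas).comp (joinGroups gr j).measurable).aestronglyMeasurable
          (μ := volume.prod volume)
        refine h1.congr (Eventually.of_forall fun p => ?_)
        exact hform φ p
      refine (integrable_prod_iff hm).2 ⟨Eventually.of_forall fun y => ?_, ?_⟩
      · exact (ih hK' hvol' hw' hφ (ovEq gr j θ y)).1.const_mul (G y)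
      · refine (hGint hφ.abs).congr (Eventually.of_forall fun y => ?_)
        simp only [Real.norm_eq_abs, abs_mul, abs_of_nonneg (hGnn _),
          abs_of_nonneg (seqPrior_nonneg _ _)]
        rw [integral_const_mul, (ih hK' hvol' hw' hφ.abs (ovEq gr j θ y)).2]
    have hmp := measurePreserving_joinGroups (gr := gr) j
    have hemb := (joinGroups gr j).measurableEmbedding
    constructor
    · rw [← hmp.integrable_comp_emb hemb]
      refine hint.congr (Eventually.of_forall fun p => ?_)
      simp only [Function.comp_apply]
      rw [hform]
    · rw [← hmp.integral_comp hemb]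
      simp_rw [hform]
      rw [integral_prod _ hint]
      simp only [integral_const_mul]
      simp_rw [(ih hK' hvol' hw' hφ _).2]
      rw [iterAvg, avg, ← integral_indicator (hK j (by omega)).measurableSet, ← hD,
        ← integral_div]
      refine integral_congr_ae (Eventually.of_forall fun y => ?_)
      simp only [hG]
      by_cases hp : y ∈ K j
      · simp only [Set.indicator_of_mem hp]; ring
      · simp only [Set.indicator_of_notMem hp]; ring

end Iterate

/-! ### The limit along an exhaustion -/

section Limit

variable {κ : Type*} [Fintype κ] [DecidableEq κ] {gr : κ → ℕ}

/-- The situation in which the reference prior can be computed: in the coordinates `T θ`, where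
`T` shifts each coordinate by a function of the more important groups, the density `F j` of group
`j` involves this group only, and `log det h_j` differs from `2 log F_j` by a function `β j` of the
other groups. -/
structure ShearModel (gr : κ → ℕ) (m : ℕ) (ℓ : ℕ → (κ → ℝ) → ℝ) (T : (κ → ℝ) → κ → ℝ)
    (F β : ℕ → (κ → ℝ) → ℝ) : Prop where
  eq : ∀ j < m, ∀ θ, ℓ j θ = 2 * Real.log (F j (T θ)) + β j (T θ)
  continuous_T : Continuous T
  shear : ∀ a θ θ', (∀ b, gr a < gr b → θ b = θ' b) → T θ a - θ a = T θ' a - θ' a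
  growth : ∃ M, 0 ≤ M ∧ ∀ θ, ‖T θ‖ ≤ M * (1 + ‖θ‖)
  continuous_F : ∀ j < m, Continuous (F j)
  dependsOn_F : ∀ j < m, DependsOn (F j) {a | gr a = j}
  F_lower : ∃ M, 0 ≤ M ∧ ∀ j < m, ∀ x, Real.exp (-(M * (1 + ‖x‖))) ≤ F j x
  F_upper : ∃ M ε, 0 < ε ∧ ∀ j < m, ∀ x,
    F j x ≤ Real.exp (M - ε * ‖fun a : {a : κ // gr a = j} => x a.1‖)
  continuous_β : ∀ j < m, Continuous (β j)
  dependsOn_β : ∀ j < m, DependsOn (β j) {a | gr a ≠ j}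
  β_le : ∃ M, ∀ j < m, ∀ x, β j x ≤ M
  le_β : ∃ M, ∀ j < m, ∀ x, -(M * (1 + ‖x‖)) ≤ β j x

variable {m : ℕ} {ℓ : ℕ → (κ → ℝ) → ℝ} {T : (κ → ℝ) → κ → ℝ} {F β : ℕ → (κ → ℝ) → ℝ}

theorem ShearModel.apply_ovEq (S : ShearModel gr m ℓ T F β) {j : ℕ} {f : (κ → ℝ) → ℝ}
    (hf : DependsOn f {a | j ≤ gr a}) (θ : κ → ℝ) (y : GroupSpace gr j) :
    f (T (ovEq gr j θ y)) =
      f (ovEq gr j (T θ) (y + fun a : {a : κ // gr a = j} => T θ a.1 - θ a.1)) := by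
  refine hf fun a ha => ?_
  have ha' : j ≤ gr a := ha
  have h := S.shear a (ovEq gr j θ y) θ fun b hb => ovEq_of_ne (by omega)
  by_cases hj : gr a = j
  · rw [ovEq_of hj] at h ⊢
    simp only [Pi.add_apply]
    linarith
  · rw [ovEq_of_ne hj] at h ⊢
    linarith

theorem ShearModel.F_pos (S : ShearModel gr m ℓ T F β) {j : ℕ} (hj : j < m) (x : κ → ℝ) :
    0 < F j x := by
  obtain ⟨M, -, h⟩ := S.F_lower
  exact (Real.exp_pos _).trans_le (h j hj x)

theorem ShearModel.dependsOn_F_le (S : ShearModel gr m ℓ T F β) {j : ℕ} (hj : j < m) :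
    DependsOn (F j) {a | j ≤ gr a} :=
  (S.dependsOn_F j hj).mono fun a (ha : gr a = j) => show j ≤ gr a by omega

/-- The limiting weights have exponential tails. -/
theorem ShearModel.weightBound_F (S : ShearModel gr m ℓ T F β) {j : ℕ} (hj : j < m) :
    ∃ M ε, WeightBound gr j M ε (F j) := by
  obtain ⟨M₁, hM₁, h₁⟩ := S.F_lower
  obtain ⟨M₂, ε, hε, h₂⟩ := S.F_upper
  refine ⟨M₁ + |M₂|, ε, ⟨(S.continuous_F j hj).measurable, by positivity, hε, fun θ => ?_,
    fun θ y => ?_⟩⟩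
  · refine le_trans (Real.exp_le_exp.2 ?_) (h₁ j hj θ)
    have : 0 ≤ |M₂| * (1 + ‖θ‖) := by positivity
    linarith
  · refine (h₂ j hj _).trans (Real.exp_le_exp.2 ?_)
    have e : (fun a : {a : κ // gr a = j} => ovEq gr j θ y a.1) = y := by
      funext a; exact ovEq_of a.2
    rw [e]
    have h3 : 0 ≤ |M₂| * ‖θ‖ := by positivity
    have h4 : 0 ≤ M₁ * (1 + ‖θ‖) := by positivity
    have := le_abs_self M₂
    linarith

theorem dependsOn_avg {j : ℕ} {K : Set (GroupSpace gr j)} {w φ : (κ → ℝ) → ℝ} {s t : Set κ}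
    (hw : DependsOn w t) (hφ : DependsOn φ s) :
    DependsOn (avg j K w φ) ((s ∪ t) \ {a | gr a = j}) := by
  intro x x' h
  have key : ∀ (u : Set κ), u ⊆ s ∪ t → ∀ y, ∀ a ∈ u, ovEq gr j x y a = ovEq gr j x' y a := by
    intro u hu y a ha
    by_cases hj : gr a = j
    · rw [ovEq_of hj, ovEq_of hj]
    · rw [ovEq_of_ne hj, ovEq_of_ne hj, h a ⟨hu ha, hj⟩]
  have h1 : ∀ y, w (ovEq gr j x y) = w (ovEq gr j x' y) :=
    fun y => hw (key t Set.subset_union_right y)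
  have h2 : ∀ y, φ (ovEq gr j x y) = φ (ovEq gr j x' y) :=
    fun y => hφ (key s Set.subset_union_left y)
  simp only [avg, h1, h2]

/-- The iterated averages with respect to the limiting weights, over the whole spaces. -/
def limAvg (gr : κ → ℕ) (F : ℕ → (κ → ℝ) → ℝ) (j : ℕ) (φ : (κ → ℝ) → ℝ) : (κ → ℝ) → ℝ :=
  iterAvg (gr := gr) (fun _ => Set.univ) F j φ

theorem ShearModel.dependsOn_limAvg (S : ShearModel gr m ℓ T F β) {j i : ℕ} (hi : i < m)
    (hj : j ≤ i) : DependsOn (limAvg gr F j (β i)) {a | j ≤ gr a ∧ gr a ≠ i} := by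
  induction j with
  | zero => exact (S.dependsOn_β i hi).mono fun a ha => ⟨Nat.zero_le _, ha⟩
  | succ j ih =>
    refine (dependsOn_avg (S.dependsOn_F j (by omega)) (ih (by omega))).mono ?_
    rintro a ⟨ha, ha'⟩
    simp only [Set.mem_union, Set.mem_ofPred_eq] at ha ha' ⊢
    omega

variable {K : ℕ → (j : ℕ) → Set (GroupSpace gr j)}

theorem IsExhaustion.eventually_mem (hK : IsExhaustion gr K) (j : ℕ) (y : GroupSpace gr j) :
    ∀ᶠ n in atTop, y ∈ K n j := by
  have : y ∈ ⋃ n, K n j := by rw [hK.union]; exact Set.mem_univ _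
  obtain ⟨n, hn⟩ := Set.mem_iUnion.1 this
  exact eventually_atTop.2 ⟨n, fun n' h => hK.mono j h hn⟩

theorem IsExhaustion.exists_volume_ne_zero (hK : IsExhaustion gr K) (m : ℕ) :
    ∃ n₀, ∀ n ≥ n₀, ∀ j < m, volume (K n j) ≠ 0 := by
  have h1 : ∀ j, ∃ n, volume (K n j) ≠ 0 := by
    intro j
    by_contra hcon
    push Not at hcon
    have := measure_iUnion_null hcon
    rw [hK.union, Measure.measure_univ_eq_zero] at this
    exact NeZero.ne (volume : Measure (GroupSpace gr j)) this
  choose N hN using h1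
  refine ⟨(Finset.range m).sup N, fun n hn j hj h0 => hN j ?_⟩
  exact measure_mono_null (hK.mono j ((Finset.le_sup (Finset.mem_range.2 hj)).trans hn)) h0

/-- Dominated convergence for the numerators and denominators of the averages. -/
theorem ShearModel.tendsto_setIntegral (S : ShearModel gr m ℓ T F β) (hK : IsExhaustion gr K)
    {j : ℕ} (hj : j < m) {M ε M' : ℝ} {w φ : ℕ → (κ → ℝ) → ℝ} {h ψ : (κ → ℝ) → ℝ}
    (hw : ∀ᶠ n in atTop, WeightBound gr j M ε (w n))
    (hwlim : ∀ θ, Tendsto (fun n => w n θ) atTop (𝓝 (F j (T θ) * Real.exp (h (T θ)))))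
    (hh : DependsOn h {a | j < gr a})
    (hφ : ∀ᶠ n in atTop, LinGrowth M' (φ n))
    (hφlim : ∀ θ, Tendsto (fun n => φ n θ) atTop (𝓝 (ψ (T θ))))
    (hψ : DependsOn ψ {a | j ≤ gr a}) (θ : κ → ℝ) :
    Tendsto (fun n => ∫ y in K n j, w n (ovEq gr j θ y) * φ n (ovEq gr j θ y)) atTop
      (𝓝 (Real.exp (h (T θ)) * ∫ y, F j (ovEq gr j (T θ) y) * ψ (ovEq gr j (T θ) y))) := by
  have hε : 0 < ε := by obtain ⟨n, hn⟩ := hw.exists; exact hn.eps_pos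
  have hlim : Real.exp (h (T θ)) * ∫ y, F j (ovEq gr j (T θ) y) * ψ (ovEq gr j (T θ) y) =
      ∫ y, F j (T (ovEq gr j θ y)) * Real.exp (h (T (ovEq gr j θ y))) * ψ (T (ovEq gr j θ y)) := by
    have h1 : ∀ y, h (T (ovEq gr j θ y)) = h (T θ) := by
      intro y
      rw [S.apply_ovEq (hh.mono fun a (ha : j < gr a) => show j ≤ gr a from ha.le)]
      exact hh fun a (ha : j < gr a) => ovEq_of_ne ha.ne'
    simp_rw [h1, S.apply_ovEq (S.dependsOn_F_le hj), S.apply_ovEq hψ]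
    rw [integral_add_right_eq_self (fun y => F j (ovEq gr j (T θ) y) * Real.exp (h (T θ)) *
      ψ (ovEq gr j (T θ) y)), ← integral_const_mul]
    refine integral_congr_ae (Eventually.of_forall fun y => ?_)
    simp only; ring
  rw [hlim]
  simp_rw [← integral_indicator (hK.compact _ j).measurableSet]
  refine tendsto_integral_filter_of_dominated_convergence (fun y => dominating M M' ε θ y) ?_ ?_
    (integrable_dominating M M' hε θ) ?_
  · filter_upwards [hw, hφ] with n h1 h2
    exact (integrable_weight_mul h1 h2 θ).aestronglyMeasurable.indicator
      (hK.compact n j).measurableSet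
  · filter_upwards [hw, hφ] with n h1 h2
    refine Eventually.of_forall fun y => ?_
    have h3 := abs_weight_mul_le h1 h2 θ y
    by_cases hy : y ∈ K n j
    · rw [Set.indicator_of_mem hy]; exact h3
    · rw [Set.indicator_of_notMem hy, norm_zero]; exact (abs_nonneg _).trans h3
  · refine Eventually.of_forall fun y => ?_
    refine ((hwlim _).mul (hφlim _)).congr' ?_
    filter_upwards [hK.eventually_mem j y] with n hn
    rw [Set.indicator_of_mem hn]

theorem ShearModel.integral_F_pos (S : ShearModel gr m ℓ T F β) {j : ℕ} (hj : j < m)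
    (x : κ → ℝ) : 0 < ∫ y, F j (ovEq gr j x y) := by
  obtain ⟨M, ε, h⟩ := S.weightBound_F hj
  have := setIntegral_weight_pos (K := Set.univ) h
    ((Measure.measure_univ_eq_zero).not.2 (NeZero.ne (volume : Measure (GroupSpace gr j)))) x
  rwa [setIntegral_univ] at this

theorem ShearModel.tendsto_setIntegral_weight (S : ShearModel gr m ℓ T F β)
    (hK : IsExhaustion gr K) {j : ℕ} (hj : j < m) {M ε : ℝ} {w : ℕ → (κ → ℝ) → ℝ}
    {h : (κ → ℝ) → ℝ} (hw : ∀ᶠ n in atTop, WeightBound gr j M ε (w n))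
    (hwlim : ∀ θ, Tendsto (fun n => w n θ) atTop (𝓝 (F j (T θ) * Real.exp (h (T θ)))))
    (hh : DependsOn h {a | j < gr a}) (θ : κ → ℝ) :
    Tendsto (fun n => ∫ y in K n j, w n (ovEq gr j θ y)) atTop
      (𝓝 (Real.exp (h (T θ)) * ∫ y, F j (ovEq gr j (T θ) y))) := by
  simpa using S.tendsto_setIntegral hK hj hw hwlim hh (φ := fun _ _ => 1) (ψ := fun _ => 1)
    (Eventually.of_forall fun _ => linGrowth_const 1) (fun _ => tendsto_const_nhds)
    (fun _ _ _ => rfl) θ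

theorem ShearModel.tendsto_avg (S : ShearModel gr m ℓ T F β) (hK : IsExhaustion gr K)
    {j : ℕ} (hj : j < m) {M ε M' : ℝ} {w φ : ℕ → (κ → ℝ) → ℝ} {h ψ : (κ → ℝ) → ℝ}
    (hw : ∀ᶠ n in atTop, WeightBound gr j M ε (w n))
    (hwlim : ∀ θ, Tendsto (fun n => w n θ) atTop (𝓝 (F j (T θ) * Real.exp (h (T θ)))))
    (hh : DependsOn h {a | j < gr a})
    (hφ : ∀ᶠ n in atTop, LinGrowth M' (φ n))
    (hφlim : ∀ θ, Tendsto (fun n => φ n θ) atTop (𝓝 (ψ (T θ))))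
    (hψ : DependsOn ψ {a | j ≤ gr a}) (θ : κ → ℝ) :
    Tendsto (fun n => avg j (K n j) (w n) (φ n) θ) atTop
      (𝓝 (avg (gr := gr) j Set.univ (F j) ψ (T θ))) := by
  have h1 := S.tendsto_setIntegral hK hj hw hwlim hh hφ hφlim hψ θ
  have h2 := S.tendsto_setIntegral_weight hK hj hw hwlim hh θ
  have hne := (S.integral_F_pos hj (T θ)).ne'
  have h3 := h1.div h2 (mul_ne_zero (Real.exp_pos _).ne' hne)
  rw [mul_div_mul_left _ _ (Real.exp_pos _).ne'] at h3
  rw [avg, setIntegral_univ, setIntegral_univ]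
  exact h3

theorem ShearModel.linGrowth_β (S : ShearModel gr m ℓ T F β) :
    ∃ M, ∀ j < m, LinGrowth M fun θ => β j (T θ) := by
  obtain ⟨M₁, h₁⟩ := S.β_le
  obtain ⟨M₂, h₂⟩ := S.le_β
  obtain ⟨M₃, hM₃, h₃⟩ := S.growth
  refine ⟨|M₁| + |M₂| * (1 + M₃), fun j hj => ⟨((S.continuous_β j hj).comp S.continuous_T).measurable,
    by positivity, fun θ => ?_⟩⟩
  have hn := norm_nonneg θ
  have h4 : (1 + ‖T θ‖) ≤ (1 + M₃) * (1 + ‖θ‖) := by have := h₃ θ; linarith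
  have h5 : M₂ * (1 + ‖T θ‖) ≤ |M₂| * ((1 + M₃) * (1 + ‖θ‖)) :=
    (mul_le_mul_of_nonneg_right (le_abs_self _) (by positivity)).trans (by gcongr)
  have h6 : |M₁| ≤ |M₁| * (1 + ‖θ‖) := le_mul_of_one_le_right (abs_nonneg _) (by linarith)
  have h7 : 0 ≤ |M₁| * (1 + ‖θ‖) := by positivity
  have h8 : 0 ≤ |M₂| * ((1 + M₃) * (1 + ‖θ‖)) := by positivity
  have h9 := le_abs_self M₁
  rw [abs_le]
  have a1 := h₁ j hj (T θ)
  have a2 := h₂ j hj (T θ)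
  constructor <;> linarith

theorem ShearModel.linGrowth_log_F (S : ShearModel gr m ℓ T F β) :
    ∃ M, ∀ j < m, LinGrowth M fun θ => 2 * Real.log (F j (T θ)) := by
  obtain ⟨M₁, hM₁, h₁⟩ := S.F_lower
  obtain ⟨M₂, ε, hε, h₂⟩ := S.F_upper
  obtain ⟨M₃, hM₃, h₃⟩ := S.growth
  refine ⟨2 * (|M₂| + M₁ * (1 + M₃)), fun j hj => ⟨?_, by positivity, fun θ => ?_⟩⟩
  · exact (Real.measurable_log.comp
      ((S.continuous_F j hj).comp S.continuous_T).measurable).const_mul 2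
  have hn := norm_nonneg θ
  have hlow : -(M₁ * (1 + ‖T θ‖)) ≤ Real.log (F j (T θ)) := by
    rw [← Real.log_exp (-(M₁ * (1 + ‖T θ‖)))]
    exact Real.log_le_log (Real.exp_pos _) (h₁ j hj _)
  have hup : Real.log (F j (T θ)) ≤ |M₂| := by
    refine (Real.log_le_log (S.F_pos hj _) (h₂ j hj _)).trans ?_
    rw [Real.log_exp]
    have : 0 ≤ ε * ‖fun a : {a : κ // gr a = j} => T θ a.1‖ := by positivity
    have := le_abs_self M₂
    linarith
  have h4 : (1 + ‖T θ‖) ≤ (1 + M₃) * (1 + ‖θ‖) := by have := h₃ θ; linarith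
  have h5 : M₁ * (1 + ‖T θ‖) ≤ M₁ * ((1 + M₃) * (1 + ‖θ‖)) := by gcongr
  have h6 : |M₂| ≤ |M₂| * (1 + ‖θ‖) := le_mul_of_one_le_right (abs_nonneg _) (by linarith)
  have h7 : 0 ≤ |M₂| * (1 + ‖θ‖) := by positivity
  have h8 : 0 ≤ M₁ * ((1 + M₃) * (1 + ‖θ‖)) := by positivity
  rw [abs_le]
  constructor <;> linarith

/-- `F j (T θ)` has exponential tails in group `j`, the shift growing at most linearly. -/
theorem ShearModel.weightBound_of_le (S : ShearModel gr m ℓ T F β) {M₀ : ℝ} (hM₀ : 0 ≤ M₀) :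
    ∃ M ε, ∀ j < m, ∀ w : (κ → ℝ) → ℝ, Measurable w →
      (∀ θ, F j (T θ) * Real.exp (-(M₀ * (1 + ‖θ‖))) ≤ w θ) →
      (∀ θ, w θ ≤ F j (T θ) * Real.exp M₀) → WeightBound gr j M ε w := by
  obtain ⟨M₁, hM₁, h₁⟩ := S.F_lower
  obtain ⟨M₂, ε, hε, h₂⟩ := S.F_upper
  obtain ⟨M₃, hM₃, h₃⟩ := S.growth
  refine ⟨M₀ + M₁ * (1 + M₃) + |M₂| + ε * (M₃ + 1), ε, fun j hj w hw hlow hup =>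
    ⟨hw, by positivity, hε, fun θ => ?_, fun θ y => ?_⟩⟩
  · refine le_trans ?_ (hlow θ)
    refine le_trans ?_ (mul_le_mul_of_nonneg_right (h₁ j hj (T θ)) (Real.exp_pos _).le)
    rw [← Real.exp_add, Real.exp_le_exp]
    have hn := norm_nonneg θ
    have h4 : (1 + ‖T θ‖) ≤ (1 + M₃) * (1 + ‖θ‖) := by have := h₃ θ; linarith
    have h5 : M₁ * (1 + ‖T θ‖) ≤ M₁ * ((1 + M₃) * (1 + ‖θ‖)) := by gcongr
    have h6 : 0 ≤ |M₂| * (1 + ‖θ‖) := by positivity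
    have h7 : 0 ≤ ε * (M₃ + 1) * (1 + ‖θ‖) := by positivity
    linarith
  · refine (hup _).trans ?_
    rw [S.apply_ovEq (S.dependsOn_F_le hj)]
    set c : GroupSpace gr j := fun a => T θ a.1 - θ a.1 with hc
    refine (mul_le_mul_of_nonneg_right (h₂ j hj _) (Real.exp_pos _).le).trans ?_
    rw [← Real.exp_add, Real.exp_le_exp]
    have e : (fun a : {a : κ // gr a = j} => ovEq gr j (T θ) (y + c) a.1) = y + c := by
      funext a; exact ovEq_of a.2
    rw [e]
    have hcn : ‖c‖ ≤ ‖T θ‖ + ‖θ‖ := by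
      refine (pi_norm_le_iff_of_nonneg (by positivity)).2 fun a => ?_
      exact (norm_sub_le _ _).trans (add_le_add (norm_le_pi_norm _ _) (norm_le_pi_norm _ _))
    have h4 : ‖y‖ ≤ ‖y + c‖ + ‖c‖ := by
      have := norm_sub_le (y + c) c
      rwa [add_sub_cancel_right] at this
    have h5 := h₃ θ
    have hn := norm_nonneg θ
    have h6 : ε * ‖y‖ ≤ ε * ‖y + c‖ + ε * ((M₃ + 1) * (1 + ‖θ‖)) := by
      rw [← mul_add]
      refine mul_le_mul_of_nonneg_left ?_ hε.le
      linarith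
    have h7 : 0 ≤ M₁ * (1 + M₃) * (1 + ‖θ‖) := by positivity
    have h8 : 0 ≤ M₀ * ‖θ‖ := by positivity
    have h9 : 0 ≤ |M₂| * ‖θ‖ := by positivity
    have := le_abs_self M₂
    linarith

variable {info : (κ → ℝ) → Matrix κ κ ℝ}

/-- The weights of the algorithm on the compact sets have exponential tails, uniformly in `n`, and
they converge to `F j (T θ)` up to a function of the more important groups. -/
theorem ShearModel.stepWeight_spec
    (S : ShearModel gr m (fun j θ => Real.log (infoBlock (info θ) gr j).det) T F β)
    (hK : IsExhaustion gr K) {n₀ : ℕ} (hn₀ : ∀ n ≥ n₀, ∀ j < m, volume (K n j) ≠ 0) (j : ℕ)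
    (hj : j < m) :
    (∃ M ε, ∀ n ≥ n₀, WeightBound gr j M ε (stepWeight info gr (K n) j)) ∧
      ∃ h : (κ → ℝ) → ℝ, DependsOn h {a | j < gr a} ∧
        ∀ θ, Tendsto (fun n => stepWeight info gr (K n) j θ) atTop
          (𝓝 (F j (T θ) * Real.exp (h (T θ)))) := by
  induction j using Nat.strong_induction_on with
  | _ j ih =>
  have ih1 : ∀ i, ∃ M ε, i < j → ∀ n ≥ n₀, WeightBound gr i M ε (stepWeight info gr (K n) i) := by
    intro i
    by_cases hi : i < j
    · obtain ⟨M, ε, h⟩ := (ih i hi (hi.trans hj)).1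
      exact ⟨M, ε, fun _ => h⟩
    · exact ⟨0, 0, fun h => absurd h hi⟩
  choose Mw εw hwb using ih1
  obtain ⟨Mβ, hβ⟩ := S.linGrowth_β
  obtain ⟨MF, hF⟩ := S.linGrowth_log_F
  obtain ⟨Bβ, hBβ⟩ := S.β_le
  -- the averages of `β j` grow linearly, uniformly in `n`: this dominates them in the limit
  have hgrowth : ∀ i ≤ j, ∃ M'', ∀ n ≥ n₀, LinGrowth M''
      (iterAvg (K n) (stepWeight info gr (K n)) i fun θ => β j (T θ)) := by
    intro i hi
    obtain ⟨M'', h⟩ := exists_linGrowth_iterAvg (gr := gr) (K₀ := K n₀) (M := Mw) (ε := εw) i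
      (fun i _ => hK.compact n₀ i) (fun i' hi' => hn₀ n₀ le_rfl i' (by omega)) (M' := Mβ)
    exact ⟨M'', fun n hn => h (K n) (fun i' _ => hK.mono i' hn) _
      (fun i' hi' => hwb i' (by omega) n hn) _ (hβ j hj)⟩
  -- `F j` does not involve the groups averaged over, so that only `β j` is averaged
  have hrepr : ∀ n ≥ n₀, ∀ θ, stepWeight info gr (K n) j θ = F j (T θ) * Real.exp (1 / 2 *
      iterAvg (K n) (stepWeight info gr (K n)) j (fun θ => β j (T θ)) θ) := by
    intro n hn θ
    have hw : ∀ i < j, WeightBound gr i (Mw i) (εw i) (stepWeight info gr (K n) i) :=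
      fun i hi => hwb i hi n hn
    have hKc : ∀ i < j, IsCompact (K n i) := fun i _ => hK.compact n i
    have hv : ∀ i < j, volume (K n i) ≠ 0 := fun i hi => hn₀ n hn i (by omega)
    have hℓ : (fun θ => Real.log (infoBlock (info θ) gr j).det) =
        fun θ => 2 * Real.log (F j (T θ)) + β j (T θ) := funext fun θ => S.eq j hj θ
    have hlin : LinGrowth (MF + Mβ) fun θ => Real.log (infoBlock (info θ) gr j).det := by
      rw [hℓ]
      refine ⟨(hF j hj).meas.add (hβ j hj).meas, add_nonneg (hF j hj).nonneg (hβ j hj).nonneg,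
        fun θ => (abs_add_le _ _).trans ?_⟩
      rw [add_mul]
      exact add_le_add ((hF j hj).le θ) ((hβ j hj).le θ)
    rw [stepWeight, (integral_mul_seqPrior hKc hv hw hlin θ).2, hℓ,
      iterAvg_add hKc hv hw (hF j hj) (hβ j hj)]
    · simp only
      rw [mul_add, Real.exp_add, ← mul_assoc]
      norm_num
      rw [Real.exp_log (S.F_pos hj _)]
    · -- the density of group `j` does not involve the less important groups
      intro i hi θ y
      congr 2
      have h1 := S.apply_ovEq (j := i) (f := F j)
        ((S.dependsOn_F j hj).mono fun a (ha : gr a = j) => show i ≤ gr a by omega) θ y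
      rw [h1]
      exact S.dependsOn_F j hj fun a (ha : gr a = j) => ovEq_of_ne (by omega)
  constructor
  · obtain ⟨M'', hM''⟩ := hgrowth j le_rfl
    obtain ⟨M, ε, h⟩ := S.weightBound_of_le (M₀ := |M''| + |Bβ|) (by positivity)
    refine ⟨M, ε, fun n hn => h j hj _ ?_ (fun θ => ?_) (fun θ => ?_)⟩
    · rw [funext (hrepr n hn)]
      exact ((S.continuous_F j hj).comp S.continuous_T).measurable.mul
        (((hM'' n hn).meas.const_mul _).exp)
    · rw [hrepr n hn]
      refine mul_le_mul_of_nonneg_left (Real.exp_le_exp.2 ?_) (S.F_pos hj _).le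
      have h1 := (abs_le.1 ((hM'' n hn).le θ)).1
      have h2 : M'' * (1 + ‖θ‖) ≤ |M''| * (1 + ‖θ‖) :=
        mul_le_mul_of_nonneg_right (le_abs_self _) (by positivity)
      have h3 : 0 ≤ |Bβ| * (1 + ‖θ‖) := by positivity
      have h4 : 0 ≤ |M''| * (1 + ‖θ‖) := by positivity
      linarith
    · rw [hrepr n hn]
      refine mul_le_mul_of_nonneg_left (Real.exp_le_exp.2 ?_) (S.F_pos hj _).le
      have h1 := iterAvg_le (K := K n) (fun i _ => hK.compact n i)
        (fun i hi => hn₀ n hn i (by omega)) (fun i hi => hwb i hi n hn) (hβ j hj)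
        (fun θ => hBβ j hj (T θ)) θ
      have := le_abs_self Bβ
      have := abs_nonneg Bβ
      have := abs_nonneg M''
      linarith
  · have hlim : ∀ i ≤ j, ∀ θ, Tendsto (fun n => iterAvg (K n) (stepWeight info gr (K n)) i
        (fun θ => β j (T θ)) θ) atTop (𝓝 (limAvg gr F i (β j) (T θ))) := by
      intro i
      induction i with
      | zero => intro _ θ; exact tendsto_const_nhds
      | succ i ihi =>
        intro hi θ
        obtain ⟨M'', hM''⟩ := hgrowth i (by omega)
        obtain ⟨-, h, hdep, hlim⟩ := ih i (by omega) (by omega)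
        exact S.tendsto_avg hK (by omega) (eventually_atTop.2 ⟨n₀, hwb i (by omega)⟩) hlim hdep
          (eventually_atTop.2 ⟨n₀, hM''⟩) (ihi (by omega))
          ((S.dependsOn_limAvg hj (by omega)).mono fun a ha => ha.1) θ
    refine ⟨fun x => 1 / 2 * limAvg gr F j (β j) x, fun x x' hx => ?_, fun θ => ?_⟩
    · simp only
      congr 1
      refine S.dependsOn_limAvg hj le_rfl fun a ha => hx a ?_
      have h1 : j ≤ gr a := ha.1
      have h2 : gr a ≠ j := ha.2
      change j < gr a
      omega
    · refine (((Real.continuous_exp.tendsto _).comp ((hlim j le_rfl θ).const_mul (1 / 2))).const_mul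
        (F j (T θ))).congr' ?_
      filter_upwards [eventually_ge_atTop n₀] with n hn
      rw [hrepr n hn]; rfl

/-- The limit of the priors on the compact sets: the function of the more important groups by
which the weight of group `j` differs from `F j (T θ)` cancels in the normalization. -/
theorem ShearModel.tendsto_seqPrior
    (S : ShearModel gr m (fun j θ => Real.log (infoBlock (info θ) gr j).det) T F β)
    (hK : IsExhaustion gr K) (j : ℕ) (hj : j ≤ m) (θ : κ → ℝ) :
    Tendsto (fun n => seqPrior info gr (K n) j θ) atTop
      (𝓝 (∏ i ∈ Finset.range j, F i (T θ) / ∫ y, F i (ovEq gr i 0 y))) := by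
  obtain ⟨n₀, hn₀⟩ := hK.exists_volume_ne_zero m
  induction j with
  | zero => simp [seqPrior]
  | succ j ih =>
    obtain ⟨⟨M, ε, hb⟩, h, hdep, hlim⟩ := S.stepWeight_spec hK hn₀ j (by omega)
    rw [Finset.prod_range_succ]
    refine (ih (by omega)).mul ?_
    have h1 := S.tendsto_setIntegral_weight hK (by omega : j < m)
      (eventually_atTop.2 ⟨n₀, hb⟩) hlim hdep θ
    have hne := (S.integral_F_pos (by omega : j < m) (T θ)).ne'
    have h2 : ∀ y, F j (ovEq gr j (T θ) y) = F j (ovEq gr j 0 y) := fun y =>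
      S.dependsOn_F j (by omega) fun a (ha : gr a = j) => by rw [ovEq_of ha, ovEq_of ha]
    have h3 := (hlim θ).div h1 (mul_ne_zero (Real.exp_pos _).ne' hne)
    rw [mul_comm, mul_div_mul_left _ _ (Real.exp_pos _).ne'] at h3
    simp_rw [h2] at h3
    refine h3.congr' ?_
    filter_upwards [hK.eventually_mem j fun a => θ a.1] with n hn
    simp only [Pi.div_apply]
    rw [Set.indicator_of_mem hn]
    rfl

theorem ShearModel.isReferencePrior {m : ℕ} {grp : κ → Fin m}
    (S : ShearModel (fun a => (grp a : ℕ)) m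
      (fun j θ => Real.log (infoBlock (info θ) (fun a => (grp a : ℕ)) j).det) T F β)
    {π : (κ → ℝ) → ℝ} (hπ : ∀ θ, π θ = ∏ j ∈ Finset.range m, F j (T θ)) :
    IsReferencePrior info m grp π := by
  refine ⟨fun θ => ?_, fun K hK θ θ₀ => ?_⟩
  · rw [hπ]; exact Finset.prod_pos fun j hj => S.F_pos (Finset.mem_range.1 hj) _
  · have hZ : ∀ j ∈ Finset.range m, (∫ y, F j (ovEq (fun a => (grp a : ℕ)) j 0 y)) ≠ 0 :=
      fun j hj => (S.integral_F_pos (Finset.mem_range.1 hj) 0).ne'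
    have hpos : ∀ θ, (∏ j ∈ Finset.range m, F j (T θ) /
        ∫ y, F j (ovEq (fun a => (grp a : ℕ)) j 0 y)) ≠ 0 := fun θ =>
      Finset.prod_ne_zero_iff.2 fun j hj =>
        div_ne_zero (S.F_pos (Finset.mem_range.1 hj) _).ne' (hZ j hj)
    have h := (S.tendsto_seqPrior hK m le_rfl θ).div (S.tendsto_seqPrior hK m le_rfl θ₀) (hpos θ₀)
    rw [Finset.prod_div_distrib, Finset.prod_div_distrib,
      div_div_div_cancel_right₀ (Finset.prod_ne_zero_iff.2 hZ), ← hπ, ← hπ] at h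
    exact h

end Limit

/-! ### The blocks of an information matrix -/

section InfoBlock

open Matrix

variable {κ : Type*} [Fintype κ] [DecidableEq κ]

theorem sum_eq_sum_subtype {P : κ → Prop} [DecidablePred P] {f : κ → ℝ}
    (hf : ∀ c, ¬ P c → f c = 0) : ∑ c, f c = ∑ c : {c : κ // P c}, f c.1 := by
  rw [← Finset.sum_subtype (Finset.univ.filter P) (by simp) f, Finset.sum_filter]
  refine Finset.sum_congr rfl fun c _ => ?_
  split_ifs with h
  · rfl
  · exact hf c h

/-- The block of a matrix belonging to the groups `≥ j`. -/
def geBlock (gr : κ → ℕ) (j : ℕ) (A : Matrix κ κ ℝ) :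
    Matrix {a : κ // j ≤ gr a} {a : κ // j ≤ gr a} ℝ :=
  A.submatrix Subtype.val Subtype.val

theorem geBlock_mul {gr : κ → ℕ} {A : Matrix κ κ ℝ} (hA : A.BlockTriangular gr)
    (B : Matrix κ κ ℝ) (j : ℕ) : geBlock gr j (A * B) = geBlock gr j A * geBlock gr j B := by
  ext a b
  simp only [geBlock, submatrix_apply, mul_apply]
  exact sum_eq_sum_subtype fun c h => by
    rw [hA (show gr c < gr a.1 from (not_le.1 h).trans_le a.2), zero_mul]

theorem geBlock_one {gr : κ → ℕ} {j : ℕ} : geBlock gr j (1 : Matrix κ κ ℝ) = 1 :=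
  submatrix_one _ Subtype.val_injective

theorem geBlock_transpose {gr : κ → ℕ} {j : ℕ} (A : Matrix κ κ ℝ) :
    geBlock gr j Aᵀ = (geBlock gr j A)ᵀ := rfl

theorem geBlock_mul_transpose {gr : κ → ℕ} {A : Matrix κ κ ℝ} (hA : A.BlockTriangular gr)
    (B : Matrix κ κ ℝ) (j : ℕ) : geBlock gr j (B * Aᵀ) = geBlock gr j B * geBlock gr j Aᵀ := by
  rw [← transpose_transpose (B * Aᵀ), transpose_mul, transpose_transpose, geBlock_transpose,
    geBlock_mul hA, transpose_mul]
  rfl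

theorem det_of_blockUnitriangular {gr : κ → ℕ} {J : Matrix κ κ ℝ} (hJ : J.BlockTriangular gr)
    (hJ1 : ∀ a b, gr a = gr b → J a b = (1 : Matrix κ κ ℝ) a b) : J.det = 1 := by
  rw [hJ.det]
  refine Finset.prod_eq_one fun j _ => ?_
  have : J.toSquareBlock gr j = 1 := by
    ext a b
    rw [toSquareBlock_def, of_apply, hJ1 _ _ (a.2.trans b.2.symm), one_apply, one_apply]
    simp only [Subtype.ext_iff]
  rw [this, det_one]

/-- The blocks `h_j` do not change under a change of coordinates whose Jacobian is
block-unitriangular: they are the diagonal blocks of the block diagonal information matrix in the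
new coordinates. -/
theorem infoBlock_transpose_mul_mul {gr : κ → ℕ} {J D : Matrix κ κ ℝ}
    (hJ : J.BlockTriangular gr) (hJ1 : ∀ a b, gr a = gr b → J a b = (1 : Matrix κ κ ℝ) a b)
    (hD : ∀ a b, gr a ≠ gr b → D a b = 0) (hdet : IsUnit D.det) (j : ℕ) :
    infoBlock (Jᵀ * D * J) gr j = D.toSquareBlock gr j := by
  have hJdet : IsUnit J.det := by rw [det_of_blockUnitriangular hJ hJ1]; exact isUnit_one
  have hDt : D.BlockTriangular gr := fun a b h => hD a b h.ne'
  have : Invertible J := J.invertibleOfIsUnitDet hJdet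
  have hB : (J⁻¹).BlockTriangular gr := blockTriangular_inv_of_blockTriangular hJ
  set B := J⁻¹ with hBdef
  have h1 : geBlock gr j (Jᵀ * D * J)⁻¹ = geBlock gr j B * (geBlock gr j D⁻¹ * geBlock gr j Bᵀ) := by
    rw [Matrix.mul_inv_rev, Matrix.mul_inv_rev, ← transpose_nonsing_inv, geBlock_mul hB,
      geBlock_mul_transpose hB]
  have h2 : geBlock gr j Jᵀ * geBlock gr j D * geBlock gr j J * geBlock gr j (Jᵀ * D * J)⁻¹ = 1 := by
    have e1 : geBlock gr j J * geBlock gr j B = 1 := by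
      rw [← geBlock_mul hJ, hBdef, mul_nonsing_inv _ hJdet, geBlock_one]
    have e2 : geBlock gr j D * geBlock gr j D⁻¹ = 1 := by
      rw [← geBlock_mul hDt, mul_nonsing_inv _ hdet, geBlock_one]
    have e3 : geBlock gr j Jᵀ * geBlock gr j Bᵀ = 1 := by
      rw [← geBlock_mul_transpose hB, ← transpose_mul, hBdef, nonsing_inv_mul _ hJdet,
        transpose_one, geBlock_one]
    rw [h1]
    calc _ = geBlock gr j Jᵀ * (geBlock gr j D * (geBlock gr j J * geBlock gr j B) *
          geBlock gr j D⁻¹) * geBlock gr j Bᵀ := by simp only [Matrix.mul_assoc]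
      _ = 1 := by rw [e1, Matrix.mul_one, e2, Matrix.mul_one, e3]
  have h3 : (geBlock gr j (Jᵀ * D * J)⁻¹)⁻¹ = geBlock gr j Jᵀ * geBlock gr j D * geBlock gr j J :=
    inv_eq_left_inv h2
  change ((geBlock gr j (Jᵀ * D * J)⁻¹)⁻¹).submatrix _ _ = _
  rw [h3]
  ext a b
  have hcol : ∀ (c : {a : κ // j ≤ gr a}) (b : {a : κ // gr a = j}),
      J c.1 b.1 = (1 : Matrix κ κ ℝ) c.1 b.1 := by
    intro c b
    rcases eq_or_lt_of_le c.2 with h | h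
    · exact hJ1 _ _ (h.symm.trans b.2.symm)
    · have : gr b.1 < gr c.1 := b.2.trans_lt h
      rw [hJ this, one_apply_ne]
      rintro h'; rw [h'] at this; exact lt_irrefl _ this
  simp only [submatrix_apply, mul_apply, geBlock, transpose_apply, hcol, toSquareBlock_def, of_apply,
    one_apply]
  rw [Finset.sum_eq_single ⟨b.1, b.2.ge⟩]
  · rw [if_pos rfl, mul_one, Finset.sum_eq_single ⟨a.1, a.2.ge⟩]
    · rw [if_pos rfl, one_mul]
    · intro c _ hc
      rw [if_neg (fun h => hc (Subtype.ext h)), zero_mul]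
    · exact fun h => absurd (Finset.mem_univ _) h
  · intro c _ hc
    rw [if_neg (fun h => hc (Subtype.ext h)), mul_zero]
  · exact fun h => absurd (Finset.mem_univ _) h

/-- The diagonal block of `Aᵀ D A` if `A` and `D` are block diagonal. -/
theorem toSquareBlock_transpose_mul_mul {gr : κ → ℕ} {A D : Matrix κ κ ℝ}
    (hA : ∀ a b, gr a ≠ gr b → A a b = 0) (j : ℕ) :
    (Aᵀ * D * A).toSquareBlock gr j =
      (A.toSquareBlock gr j)ᵀ * D.toSquareBlock gr j * A.toSquareBlock gr j := by
  ext a b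
  simp only [toSquareBlock_def, of_apply, mul_apply, transpose_apply]
  rw [sum_eq_sum_subtype (P := fun c => gr c = j)]
  · refine Finset.sum_congr rfl fun c _ => ?_
    rw [sum_eq_sum_subtype (P := fun c => gr c = j)]
    intro d hd
    rw [hA d a.1 (by rw [a.2]; exact hd), zero_mul]
  · intro d hd
    rw [hA d b.1 (by rw [b.2]; exact hd), mul_zero]

/-- The determinant of the blocks of a matrix which is block diagonal for a finer partition. -/
theorem det_toSquareBlock_sigma {ι : Type*} [Fintype ι] [DecidableEq ι] {X : ι → Type*}
    [∀ g, Fintype (X g)] [∀ g, DecidableEq (X g)] {D : Matrix (Σ g, X g) (Σ g, X g) ℝ}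
    (hD : ∀ x y, x.1 ≠ y.1 → D x y = 0) (grp : ι → ℕ) (j : ℕ) :
    (D.toSquareBlock (fun x => grp x.1) j).det =
      ∏ g with grp g = j, (Matrix.of fun a b => D ⟨g, a⟩ ⟨g, b⟩).det := by
  let b : {x : Σ g, X g // grp x.1 = j} → Fin (Fintype.card ι) := fun x => Fintype.equivFin ι x.1.1
  have hb : (D.toSquareBlock (fun x => grp x.1) j).BlockTriangular b := fun x y h =>
    hD _ _ fun h' => h.ne (by simp only [b, h'])
  rw [hb.det_fintype, ← (Fintype.equivFin ι).prod_comp, Finset.prod_filter]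
  refine Finset.prod_congr rfl fun g _ => ?_
  split_ifs with hg
  · let E : X g ≃ {x : {x : Σ g, X g // grp x.1 = j} // b x = Fintype.equivFin ι g} :=
      Equiv.ofBijective (fun a => ⟨⟨⟨g, a⟩, hg⟩, rfl⟩) ⟨fun a a' h => by simpa using h, by
        rintro ⟨⟨⟨g', a⟩, hg'⟩, h⟩
        obtain rfl : g' = g := (Fintype.equivFin ι).injective h
        exact ⟨a, rfl⟩⟩
    rw [← det_submatrix_equiv_self E]
    rfl
  · have : IsEmpty {x : {x : Σ g, X g // grp x.1 = j} // b x = Fintype.equivFin ι g} :=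
      ⟨fun x => hg (by
        have h : x.1.1.1 = g := (Fintype.equivFin ι).injective x.2
        rw [← h]; exact x.1.2)⟩
    exact det_isEmpty

/-- The determinant of the covariance matrix of the indicators of all cells but one. -/
theorem det_diagonal_sub_mul {ι : Type*} [Fintype ι] [DecidableEq ι] (f : ι → ℝ) :
    (Matrix.of fun r t => f r * ((1 : Matrix ι ι ℝ) r t - f t)).det =
      (∏ r, f r) * (1 - ∑ r, f r) := by
  have h : (Matrix.of fun r t => f r * ((1 : Matrix ι ι ℝ) r t - f t)) =
      diagonal f * (1 + replicateCol Unit (fun _ : ι => (-1 : ℝ)) * replicateRow Unit f) := by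
    ext r t
    rw [diagonal_mul]
    simp [mul_apply, sub_eq_add_neg]
  rw [h, det_mul, det_diagonal, det_one_add_replicateCol_mul_replicateRow]
  simp [dotProduct, sub_eq_add_neg]

end InfoBlock

/-! ### The Fisher information of a multinomial model -/

section Fisher

variable {κ κ' : Type*} [Fintype κ] [DecidableEq κ] [Fintype κ'] [DecidableEq κ']

/-- The expected counts of a multinomial distribution: the derivative of the multinomial theorem. -/
theorem sum_multinomial_mul_count {X : Type*} [Fintype X] [DecidableEq X] (N : ℕ) (p : X → ℝ)
    (hp : ∑ i, p i = 1) (i : X) :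
    ∑ n ∈ Finset.piAntidiag (Finset.univ : Finset X) N,
      (Nat.multinomial Finset.univ n * ∏ j, p j ^ n j) * (n i : ℝ) = N * p i := by
  have h1 : ∀ t : ℝ, (1 + p i * (t - 1)) ^ N =
      ∑ n ∈ Finset.piAntidiag (Finset.univ : Finset X) N,
        (Nat.multinomial Finset.univ n * ∏ j, p j ^ n j) * t ^ n i := by
    intro t
    have e : 1 + p i * (t - 1) = ∑ j, p j * (if j = i then t else 1) := by
      have : ∀ j, p j * (if j = i then t else 1) = p j + if j = i then p i * (t - 1) else 0 := by
        intro j; split_ifs with h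
        · rw [h]; ring
        · ring
      simp_rw [this]
      rw [Finset.sum_add_distrib, hp]
      simp
    rw [e, Finset.sum_pow_eq_sum_piAntidiag]
    refine Finset.sum_congr rfl fun n _ => ?_
    simp_rw [mul_pow, ite_pow, one_pow]
    rw [Finset.prod_mul_distrib]
    simp [mul_assoc]
  have h2 : HasDerivAt (fun t : ℝ => (1 + p i * (t - 1)) ^ N) (N * p i) 1 := by
    have := ((((hasDerivAt_id (1 : ℝ)).sub_const 1).const_mul (p i)).const_add 1).fun_pow N
    simpa using this
  have h3 : HasDerivAt (fun t : ℝ => (1 + p i * (t - 1)) ^ N)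
      (∑ n ∈ Finset.piAntidiag (Finset.univ : Finset X) N,
        (Nat.multinomial Finset.univ n * ∏ j, p j ^ n j) * (n i : ℝ)) 1 := by
    rw [funext h1]
    refine HasDerivAt.fun_sum fun n _ => ?_
    simpa using (hasDerivAt_pow (n i) (1 : ℝ)).const_mul _
  exact h3.unique h2

theorem pderiv_sum {ι : Type*} (s : Finset ι) (f : ι → (κ → ℝ) → ℝ) {θ : κ → ℝ}
    (hf : ∀ i ∈ s, DifferentiableAt ℝ (f i) θ) (a : κ) :
    pderiv a (fun η => ∑ i ∈ s, f i η) θ = ∑ i ∈ s, pderiv a (f i) θ := by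
  rw [pderiv, fderiv_fun_sum hf, _root_.sum_apply]; rfl

theorem pderiv_const_mul (c : ℝ) {f : (κ → ℝ) → ℝ} {θ : κ → ℝ} (hf : DifferentiableAt ℝ f θ)
    (a : κ) : pderiv a (fun η => c * f η) θ = c * pderiv a f θ := by
  rw [pderiv, fderiv_const_mul hf]; rfl

theorem pderiv_const_add (c : ℝ) (f : (κ → ℝ) → ℝ) (θ : κ → ℝ) (a : κ) :
    pderiv a (fun η => c + f η) θ = pderiv a f θ := by
  rw [pderiv, fderiv_const_add]; rfl

theorem pderiv_exp {f : (κ → ℝ) → ℝ} {θ : κ → ℝ} (hf : DifferentiableAt ℝ f θ) (a : κ) :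
    pderiv a (fun η => Real.exp (f η)) θ = Real.exp (f θ) * pderiv a f θ := by
  rw [pderiv, fderiv_exp hf]; rfl

theorem pderiv_mul {f g : (κ → ℝ) → ℝ} {θ : κ → ℝ} (hf : DifferentiableAt ℝ f θ)
    (hg : DifferentiableAt ℝ g θ) (a : κ) :
    pderiv a (fun η => f η * g η) θ = f θ * pderiv a g θ + pderiv a f θ * g θ := by
  rw [pderiv, fderiv_fun_mul hf hg]
  simp [pderiv, mul_comm]

theorem pderiv_sub {f g : (κ → ℝ) → ℝ} {θ : κ → ℝ} (hf : DifferentiableAt ℝ f θ)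
    (hg : DifferentiableAt ℝ g θ) (a : κ) :
    pderiv a (fun η => f η - g η) θ = pderiv a f θ - pderiv a g θ := by
  rw [pderiv, fderiv_fun_sub hf hg]; rfl

theorem pderiv_const (c : ℝ) (θ : κ → ℝ) (a : κ) : pderiv a (fun _ => c) θ = 0 := by
  simp [pderiv]

theorem contDiff_pderiv {f : (κ → ℝ) → ℝ} (hf : ContDiff ℝ 2 f) (a : κ) :
    ContDiff ℝ 1 (pderiv a f) :=
  (hf.fderiv_right (m := 1) (by norm_num)).clm_apply contDiff_const

theorem pderiv_comp {f : (κ' → ℝ) → ℝ} {T : (κ → ℝ) → κ' → ℝ} {θ : κ → ℝ}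
    (hf : DifferentiableAt ℝ f (T θ)) (hT : DifferentiableAt ℝ T θ) (a : κ) :
    pderiv a (fun η => f (T η)) θ = ∑ c, pderiv c f (T θ) * pderiv a (fun η => T η c) θ := by
  have h1 : pderiv a (fun η => f (T η)) θ = fderiv ℝ f (T θ) (fderiv ℝ T θ (Pi.single a 1)) := by
    rw [pderiv, show (fun η => f (T η)) = f ∘ T from rfl, fderiv_comp _ hf hT]; rfl
  have h2 : ∀ c, pderiv a (fun η => T η c) θ = fderiv ℝ T θ (Pi.single a 1) c := by
    intro c
    rw [pderiv, fderiv_apply hT]; rfl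
  rw [h1]
  conv_lhs => rw [pi_eq_sum_univ' (fderiv ℝ T θ (Pi.single a 1))]
  rw [map_sum]
  refine Finset.sum_congr rfl fun c _ => ?_
  rw [map_smul, h2, smul_eq_mul, mul_comm]
  congr 2

variable {V : Type*} [Fintype V] [DecidableEq V] {L : V → Type*} [∀ v, Fintype (L v)]
  [∀ v, DecidableEq (L v)] [∀ v, Zero (L v)]

/-- The Fisher information in terms of the second derivatives of the log-probabilities of the
cells. -/
theorem multinomialInfo_eq_neg_sum (N : ℕ) {P : (κ → ℝ) → Cell L → ℝ}
    (hpos : ∀ θ i, 0 < P θ i) (hsum : ∀ θ, ∑ i, P θ i = 1)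
    (hP : ∀ i, ContDiff ℝ 2 fun θ => Real.log (P θ i)) (θ : κ → ℝ) (a b : κ) :
    multinomialInfo N P θ a b =
      -(N * ∑ i, P θ i * pderiv a (pderiv b fun η => Real.log (P η i)) θ) := by
  have hd : ∀ i, Differentiable ℝ fun θ => Real.log (P θ i) := fun i =>
    (hP i).differentiable (by norm_num)
  have hd' : ∀ i, Differentiable ℝ (pderiv b fun θ => Real.log (P θ i)) := fun i =>
    (contDiff_pderiv (hP i) b).differentiable (by norm_num)
  have hlog : ∀ (n : Cell L → ℕ), (fun η => Real.log (multinomialPMF (P η) n)) =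
      fun η => Real.log (Nat.multinomial Finset.univ n) + ∑ i, n i * Real.log (P η i) := by
    intro n; funext η
    rw [multinomialPMF, Real.log_mul, Real.log_prod]
    · simp_rw [Real.log_pow]
    · intro i _; exact (pow_pos (hpos η i) _).ne'
    · exact Nat.cast_ne_zero.2 (Nat.multinomial_pos _ _).ne'
    · exact Finset.prod_ne_zero_iff.2 fun i _ => (pow_pos (hpos η i) _).ne'
  have hh : ∀ (n : Cell L → ℕ), pderiv a (pderiv b fun η => Real.log (multinomialPMF (P η) n)) θ =
      ∑ i, n i * pderiv a (pderiv b fun η => Real.log (P η i)) θ := by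
    intro n
    have e : (pderiv b fun η => Real.log (multinomialPMF (P η) n)) =
        fun η => ∑ i, n i * pderiv b (fun η => Real.log (P η i)) η := by
      funext η
      rw [hlog, pderiv_const_add, pderiv_sum _ _ fun i _ => ((hd i) η).const_mul _]
      exact Finset.sum_congr rfl fun i _ => pderiv_const_mul _ (hd i η) b
    rw [e, pderiv_sum _ _ fun i _ => ((hd' i) θ).const_mul _]
    exact Finset.sum_congr rfl fun i _ => pderiv_const_mul _ (hd' i θ) a
  rw [multinomialInfo, fisherInfo]
  simp_rw [hh, Finset.mul_sum]
  rw [Finset.sum_comm]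
  congr 1
  refine Finset.sum_congr rfl fun i _ => ?_
  simp_rw [← mul_assoc]
  rw [← Finset.sum_mul, ← sum_multinomial_mul_count N (P θ) (hsum θ) i]
  rfl

/-- The Fisher information in terms of the score. -/
theorem multinomialInfo_eq_sum (N : ℕ) {P : (κ → ℝ) → Cell L → ℝ}
    (hpos : ∀ θ i, 0 < P θ i) (hsum : ∀ θ, ∑ i, P θ i = 1)
    (hP : ∀ i, ContDiff ℝ 2 fun θ => Real.log (P θ i)) (θ : κ → ℝ) (a b : κ) :
    multinomialInfo N P θ a b =
      N * ∑ i, P θ i * (pderiv a (fun η => Real.log (P η i)) θ *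
        pderiv b (fun η => Real.log (P η i)) θ) := by
  have hd : ∀ i, Differentiable ℝ fun θ => Real.log (P θ i) := fun i =>
    (hP i).differentiable (by norm_num)
  have hd' : ∀ i, Differentiable ℝ (pderiv b fun θ => Real.log (P θ i)) := fun i =>
    (contDiff_pderiv (hP i) b).differentiable (by norm_num)
  have hPe : ∀ i, (fun θ => P θ i) = fun θ => Real.exp (Real.log (P θ i)) := fun i =>
    funext fun θ => (Real.exp_log (hpos θ i)).symm
  have hdP : ∀ i, Differentiable ℝ fun θ => P θ i := fun i => by rw [hPe]; exact (hd i).exp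
  have hpP : ∀ i c θ, pderiv c (fun θ => P θ i) θ =
      P θ i * pderiv c (fun η => Real.log (P η i)) θ := by
    intro i c θ
    rw [hPe i, pderiv_exp (hd i θ), Real.exp_log (hpos θ i)]
  have h1 : (fun η => ∑ i, P η i * pderiv b (fun η => Real.log (P η i)) η) = fun _ => 0 := by
    funext η
    simp_rw [← hpP]
    rw [← pderiv_sum _ _ fun i _ => hdP i η]
    simp_rw [hsum]
    exact pderiv_const _ _ _
  have h2 := congrArg (fun f => pderiv a f θ) h1
  simp only [pderiv_const] at h2
  rw [pderiv_sum _ _ fun i _ => (hdP i θ).fun_mul (hd' i θ)] at h2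
  simp_rw [pderiv_mul (hdP _ θ) (hd' _ θ), hpP, mul_assoc] at h2
  rw [Finset.sum_add_distrib] at h2
  rw [multinomialInfo_eq_neg_sum N hpos hsum hP, ← mul_neg]
  congr 1
  linarith

/-- The Fisher information after a change of coordinates. -/
theorem multinomialInfo_comp (N : ℕ) {P : (κ' → ℝ) → Cell L → ℝ} {T : (κ → ℝ) → κ' → ℝ}
    (hpos : ∀ θ i, 0 < P θ i) (hsum : ∀ θ, ∑ i, P θ i = 1)
    (hP : ∀ i, ContDiff ℝ 2 fun θ => Real.log (P θ i)) (hT : ContDiff ℝ 2 T) (θ : κ → ℝ) :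
    multinomialInfo N (fun η => P (T η)) θ =
      (Matrix.of fun c a => pderiv a (fun η => T η c) θ).transpose * multinomialInfo N P (T θ) *
        Matrix.of fun c a => pderiv a (fun η => T η c) θ := by
  ext a b
  have hd : ∀ i, Differentiable ℝ fun θ => Real.log (P θ i) := fun i =>
    (hP i).differentiable (by norm_num)
  have hdT : Differentiable ℝ T := hT.differentiable (by norm_num)
  rw [multinomialInfo_eq_sum N (fun θ => hpos (T θ)) (fun θ => hsum (T θ)) fun i => (hP i).comp hT]
  have hc : ∀ i a, pderiv a (fun η => Real.log (P (T η) i)) θ =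
      ∑ c, pderiv c (fun x => Real.log (P x i)) (T θ) * pderiv a (fun η => T η c) θ := fun i a =>
    pderiv_comp (f := fun x => Real.log (P x i)) (hd i (T θ)) (hdT θ) a
  simp_rw [Matrix.mul_apply, Matrix.transpose_apply, Matrix.of_apply]
  simp_rw [multinomialInfo_eq_sum N hpos hsum hP, hc, Finset.sum_mul_sum, Finset.mul_sum,
    Finset.sum_mul]
  rw [Finset.sum_comm, eq_comm, Finset.sum_comm]
  refine Finset.sum_congr rfl fun c _ => ?_
  rw [eq_comm, Finset.sum_comm]
  refine Finset.sum_congr rfl fun d _ => Finset.sum_congr rfl fun i _ => ?_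
  ring

end Fisher

/-! ### The information matrix of the conditional parametrization -/

section CondInfo

variable {κ : Type*} [Fintype κ] [DecidableEq κ]

theorem pderiv_eq_zero {f : (κ → ℝ) → ℝ} {s : Set κ} (hf : DependsOn f s) {a : κ} (ha : a ∉ s)
    (θ : κ → ℝ) : pderiv a f θ = 0 := by
  by_cases hd : DifferentiableAt ℝ f θ
  · rw [pderiv, ← hd.lineDeriv_eq_fderiv, lineDeriv]
    have : (fun t : ℝ => f (θ + t • Pi.single a 1)) = fun _ => f θ := by
      funext t
      refine hf fun b hb => ?_
      have : b ≠ a := fun h => ha (h ▸ hb)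
      simp [this]
    rw [this, deriv_const]
  · rw [pderiv, fderiv_zero_of_not_differentiableAt hd]; rfl

theorem pderiv_log {f : (κ → ℝ) → ℝ} {θ : κ → ℝ} (hf : DifferentiableAt ℝ f θ) (h : f θ ≠ 0)
    (a : κ) : pderiv a (fun η => Real.log (f η)) θ = pderiv a f θ / f θ := by
  rw [pderiv, fderiv.log hf h, div_eq_inv_mul]; rfl

theorem pderiv_apply (a b : κ) (θ : κ → ℝ) :
    pderiv a (fun η => η b) θ = if b = a then 1 else 0 := by
  rw [pderiv, fderiv_apply differentiableAt_id, fderiv_fun_id, ContinuousLinearMap.comp_id]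
  simp [Pi.single_apply]

variable {V : Type*} [Fintype V] [DecidableEq V] {L : V → Type*} [∀ v, Fintype (L v)]
  [∀ v, DecidableEq (L v)] [∀ v, Zero (L v)] {k : ℕ} {C : Fin k → Finset V}

/-- The zeta matrix of the order `SubCell` on the non-zero cells of a marginal table. -/
def zetaMatrix (L : V → Type*) [∀ v, Fintype (L v)] [∀ v, DecidableEq (L v)] [∀ v, Zero (L v)]
    (D : Finset V) : Matrix (NZ L D) (NZ L D) ℝ :=
  Matrix.of fun a r => if SubCell a.1 r.1 then 1 else 0

/-- The zeta matrix is invertible, by Möbius inversion. -/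
theorem det_zetaMatrix_ne_zero (D : Finset V) : (zetaMatrix L D).det ≠ 0 := by
  rw [← isUnit_iff_ne_zero, ← Matrix.isUnit_iff_isUnit_det, ← Matrix.vecMul_injective_iff_isUnit]
  intro x y h
  have key : ∀ (x : NZ L D → ℝ) (r : NZ L D),
      Matrix.vecMul x (zetaMatrix L D) r = ∑ a : NZ L D with SubCell a.1 r.1, x a := by
    intro x r
    simp [Matrix.vecMul, dotProduct, zetaMatrix, Finset.sum_filter]
  have hmob : ∀ (x : NZ L D → ℝ) (a : NZ L D),
      mob (fun j => ∑ b : NZ L D with SubCell b.1 j, x b) a.1 = x a := fun x a =>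
    (mob_eq_of_eq_sum (fun j => sum_subtype_eq (fun b => SubCell b j) x) a.1).trans (dif_pos a.2)
  have hall : ∀ j : Cell L, ∑ b : NZ L D with SubCell b.1 j, x b =
      ∑ b : NZ L D with SubCell b.1 j, y b := by
    intro j
    have e : ∀ x : NZ L D → ℝ, ∑ b : NZ L D with SubCell b.1 j, x b =
        ∑ b : NZ L D with SubCell b.1 (restrict D j), x b := fun x =>
      Finset.sum_congr (Finset.filter_congr fun a _ => (subCell_restrict_iff a.2.1).symm)
        fun _ _ => rfl
    rw [e x, e y]
    by_cases hj : ∃ v, restrict D j v ≠ 0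
    · have h1 := congrFun h ⟨restrict D j, fun v hv => if_neg hv, hj⟩
      exact (key x _).symm.trans (h1.trans (key y _))
    · have h0 : (Finset.univ.filter fun b : NZ L D => SubCell b.1 (restrict D j)) = ∅ := by
        refine Finset.filter_eq_empty_iff.2 fun b _ hb => ?_
        obtain ⟨v, hv⟩ := b.2.2
        exact hj ⟨v, hb v hv ▸ hv⟩
      rw [h0, Finset.sum_empty, Finset.sum_empty]
  funext a
  rw [← hmob x a, ← hmob y a, funext hall]

/-- The conditional probabilities of the group `g`. -/
def groupProb (C : Fin k → Finset V) (θ : CondIdx L C → ℝ) (g : CondGroup L C) (r : Cell L) : ℝ :=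
  Real.exp (xi C θ g r - cumulant C θ g)

theorem groupProb_pos (θ : CondIdx L C → ℝ) (g : CondGroup L C) (r : Cell L) :
    0 < groupProb C θ g r := Real.exp_pos _

/-- The probability, in the group `g`, of the cells above `a`. -/
def groupMean (C : Fin k → Finset V) (θ : CondIdx L C → ℝ) (g : CondGroup L C)
    (a : NZ L (res C g.1)) : ℝ :=
  ∑ r : NZ L (res C g.1), zetaMatrix L (res C g.1) a r * groupProb C θ g r.1

theorem contDiff_xi {n : WithTop ℕ∞} (g : CondGroup L C) (j : Cell L) :
    ContDiff ℝ n fun θ : CondIdx L C → ℝ => xi C θ g j :=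
  ContDiff.sum fun a _ => contDiff_apply ℝ ℝ (⟨g, a⟩ : CondIdx L C)

theorem contDiff_cumulant {n : WithTop ℕ∞} (g : CondGroup L C) :
    ContDiff ℝ n fun θ : CondIdx L C → ℝ => cumulant C θ g :=
  ContDiff.log (contDiff_const.add (ContDiff.sum fun j _ => (contDiff_xi g j.1).exp))
    fun _ => (one_add_sum_exp_pos _ _).ne'

theorem contDiff_log_pCond {n : WithTop ℕ∞} (i : Cell L) :
    ContDiff ℝ n fun θ : CondIdx L C → ℝ => Real.log (pCond C θ i) := by
  simp_rw [log_pCond]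
  exact ContDiff.sum fun l _ => (contDiff_xi _ _).sub (contDiff_cumulant _)

theorem cumulant_congr {θ θ' : CondIdx L C → ℝ} {g : CondGroup L C}
    (h : ∀ a, θ ⟨g, a⟩ = θ' ⟨g, a⟩) : cumulant C θ g = cumulant C θ' g := by
  rw [cumulant, cumulant, xi_congr h]

theorem dependsOn_groupProb (g : CondGroup L C) (r : Cell L) :
    DependsOn (fun θ : CondIdx L C → ℝ => groupProb C θ g r) {x | x.1 = g} := by
  intro θ θ' h
  have h' : ∀ a, θ ⟨g, a⟩ = θ' ⟨g, a⟩ := fun a => h ⟨g, a⟩ rfl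
  simp only [groupProb]
  rw [xi_congr h', cumulant_congr h']

theorem pderiv_xi (g : CondGroup L C) (a : NZ L (res C g.1)) (j : Cell L) (θ : CondIdx L C → ℝ) :
    pderiv ⟨g, a⟩ (fun θ => xi C θ g j) θ = if SubCell a.1 j then 1 else 0 := by
  simp only [xi]
  rw [pderiv_sum _ _ fun b _ => (contDiff_apply ℝ ℝ (⟨g, b⟩ : CondIdx L C)).differentiable
    (n := 1) (by norm_num) θ]
  simp_rw [pderiv_apply]
  rw [Finset.sum_filter, Finset.sum_eq_single a]
  · simp
  · intro b _ hb
    have : (⟨g, b⟩ : CondIdx L C) ≠ ⟨g, a⟩ := fun h => hb (by simpa using h)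
    simp [this]
  · exact fun h => absurd (Finset.mem_univ _) h

theorem pderiv_cumulant (g : CondGroup L C) (a : NZ L (res C g.1)) (θ : CondIdx L C → ℝ) :
    pderiv ⟨g, a⟩ (fun θ => cumulant C θ g) θ = groupMean C θ g a := by
  have hd : ∀ j : Cell L, DifferentiableAt ℝ (fun θ : CondIdx L C → ℝ => xi C θ g j) θ :=
    fun j => (contDiff_xi (n := 1) g j).differentiable (by norm_num) θ
  have hpos := one_add_sum_exp_pos (Finset.univ : Finset (NZ L (res C g.1))) fun j => xi C θ g j.1
  simp only [cumulant]
  rw [pderiv_log (f := fun θ => 1 + ∑ j : NZ L (res C g.1), Real.exp (xi C θ g j.1))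
    ((DifferentiableAt.fun_sum fun j _ => (hd j.1).exp).const_add 1) hpos.ne',
    pderiv_const_add, pderiv_sum _ _ fun j _ => (hd j.1).exp, Finset.sum_div, groupMean]
  refine Finset.sum_congr rfl fun j _ => ?_
  rw [pderiv_exp (hd j.1), pderiv_xi, groupProb, Real.exp_sub, cumulant, Real.exp_log hpos,
    zetaMatrix, Matrix.of_apply]
  ring

theorem differentiable_groupProb (g : CondGroup L C) (r : Cell L) :
    Differentiable ℝ fun θ : CondIdx L C → ℝ => groupProb C θ g r :=
  ((contDiff_xi (n := 1) g r).sub (contDiff_cumulant g)).exp.differentiable (by norm_num)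

theorem pderiv_log_groupProb (g : CondGroup L C) (a : NZ L (res C g.1)) (r : Cell L)
    (θ : CondIdx L C → ℝ) : pderiv ⟨g, a⟩ (fun θ => xi C θ g r - cumulant C θ g) θ =
      (if SubCell a.1 r then 1 else 0) - groupMean C θ g a := by
  rw [pderiv_sub ((contDiff_xi (n := 1) g r).differentiable (by norm_num) θ)
    ((contDiff_cumulant (n := 1) g).differentiable (by norm_num) θ), pderiv_xi, pderiv_cumulant]

theorem differentiable_groupMean (g : CondGroup L C) (a : NZ L (res C g.1)) :
    Differentiable ℝ fun θ : CondIdx L C → ℝ => groupMean C θ g a :=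
  Differentiable.fun_sum fun r _ => (differentiable_groupProb g r.1).const_mul _

theorem pderiv_groupMean (g : CondGroup L C) (a b : NZ L (res C g.1)) (θ : CondIdx L C → ℝ) :
    pderiv ⟨g, a⟩ (fun θ => groupMean C θ g b) θ =
      ∑ r : NZ L (res C g.1), zetaMatrix L (res C g.1) b r * (groupProb C θ g r.1 *
        (zetaMatrix L (res C g.1) a r - groupMean C θ g a)) := by
  simp only [groupMean]
  rw [pderiv_sum _ _ fun r _ => (differentiable_groupProb g r.1 θ).const_mul _]
  refine Finset.sum_congr rfl fun r _ => ?_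
  rw [pderiv_const_mul _ (differentiable_groupProb g r.1 θ)]
  congr 1
  simp only [groupProb]
  rw [pderiv_exp (((contDiff_xi (n := 1) g r.1).sub (contDiff_cumulant g)).differentiable
    (by norm_num) θ), pderiv_log_groupProb]
  rfl

theorem logFactor_of_slice {g : CondGroup L C} {i : Cell L} (h : slice C g.1 i = g)
    (θ : CondIdx L C → ℝ) : logFactor C θ g.1 i = xi C θ g i - cumulant C θ g := by
  rw [logFactor, h, xi_restrict]

theorem slice_eq_iff {g : CondGroup L C} {i : Cell L} :
    slice C g.1 i = g ↔ ∀ v ∈ sep C g.1, i v = g.2.1 v := by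
  obtain ⟨l, s⟩ := g
  constructor
  · intro h v hv
    have h1 : restrict (sep C l) i = s.1 := by
      have := eq_of_heq (Sigma.mk.inj h).2
      exact congrArg Subtype.val this
    simpa [restrict, hv] using congrFun h1 v
  · intro h
    have h1 : slice C l i = slice C l s.1 := slice_congr h
    rw [h1]
    simp only [slice]
    congr 1
    exact Subtype.ext (restrict_eq_self s.2)

theorem pderiv_log_pCond (x : CondIdx L C) (i : Cell L) (θ : CondIdx L C → ℝ) :
    pderiv x (fun θ => Real.log (pCond C θ i)) θ =
      if slice C x.1.1 i = x.1 then
        (if SubCell x.2.1 i then 1 else 0) - groupMean C θ x.1 x.2 else 0 := by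
  simp_rw [log_pCond]
  have hd : ∀ l, DifferentiableAt ℝ (fun θ : CondIdx L C → ℝ => logFactor C θ l i) θ := fun l =>
    ((contDiff_xi (n := 1) _ _).sub (contDiff_cumulant _)).differentiable (by norm_num) θ
  have h0 : ∀ l, slice C l i ≠ x.1 → pderiv x (fun θ => logFactor C θ l i) θ = 0 := by
    intro l hl
    refine pderiv_eq_zero (s := {y | y.1 = slice C l i}) (fun θ θ' h => ?_)
      (fun h : x.1 = slice C l i => hl h.symm) θ
    have h' : ∀ a, θ ⟨slice C l i, a⟩ = θ' ⟨slice C l i, a⟩ := fun a => h ⟨_, a⟩ rfl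
    simp only [logFactor]
    rw [xi_congr h', cumulant_congr h']
  rw [pderiv_sum _ _ fun l _ => hd l, Finset.sum_eq_single x.1.1]
  · split_ifs with h hs
    · simp only [logFactor_of_slice h]
      rw [pderiv_log_groupProb, if_pos hs]
    · simp only [logFactor_of_slice h]
      rw [pderiv_log_groupProb, if_neg hs]
    · exact h0 _ h
  · intro l _ hl
    exact h0 l fun h => hl (congrArg Sigma.fst h)
  · exact fun h => absurd (Finset.mem_univ _) h

/-- The marginal probability `p^{S_l}(i_{S_l})` of the group `g = (l, i_{S_l})`. -/
def sepProb (C : Fin k → Finset V) (θ : CondIdx L C → ℝ) (g : CondGroup L C) : ℝ :=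
  marg (pCond C θ) (sep C g.1) g.2.1

theorem sepProb_pos (θ : CondIdx L C → ℝ) (g : CondGroup L C) : 0 < sepProb C θ g :=
  marg_pos (pCond_pos θ) _ _

theorem multinomialInfo_pCond_apply (hk : hlt C k = Finset.univ) (N : ℕ) (θ : CondIdx L C → ℝ)
    (x y : CondIdx L C) : multinomialInfo N (pCond C) θ x y =
      N * sepProb C θ y.1 * pderiv x (fun θ => groupMean C θ y.1 y.2) θ := by
  rw [multinomialInfo_eq_neg_sum N pCond_pos (sum_pCond hk) contDiff_log_pCond]
  have h1 : ∀ i, pderiv x (pderiv y fun η => Real.log (pCond C η i)) θ =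
      if slice C y.1.1 i = y.1 then -pderiv x (fun θ => groupMean C θ y.1 y.2) θ else 0 := by
    intro i
    rw [funext fun η => pderiv_log_pCond y i η]
    split_ifs with h hs
    · rw [pderiv_sub (differentiableAt_const _) (differentiable_groupMean _ _ _), pderiv_const,
        zero_sub]
    · rw [pderiv_sub (differentiableAt_const _) (differentiable_groupMean _ _ _), pderiv_const,
        zero_sub]
    · exact pderiv_const _ _ _
  simp_rw [h1, slice_eq_iff, mul_ite, mul_zero]
  rw [← Finset.sum_filter, ← Finset.sum_mul, sepProb, marg]
  ring

/-- The information matrix is block diagonal: the conditional probabilities of a group involve no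
other group. -/
theorem multinomialInfo_pCond_of_ne (hk : hlt C k = Finset.univ) (N : ℕ) (θ : CondIdx L C → ℝ)
    {x y : CondIdx L C} (h : x.1 ≠ y.1) : multinomialInfo N (pCond C) θ x y = 0 := by
  rw [multinomialInfo_pCond_apply hk, pderiv_eq_zero (s := {z | z.1 = y.1}) (fun θ θ' h => ?_) h,
    mul_zero]
  exact Finset.sum_congr rfl fun r _ => congrArg _ (dependsOn_groupProb y.1 r.1 h)

/-- The block of the group `g` is `N p^{S_l}(i_{S_l})` times the covariance matrix of the
sufficient statistic, the image of that of the indicators of the cells under the zeta matrix. -/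
theorem det_multinomialInfo_pCond (hk : hlt C k = Finset.univ) (N : ℕ) (θ : CondIdx L C → ℝ)
    (g : CondGroup L C) :
    (Matrix.of fun a b => multinomialInfo N (pCond C) θ ⟨g, a⟩ ⟨g, b⟩).det =
      (N * sepProb C θ g) ^ Fintype.card (NZ L (res C g.1)) *
        ((zetaMatrix L (res C g.1)).det ^ 2 * ∏ r : Table L (res C g.1), groupProb C θ g r.1) := by
  set Z := zetaMatrix L (res C g.1) with hZ
  set f : NZ L (res C g.1) → ℝ := fun r => groupProb C θ g r.1 with hf
  have h1 : (Matrix.of fun a b => multinomialInfo N (pCond C) θ ⟨g, a⟩ ⟨g, b⟩) =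
      (N * sepProb C θ g) • (Z * (Matrix.of fun r t => f r * ((1 : Matrix _ _ ℝ) r t - f t)) *
        Z.transpose) := by
    ext a b
    rw [Matrix.of_apply, multinomialInfo_pCond_apply hk, pderiv_groupMean, Matrix.smul_apply,
      smul_eq_mul]
    congr 1
    simp only [Matrix.mul_apply, Matrix.transpose_apply, Matrix.of_apply]
    have h2 : ∀ t, ∑ r, Z a r * (f r * ((1 : Matrix _ _ ℝ) r t - f t)) =
        f t * (Z a t - groupMean C θ g a) := by
      intro t
      simp_rw [mul_sub]
      rw [Finset.sum_sub_distrib]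
      congr 1
      · simp [Matrix.one_apply, mul_comm]
      · rw [groupMean, Finset.mul_sum]
        exact Finset.sum_congr rfl fun r _ => by rw [hf]; ring
    exact Finset.sum_congr rfl fun t _ => by rw [h2, mul_comm]
  have h2 : (∏ r, f r) * (1 - ∑ r, f r) = ∏ r : Table L (res C g.1), groupProb C θ g r.1 := by
    have h3 := sum_exp_logFactor θ g
    rw [sum_table_eq (res C g.1) fun r => Real.exp (xi C θ g r - cumulant C θ g)] at h3
    have h4 : 1 - ∑ r, f r = groupProb C θ g 0 := by
      rw [← h3]; simp only [hf, groupProb]; ring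
    have h5 := sum_table_eq (res C g.1) fun r => Real.log (groupProb C θ g r)
    rw [h4, ← Real.exp_log (groupProb_pos θ g 0), hf]
    have h6 : ∀ r, groupProb C θ g r = Real.exp (Real.log (groupProb C θ g r)) := fun r =>
      (Real.exp_log (groupProb_pos θ g r)).symm
    rw [Finset.prod_congr rfl fun (r : Table L (res C g.1)) _ => h6 r.1, ← Real.exp_sum, h5,
      Finset.prod_congr rfl fun (r : NZ L (res C g.1)) _ => h6 r.1, ← Real.exp_sum, ← Real.exp_add,
      add_comm]
  rw [h1, Matrix.det_smul, Matrix.det_mul, Matrix.det_mul, Matrix.det_transpose,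
    det_diagonal_sub_mul, h2]
  ring

end CondInfo

/-! ### Bounds for the conditional parametrization -/

section Bounds

variable {V : Type*} [Fintype V] [DecidableEq V] {L : V → Type*} [∀ v, Fintype (L v)]
  [∀ v, DecidableEq (L v)] [∀ v, Zero (L v)] {k : ℕ} {C : Fin k → Finset V}

theorem xi_le_cumulant (θ : CondIdx L C → ℝ) (g : CondGroup L C) (r : Table L (res C g.1)) :
    xi C θ g r.1 ≤ cumulant C θ g := by
  have h := sum_exp_logFactor θ g
  have h1 : Real.exp (xi C θ g r.1 - cumulant C θ g) ≤ 1 := by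
    rw [← h]
    exact Finset.single_le_sum
      (f := fun r : Table L (res C g.1) => Real.exp (xi C θ g r.1 - cumulant C θ g))
      (fun _ _ => (Real.exp_pos _).le) (Finset.mem_univ r)
  have := Real.exp_le_one_iff.1 h1
  linarith

theorem card_le_card_cell {P : Cell L → Prop} (s : Finset {i : Cell L // P i}) :
    (s.card : ℝ) ≤ Fintype.card (Cell L) := by
  rw [← Finset.card_map (Function.Embedding.subtype P)]
  exact Nat.cast_le.2 (Finset.card_le_univ _)

theorem abs_xi_le (θ : CondIdx L C → ℝ) (g : CondGroup L C) (j : Cell L) :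
    |xi C θ g j| ≤ Fintype.card (Cell L) * ‖θ‖ := by
  rw [xi]
  refine (Finset.abs_sum_le_sum_abs _ _).trans ((Finset.sum_le_card_nsmul _ _ ‖θ‖
    fun a _ => norm_le_pi_norm θ ⟨g, a⟩).trans ?_)
  rw [nsmul_eq_mul]
  exact mul_le_mul_of_nonneg_right (card_le_card_cell _) (norm_nonneg _)

theorem log_one_add_sum_exp_le {P : Cell L → Prop} [DecidablePred P] {f : {i : Cell L // P i} → ℝ}
    {c : ℝ} (hc : 0 ≤ c) (hf : ∀ a, f a ≤ c) :
    Real.log (1 + ∑ a, Real.exp (f a)) ≤ Real.log (1 + Fintype.card (Cell L)) + c := by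
  rw [Real.log_le_iff_le_exp (one_add_sum_exp_pos _ _), Real.exp_add, Real.exp_log (by positivity),
    add_mul, one_mul]
  refine add_le_add (Real.one_le_exp hc) ?_
  refine (Finset.sum_le_card_nsmul _ _ (Real.exp c) fun a _ => Real.exp_le_exp.2 (hf a)).trans ?_
  rw [nsmul_eq_mul]
  exact mul_le_mul_of_nonneg_right (card_le_card_cell _) (Real.exp_pos _).le

theorem cumulant_le (θ : CondIdx L C → ℝ) (g : CondGroup L C) :
    cumulant C θ g ≤ Real.log (1 + Fintype.card (Cell L)) + Fintype.card (Cell L) * ‖θ‖ :=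
  log_one_add_sum_exp_le (by positivity) fun a => (le_abs_self _).trans (abs_xi_le θ g a.1)

/-- The logarithms of the conditional probabilities grow at most linearly. -/
theorem exists_le_log_groupProb (L : V → Type*) [∀ v, Fintype (L v)] [∀ v, DecidableEq (L v)]
    [∀ v, Zero (L v)] (C : Fin k → Finset V) : ∃ M, 0 ≤ M ∧
      ∀ (θ : CondIdx L C → ℝ) (g : CondGroup L C) (j : Cell L),
        -(M * (1 + ‖θ‖)) ≤ xi C θ g j - cumulant C θ g := by
  set n : ℝ := ((Fintype.card (Cell L) : ℕ) : ℝ) with hn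
  have hn0 : 0 ≤ n := Nat.cast_nonneg _
  have hlog : 0 ≤ Real.log (1 + n) := Real.log_nonneg (by linarith)
  refine ⟨Real.log (1 + n) + 2 * n, by positivity, fun θ g j => ?_⟩
  have h1 := (abs_le.1 (abs_xi_le θ g j)).1
  have h2 := cumulant_le θ g
  rw [← hn] at h1 h2
  have h3 : 0 ≤ Real.log (1 + n) * ‖θ‖ := by positivity
  nlinarith

/-- As the parameters are alternating sums of the logarithms of the conditional probabilities, one
of the latter is very negative when a parameter is large. -/
theorem sum_log_groupProb_le (θ : CondIdx L C → ℝ) (g : CondGroup L C) (a : NZ L (res C g.1)) :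
    ∑ r : Table L (res C g.1), (xi C θ g r.1 - cumulant C θ g) ≤
      -(|θ ⟨g, a⟩| / 2 ^ Fintype.card V) := by
  obtain ⟨f, hf⟩ : ∃ f : Cell L → ℝ, ∀ j, f j = xi C θ g j - cumulant C θ g := ⟨_, fun _ => rfl⟩
  simp_rw [← hf]
  set S := ∑ r : Table L (res C g.1), f r.1 with hS
  have h1 : mob f a.1 = θ ⟨g, a⟩ := by
    rw [funext hf, mob_sub, mob_const _ a.2.2, sub_zero, mob_xi]
  have hneg : ∀ r : Table L (res C g.1), 0 ≤ -f r.1 := fun r => by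
    rw [hf]; linarith [xi_le_cumulant θ g r]
  have h2 : ∀ F, |f (restrict F a.1)| ≤ -S := by
    intro F
    have hmem : ∀ v, v ∉ res C g.1 → restrict F a.1 v = 0 := by
      intro v hv
      rw [restrict]
      split_ifs
      · exact a.2.1 v hv
      · rfl
    have h0 : f (restrict F a.1) ≤ 0 := neg_nonneg.1 (hneg ⟨_, hmem⟩)
    rw [abs_of_nonpos h0, hS, ← Finset.sum_neg_distrib]
    exact Finset.single_le_sum (f := fun r : Table L (res C g.1) => -f r.1)
      (fun r _ => hneg r) (Finset.mem_univ ⟨restrict F a.1, hmem⟩)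
  have h3 : |θ ⟨g, a⟩| ≤ 2 ^ Fintype.card V * -S := by
    have hS0 : 0 ≤ -S := (abs_nonneg _).trans (h2 ∅)
    rw [← h1, mob]
    refine (Finset.abs_sum_le_sum_abs _ _).trans ((Finset.sum_le_card_nsmul _ _ (-S)
      fun F _ => ?_).trans ?_)
    · rw [abs_mul, abs_pow, abs_neg, abs_one, one_pow, one_mul]
      exact h2 F
    · rw [nsmul_eq_mul, Finset.card_powerset]
      refine mul_le_mul_of_nonneg_right ?_ hS0
      push_cast
      exact pow_le_pow_right₀ one_le_two (Finset.card_le_univ _)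
  have h4 : |θ ⟨g, a⟩| / 2 ^ Fintype.card V ≤ -S := by
    rw [div_le_iff₀ (by positivity)]; linarith
  linarith

/-- The logarithm of the part of the prior density that belongs to the groups in `s`. -/
def logPrior (C : Fin k → Finset V) (s : Finset (CondGroup L C)) (θ : CondIdx L C → ℝ) : ℝ :=
  ∑ g ∈ s, 1 / 2 * ∑ r : Table L (res C g.1), (xi C θ g r.1 - cumulant C θ g)

theorem refDensity_pCond_eq_exp_logPrior (hk : hlt C k = Finset.univ) (θ : CondIdx L C → ℝ) :
    refDensity C (pCond C θ) = Real.exp (logPrior C Finset.univ θ) := by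
  rw [refDensity_pCond_eq_exp hk, logPrior, Fintype.sum_sigma]
  simp_rw [Finset.mul_sum]

theorem logPrior_le {s : Finset (CondGroup L C)} (θ : CondIdx L C → ℝ) {x : CondIdx L C}
    (hx : x.1 ∈ s) : logPrior C s θ ≤ -(|θ x| / 2 ^ (Fintype.card V + 1)) := by
  have hneg : ∀ g ∈ s, 0 ≤ -(1 / 2 * ∑ r : Table L (res C g.1), (xi C θ g r.1 - cumulant C θ g)) := by
    intro g _
    have : ∑ r : Table L (res C g.1), (xi C θ g r.1 - cumulant C θ g) ≤ 0 :=
      Finset.sum_nonpos fun r _ => by have := xi_le_cumulant θ g r; linarith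
    linarith
  have h1 := Finset.single_le_sum hneg hx
  rw [Finset.sum_neg_distrib] at h1
  have h2 := sum_log_groupProb_le θ x.1 x.2
  have h3 : |θ x| / 2 ^ (Fintype.card V + 1) = 1 / 2 * (|θ x| / 2 ^ Fintype.card V) := by
    rw [pow_succ]; field_simp
  rw [logPrior, h3]
  linarith

theorem exists_le_logPrior (L : V → Type*) [∀ v, Fintype (L v)] [∀ v, DecidableEq (L v)]
    [∀ v, Zero (L v)] (C : Fin k → Finset V) : ∃ M, 0 ≤ M ∧
      ∀ (s : Finset (CondGroup L C)) (θ : CondIdx L C → ℝ), -(M * (1 + ‖θ‖)) ≤ logPrior C s θ := by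
  obtain ⟨M, hM, h⟩ := exists_le_log_groupProb L C
  refine ⟨Fintype.card (CondGroup L C) * (Fintype.card (Cell L) * M), by positivity,
    fun s θ => ?_⟩
  have h1 : ∀ g : CondGroup L C, -(Fintype.card (Cell L) * (M * (1 + ‖θ‖))) ≤
      1 / 2 * ∑ r : Table L (res C g.1), (xi C θ g r.1 - cumulant C θ g) := by
    intro g
    have h2 : -(Fintype.card (Cell L) * (M * (1 + ‖θ‖))) ≤
        ∑ r : Table L (res C g.1), (xi C θ g r.1 - cumulant C θ g) := by
      have h3 := Finset.card_nsmul_le_sum (Finset.univ : Finset (Table L (res C g.1)))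
        (fun r => xi C θ g r.1 - cumulant C θ g) _ fun r _ => h θ g r.1
      refine le_trans ?_ h3
      rw [nsmul_eq_mul, mul_neg, neg_le_neg_iff]
      exact mul_le_mul_of_nonneg_right (card_le_card_cell _) (by positivity)
    have h4 : 0 ≤ (Fintype.card (Cell L) : ℝ) * (M * (1 + ‖θ‖)) := by positivity
    linarith
  have h2 := Finset.card_nsmul_le_sum s _ _ fun g _ => h1 g
  refine le_trans ?_ h2
  rw [nsmul_eq_mul, mul_neg, neg_le_neg_iff, mul_assoc, mul_assoc]
  refine mul_le_mul_of_nonneg_right ?_ (by positivity)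
  exact_mod_cast Finset.card_le_univ s

theorem continuous_logPrior (s : Finset (CondGroup L C)) : Continuous (logPrior C s) :=
  continuous_finsetSum _ fun g _ => continuous_const.mul (continuous_finsetSum _ fun r _ =>
    (contDiff_xi (n := 1) g r.1).continuous.sub (contDiff_cumulant (n := 1) g).continuous)

theorem dependsOn_logPrior (s : Finset (CondGroup L C)) :
    DependsOn (logPrior C s) {x | x.1 ∈ s} := by
  intro θ θ' h
  refine Finset.sum_congr rfl fun g hg => ?_
  have h' : ∀ a, θ ⟨g, a⟩ = θ' ⟨g, a⟩ := fun a => h ⟨g, a⟩ hg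
  rw [xi_congr h', cumulant_congr h']

theorem sepProb_le_one (hk : hlt C k = Finset.univ) (θ : CondIdx L C → ℝ) (g : CondGroup L C) :
    sepProb C θ g ≤ 1 := by
  rw [← sum_pCond hk θ, sepProb, marg]
  exact Finset.sum_le_sum_of_subset_of_nonneg (Finset.filter_subset _ _)
    fun i _ _ => (pCond_pos θ i).le

theorem exists_le_log_sepProb (L : V → Type*) [∀ v, Fintype (L v)] [∀ v, DecidableEq (L v)]
    [∀ v, Zero (L v)] (C : Fin k → Finset V) : ∃ M, 0 ≤ M ∧
      ∀ (θ : CondIdx L C → ℝ) (g : CondGroup L C),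
        -(M * (1 + ‖θ‖)) ≤ Real.log (sepProb C θ g) := by
  obtain ⟨M, hM, h⟩ := exists_le_log_groupProb L C
  refine ⟨k * M, by positivity, fun θ g => ?_⟩
  have h1 : pCond C θ g.2.1 ≤ sepProb C θ g :=
    Finset.single_le_sum (fun i _ => (pCond_pos θ i).le) (by simp)
  refine le_trans ?_ (Real.log_le_log (pCond_pos θ _) h1)
  rw [log_pCond]
  have h2 := Finset.card_nsmul_le_sum (Finset.univ : Finset (Fin k))
    (fun l => logFactor C θ l g.2.1) _ fun l _ => h θ (slice C l g.2.1) (restrict (res C l) g.2.1)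
  refine le_trans (le_of_eq ?_) h2
  rw [Finset.card_univ, Fintype.card_fin, nsmul_eq_mul]
  ring

theorem continuous_sepProb (g : CondGroup L C) : Continuous fun θ => sepProb C θ g := by
  refine continuous_finsetSum _ fun i _ => ?_
  have : (fun θ => pCond C θ i) = fun θ => Real.exp (Real.log (pCond C θ i)) :=
    funext fun θ => (Real.exp_log (pCond_pos θ i)).symm
  rw [this]
  exact Real.continuous_exp.comp (contDiff_log_pCond (n := 1) i).continuous

/-- The separator probabilities involve only the parameters of the preceding cliques. -/
theorem dependsOn_sepProb (hk : hlt C k = Finset.univ) (g : CondGroup L C) :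
    DependsOn (fun θ => sepProb C θ g) {x : CondIdx L C | x.1.1 < g.1} := by
  intro θ θ' h
  simp only [sepProb]
  rw [marg_pCond_sep hk, marg_pCond_sep hk]
  congr 1
  funext i
  refine Finset.prod_congr rfl fun l hl => ?_
  rw [logFactor_congr fun s a => h ⟨⟨l, s⟩, a⟩ ?_]
  exact Fin.lt_def.2 (Finset.mem_filter.1 hl).2

end Bounds

/-! ### Coordinates that refine the grouping -/

section Coordinates

open Matrix

variable {κ : Type*} [Fintype κ] [DecidableEq κ]

/-- A change of coordinates of the whole space that shifts each coordinate by a function of the more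
important groups. -/
structure IsShear (gr : κ → ℕ) (T : (κ → ℝ) → κ → ℝ) : Prop where
  contDiff : ContDiff ℝ 2 T
  shear : ∀ a θ θ', (∀ b, gr a < gr b → θ b = θ' b) → T θ a - θ a = T θ' a - θ' a
  growth : ∃ M, 0 ≤ M ∧ ∀ θ, ‖T θ‖ ≤ M * (1 + ‖θ‖)
  injective : Function.Injective T

theorem isShear_id (gr : κ → ℕ) : IsShear gr id where
  contDiff := contDiff_id
  shear a θ θ' _ := by simp
  growth := ⟨1, zero_le_one, fun θ => by simp⟩
  injective := Function.injective_id

/-- The Jacobian matrix of `T`. -/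
def jacobian (T : (κ → ℝ) → κ → ℝ) (θ : κ → ℝ) : Matrix κ κ ℝ :=
  Matrix.of fun c a => pderiv a (fun η => T η c) θ

variable {gr : κ → ℕ} {T : (κ → ℝ) → κ → ℝ}

theorem IsShear.jacobian_apply (hT : IsShear gr T) (θ : κ → ℝ) {c a : κ} (h : gr a ≤ gr c) :
    jacobian T θ c a = (1 : Matrix κ κ ℝ) c a := by
  have hd : DifferentiableAt ℝ (fun η => T η c) θ :=
    (differentiable_pi.1 (hT.contDiff.differentiable (by norm_num)) c) θ
  have hd' : DifferentiableAt ℝ (fun η : κ → ℝ => η c) θ := differentiableAt_apply c θ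
  have h1 : pderiv a (fun η => T η c - η c) θ = 0 :=
    pderiv_eq_zero (s := {b | gr c < gr b}) (fun θ θ' h => hT.shear c θ θ' h)
      (fun h' : gr c < gr a => absurd h (not_le.2 h')) θ
  rw [pderiv_sub hd hd', pderiv_apply, sub_eq_zero] at h1
  rw [jacobian, Matrix.of_apply, h1, Matrix.one_apply]

theorem IsShear.blockTriangular (hT : IsShear gr T) (θ : κ → ℝ) :
    (jacobian T θ).BlockTriangular gr := fun c a (h : gr a < gr c) => by
  rw [hT.jacobian_apply θ h.le, Matrix.one_apply_ne]
  rintro rfl; exact lt_irrefl _ h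

theorem IsShear.det_jacobian (hT : IsShear gr T) (θ : κ → ℝ) : (jacobian T θ).det = 1 :=
  det_of_blockUnitriangular (hT.blockTriangular θ) fun _ _ h => hT.jacobian_apply θ h.ge

/-- A shear preserves the volume. -/
theorem IsShear.integrable_comp (hT : IsShear gr T) {f : (κ → ℝ) → ℝ} (hf : Integrable f) :
    Integrable fun θ => f (T θ) := by
  have hd : Differentiable ℝ T := hT.contDiff.differentiable (by norm_num)
  have h := (integrableOn_image_iff_integrableOn_abs_det_fderiv_smul (μ := volume)
    MeasurableSet.univ (fun θ _ => (hd θ).hasFDerivAt.hasFDerivWithinAt) hT.injective.injOn f).1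
    hf.integrableOn
  rw [integrableOn_univ] at h
  have hdet : ∀ θ, (fderiv ℝ T θ).det = 1 := by
    intro θ
    rw [ContinuousLinearMap.det, ← LinearMap.det_toMatrix', ← hT.det_jacobian θ]
    congr 1
    ext c a
    rw [LinearMap.toMatrix'_apply, jacobian, Matrix.of_apply, pderiv, fderiv_apply (hd θ)]
    rfl
  simpa [hdet] using h

theorem det_toSquareBlock_ne_zero {M : Matrix κ κ ℝ} (hM : M.BlockTriangular gr) (h : M.det ≠ 0)
    (j : ℕ) : (M.toSquareBlock gr j).det ≠ 0 := by
  by_cases hj : j ∈ Finset.univ.image gr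
  · rw [hM.det] at h
    exact Finset.prod_ne_zero_iff.1 h j hj
  · have : IsEmpty {a // gr a = j} := ⟨fun a => hj (Finset.mem_image.2 ⟨a.1, Finset.mem_univ _, a.2⟩)⟩
    rw [det_isEmpty]; exact one_ne_zero

variable {V : Type*} [Fintype V] [DecidableEq V] {L : V → Type*} [∀ v, Fintype (L v)]
  [∀ v, DecidableEq (L v)] [∀ v, Zero (L v)] {k : ℕ} {C : Fin k → Finset V} {m : ℕ}

/-- Linear coordinates `A` for `θ^cond` that respect a grouping `grp` of the conditional
distributions: the coordinates in group `j` determine and are determined by the conditional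
distributions in group `j`, each group belonging to one clique. -/
structure GroupedCoords (grp : CondGroup L C → Fin m) (σ : κ ≃ CondIdx L C)
    (A : (κ → ℝ) →ₗ[ℝ] (CondIdx L C → ℝ)) : Prop where
  injective : Function.Injective A
  clique_eq : ∀ g g', grp g = grp g' → g.1 = g'.1
  apply_eq_zero : ∀ b x, grp x.1 ≠ grp (σ b).1 → A (Pi.single b 1) x = 0

variable {grp : CondGroup L C → Fin m} {σ : κ ≃ CondIdx L C}
  {A : (κ → ℝ) →ₗ[ℝ] (CondIdx L C → ℝ)}

theorem linearMap_apply_eq_sum (A : (κ → ℝ) →ₗ[ℝ] (CondIdx L C → ℝ)) (y : κ → ℝ)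
    (x : CondIdx L C) : A y x = ∑ b, A (Pi.single b 1) x * y b := by
  conv_lhs => rw [pi_eq_sum_univ' y]
  rw [map_sum, Finset.sum_apply]
  refine Finset.sum_congr rfl fun b _ => ?_
  rw [map_smul, Pi.smul_apply, smul_eq_mul, mul_comm]

theorem GroupedCoords.apply_congr (h : GroupedCoords grp σ A) {y y' : κ → ℝ} {x : CondIdx L C}
    (hy : ∀ b, grp (σ b).1 = grp x.1 → y b = y' b) : A y x = A y' x := by
  rw [linearMap_apply_eq_sum, linearMap_apply_eq_sum A y']
  refine Finset.sum_congr rfl fun b _ => ?_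
  by_cases hb : grp (σ b).1 = grp x.1
  · rw [hy b hb]
  · rw [h.apply_eq_zero b x fun h' => hb h'.symm, zero_mul, zero_mul]

/-- The matrix of `A`. -/
def coordMatrix (σ : κ ≃ CondIdx L C) (A : (κ → ℝ) →ₗ[ℝ] (CondIdx L C → ℝ)) : Matrix κ κ ℝ :=
  Matrix.of fun c b => A (Pi.single b 1) (σ c)

theorem GroupedCoords.det_coordMatrix_ne_zero (h : GroupedCoords grp σ A) :
    (coordMatrix σ A).det ≠ 0 := by
  rw [← isUnit_iff_ne_zero, ← Matrix.isUnit_iff_isUnit_det, ← Matrix.mulVec_injective_iff_isUnit]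
  intro y y' hy
  refine h.injective (funext fun x => ?_)
  have h1 := congrFun hy (σ.symm x)
  simpa [Matrix.mulVec, dotProduct, coordMatrix, ← linearMap_apply_eq_sum] using h1

theorem GroupedCoords.coordMatrix_eq_zero (h : GroupedCoords grp σ A) {c b : κ}
    (hcb : (grp (σ c).1 : ℕ) ≠ grp (σ b).1) : coordMatrix σ A c b = 0 :=
  h.apply_eq_zero b (σ c) fun h' => hcb (congrArg _ h')

theorem GroupedCoords.exists_norm_le (h : GroupedCoords grp σ A) :
    ∃ c, 0 < c ∧ ∀ y, ‖y‖ ≤ c * ‖A y‖ := by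
  obtain ⟨c, hc, hA⟩ := A.exists_antilipschitzWith (LinearMap.ker_eq_bot.2 h.injective)
  refine ⟨c, hc, fun y => ?_⟩
  have := hA.le_mul_dist y 0
  simpa using this

/-- The groups of conditional distributions in group `j`. -/
def groupsOf (grp : CondGroup L C → Fin m) (j : ℕ) : Finset (CondGroup L C) :=
  Finset.univ.filter fun g => (grp g : ℕ) = j

/-- The difference between `log det h_j` and twice the logarithm of the prior density of group
`j`: apart from constants, it consists of the logarithms of separator probabilities. -/
def logRemainder (N : ℕ) (grp : CondGroup L C → Fin m) (σ : κ ≃ CondIdx L C)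
    (A : (κ → ℝ) →ₗ[ℝ] (CondIdx L C → ℝ)) (j : ℕ) (y : κ → ℝ) : ℝ :=
  Real.log (((coordMatrix σ A).toSquareBlock (fun b => (grp (σ b).1 : ℕ)) j).det ^ 2) +
    ∑ g ∈ groupsOf grp j, (Fintype.card (NZ L (res C g.1)) *
      (Real.log N + Real.log (sepProb C (A y) g)) +
        Real.log ((zetaMatrix L (res C g.1)).det ^ 2))

theorem contDiff_linearMap {n : WithTop ℕ∞} (A : (κ → ℝ) →ₗ[ℝ] (CondIdx L C → ℝ)) :
    ContDiff ℝ n A := (LinearMap.toContinuousLinearMap A).contDiff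

theorem continuous_linearMap (A : (κ → ℝ) →ₗ[ℝ] (CondIdx L C → ℝ)) : Continuous A :=
  (contDiff_linearMap (n := 0) A).continuous

/-- The information matrix in the coordinates `A`. -/
theorem multinomialInfo_pCond_linear (hk : hlt C k = Finset.univ) (N : ℕ) (σ : κ ≃ CondIdx L C)
    (A : (κ → ℝ) →ₗ[ℝ] (CondIdx L C → ℝ)) (y : κ → ℝ) :
    multinomialInfo N (fun y => pCond C (A y)) y = (coordMatrix σ A)ᵀ *
      (multinomialInfo N (pCond C) (A y)).submatrix σ σ * coordMatrix σ A := by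
  rw [multinomialInfo_comp N pCond_pos (sum_pCond hk) contDiff_log_pCond (contDiff_linearMap A)]
  have h1 : (Matrix.of fun c a => pderiv a (fun η => A η c) y) =
      Matrix.of fun c a => A (Pi.single a 1) c := by
    ext c a
    rw [Matrix.of_apply, Matrix.of_apply, pderiv]
    have : (fun η => A η c) =
      ((ContinuousLinearMap.proj c).comp (LinearMap.toContinuousLinearMap A) : (κ → ℝ) →L[ℝ] ℝ) := rfl
    rw [this, ContinuousLinearMap.fderiv]
    rfl
  have h2 : coordMatrix σ A = (Matrix.of fun c a => A (Pi.single a 1) c).submatrix σ id := rfl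
  rw [h1, h2, Matrix.transpose_submatrix, Matrix.submatrix_mul_equiv, Matrix.submatrix_mul_equiv,
    Matrix.submatrix_id_id]

end Coordinates

/-! ### Reference priors in grouped coordinates -/

section Grouped

open Matrix

variable {κ : Type*} [Fintype κ] [DecidableEq κ] {V : Type*} [Fintype V] [DecidableEq V]
  {L : V → Type*} [∀ v, Fintype (L v)] [∀ v, DecidableEq (L v)] [∀ v, Zero (L v)] {k : ℕ}
  {C : Fin k → Finset V} {m : ℕ} {grp : CondGroup L C → Fin m} {σ : κ ≃ CondIdx L C}
  {A : (κ → ℝ) →ₗ[ℝ] (CondIdx L C → ℝ)} {T : (κ → ℝ) → κ → ℝ}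

theorem mem_groupsOf {g : CondGroup L C} {j : ℕ} : g ∈ groupsOf grp j ↔ (grp g : ℕ) = j := by
  simp [groupsOf]

theorem det_toSquareBlock_pCond (hk : hlt C k = Finset.univ) (N : ℕ) (grp : CondGroup L C → Fin m)
    (σ : κ ≃ CondIdx L C) (θ : CondIdx L C → ℝ) (j : ℕ) :
    (((multinomialInfo N (pCond C) θ).submatrix σ σ).toSquareBlock
      (fun b => (grp (σ b).1 : ℕ)) j).det =
      ∏ g ∈ groupsOf grp j, ((N * sepProb C θ g) ^ Fintype.card (NZ L (res C g.1)) *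
        ((zetaMatrix L (res C g.1)).det ^ 2 * ∏ r : Table L (res C g.1), groupProb C θ g r.1)) := by
  have h1 : ((multinomialInfo N (pCond C) θ).submatrix σ σ).toSquareBlock
      (fun b => (grp (σ b).1 : ℕ)) j =
      ((multinomialInfo N (pCond C) θ).toSquareBlock (fun x => (grp x.1 : ℕ)) j).submatrix
        (σ.subtypeEquiv fun _ => Iff.rfl) (σ.subtypeEquiv fun _ => Iff.rfl) := rfl
  rw [h1, det_submatrix_equiv_self, det_toSquareBlock_sigma (fun x y => multinomialInfo_pCond_of_ne hk N θ)
    (fun g => (grp g : ℕ))]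
  exact Finset.prod_congr rfl fun g _ => det_multinomialInfo_pCond hk N θ g

theorem GroupedCoords.log_det_infoBlock (h : GroupedCoords grp σ A)
    (hT : IsShear (fun b => (grp (σ b).1 : ℕ)) T) (hk : hlt C k = Finset.univ) {N : ℕ} (hN : 1 ≤ N)
    (j : ℕ) (θ : κ → ℝ) :
    Real.log (infoBlock (multinomialInfo N (fun θ => pCond C (A (T θ))) θ)
      (fun b => (grp (σ b).1 : ℕ)) j).det =
      2 * logPrior C (groupsOf grp j) (A (T θ)) + logRemainder N grp σ A j (T θ) := by
  set gr : κ → ℕ := fun b => (grp (σ b).1 : ℕ) with hgr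
  have hN0 : (0 : ℝ) < N := by exact_mod_cast hN
  set D := multinomialInfo N (fun y => pCond C (A y)) (T θ) with hD
  have hinfo : multinomialInfo N (fun θ => pCond C (A (T θ))) θ =
      (jacobian T θ)ᵀ * D * jacobian T θ :=
    multinomialInfo_comp N (fun y => pCond_pos (A y)) (fun y => sum_pCond hk (A y))
      (fun i => (contDiff_log_pCond i).comp (contDiff_linearMap A)) hT.contDiff θ
  have hDeq := multinomialInfo_pCond_linear hk N σ A (T θ)
  rw [← hD] at hDeq
  set I := (multinomialInfo N (pCond C) (A (T θ))).submatrix σ σ with hI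
  have hA0 : ∀ c b, gr c ≠ gr b → coordMatrix σ A c b = 0 := fun c b hcb =>
    h.coordMatrix_eq_zero hcb
  have hI0 : ∀ c b, gr c ≠ gr b → I c b = 0 := fun c b hcb =>
    multinomialInfo_pCond_of_ne hk N _ fun h' => hcb (by simp only [hgr, h'])
  have hD0 : ∀ c b, gr c ≠ gr b → D c b = 0 := by
    intro c b hcb
    rw [hDeq, mul_apply]
    refine Finset.sum_eq_zero fun d _ => ?_
    rw [mul_apply, Finset.sum_mul]
    refine Finset.sum_eq_zero fun e _ => ?_
    rw [transpose_apply]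
    by_cases h1 : gr e = gr c
    · by_cases h2 : gr d = gr b
      · rw [hI0 e d fun h3 => hcb (h1.symm.trans (h3.trans h2)), mul_zero, zero_mul]
      · rw [hA0 d b h2, mul_zero]
    · rw [hA0 e c h1, zero_mul, zero_mul]
  have hIpos : ∀ j, (I.toSquareBlock gr j).det ≠ 0 := by
    intro j
    rw [hI, hgr, det_toSquareBlock_pCond hk]
    refine Finset.prod_ne_zero_iff.2 fun g _ => mul_ne_zero
      (pow_pos (mul_pos hN0 (sepProb_pos _ _)) _).ne'
      (mul_ne_zero (pow_ne_zero _ (det_zetaMatrix_ne_zero _))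
        (Finset.prod_pos fun r _ => groupProb_pos _ _ _).ne')
  have hApos : ∀ j, ((coordMatrix σ A).toSquareBlock gr j).det ≠ 0 :=
    det_toSquareBlock_ne_zero (fun c b hcb => hA0 c b hcb.ne') h.det_coordMatrix_ne_zero
  have hblock : ∀ j, (D.toSquareBlock gr j).det =
      ((coordMatrix σ A).toSquareBlock gr j).det ^ 2 * (I.toSquareBlock gr j).det := by
    intro j
    rw [hDeq, toSquareBlock_transpose_mul_mul hA0, det_mul, det_mul, det_transpose]
    ring
  have hDdet : IsUnit D.det := by
    rw [isUnit_iff_ne_zero, BlockTriangular.det (b := gr) fun c b hcb => hD0 c b hcb.ne']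
    exact Finset.prod_ne_zero_iff.2 fun j _ => by
      rw [hblock]; exact mul_ne_zero (pow_ne_zero _ (hApos j)) (hIpos j)
  rw [hinfo, infoBlock_transpose_mul_mul (hT.blockTriangular θ)
    (fun c b hcb => hT.jacobian_apply θ hcb.ge) hD0 hDdet, hblock,
    Real.log_mul (pow_ne_zero _ (hApos j)) (hIpos j), hI, hgr, det_toSquareBlock_pCond hk,
    Real.log_prod fun g _ => mul_ne_zero
      (pow_pos (mul_pos hN0 (sepProb_pos _ _)) _).ne'
      (mul_ne_zero (pow_ne_zero _ (det_zetaMatrix_ne_zero _))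
        (Finset.prod_pos fun r _ => groupProb_pos _ _ _).ne'), logRemainder, logPrior,
    Finset.mul_sum, add_left_comm, ← Finset.sum_add_distrib]
  congr 1
  refine Finset.sum_congr rfl fun g _ => ?_
  rw [Real.log_mul (pow_pos (mul_pos hN0 (sepProb_pos _ _)) _).ne'
      (mul_ne_zero (pow_ne_zero _ (det_zetaMatrix_ne_zero _))
        (Finset.prod_pos fun r _ => groupProb_pos _ _ _).ne'),
    Real.log_mul (pow_ne_zero _ (det_zetaMatrix_ne_zero _))
      (Finset.prod_pos fun r _ => groupProb_pos _ _ _).ne', Real.log_pow,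
    Real.log_mul hN0.ne' (sepProb_pos _ _).ne', Real.log_prod fun r _ => (groupProb_pos _ _ _).ne']
  simp only [groupProb, Real.log_exp]
  ring

theorem GroupedCoords.exists_apply_le (A : (κ → ℝ) →ₗ[ℝ] (CondIdx L C → ℝ)) :
    ∃ c, 0 ≤ c ∧ ∀ y, 1 + ‖A y‖ ≤ c * (1 + ‖y‖) := by
  refine ⟨1 + ‖LinearMap.toContinuousLinearMap A‖, by positivity, fun y => ?_⟩
  have h1 : ‖A y‖ ≤ ‖LinearMap.toContinuousLinearMap A‖ * ‖y‖ :=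
    (LinearMap.toContinuousLinearMap A).le_opNorm y
  have := norm_nonneg y
  have := norm_nonneg (LinearMap.toContinuousLinearMap A)
  nlinarith

/-- The prior density decays exponentially in the parameters of the groups it belongs to. -/
theorem GroupedCoords.exists_logPrior_le (h : GroupedCoords grp σ A) : ∃ ε, 0 < ε ∧
    (∀ y, logPrior C Finset.univ (A y) ≤ -(ε * ‖y‖)) ∧
    ∀ (j : ℕ) (y : κ → ℝ), logPrior C (groupsOf grp j) (A y) ≤
      -(ε * ‖fun a : {b : κ // (grp (σ b).1 : ℕ) = j} => y a.1‖) := by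
  obtain ⟨c, hc, hA⟩ := h.exists_norm_le
  set q : ℝ := 2 ^ (Fintype.card V + 1) with hq
  have hq0 : 0 < q := by positivity
  have key : ∀ (t : ℝ) (y : κ → ℝ), t ≤ 0 → (∀ x, t ≤ -(|A y x| / q)) → t ≤ -(1 / (c * q) * ‖y‖) := by
    intro t y ht hx
    have h1 : ‖A y‖ ≤ q * -t := by
      refine (pi_norm_le_iff_of_nonneg (by nlinarith)).2 fun x => ?_
      have h2 : |A y x| / q ≤ -t := by linarith [hx x]
      rw [div_le_iff₀ hq0] at h2
      rw [Real.norm_eq_abs]; linarith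
    have h2 : ‖y‖ ≤ c * q * -t := (hA y).trans (by nlinarith)
    have h3 : 1 / (c * q) * ‖y‖ ≤ -t := by
      rw [one_div, inv_mul_le_iff₀ (by positivity)]; exact h2
    linarith
  have hnonpos : ∀ (s : Finset (CondGroup L C)) θ, logPrior C s θ ≤ 0 := fun s θ =>
    Finset.sum_nonpos fun g _ => by
      have : ∑ r : Table L (res C g.1), (xi C θ g r.1 - cumulant C θ g) ≤ 0 :=
        Finset.sum_nonpos fun r _ => by linarith [xi_le_cumulant θ g r]
      linarith
  refine ⟨1 / (c * q), by positivity, fun y => key _ y (hnonpos _ _) fun x =>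
    logPrior_le _ (Finset.mem_univ _), fun j y => ?_⟩
  set y' : κ → ℝ := fun b => if (grp (σ b).1 : ℕ) = j then y b else 0 with hy'
  have h1 : logPrior C (groupsOf grp j) (A y) ≤ -(1 / (c * q) * ‖y'‖) := by
    refine key _ y' (hnonpos _ _) fun x => ?_
    by_cases hx : (grp x.1 : ℕ) = j
    · rw [← h.apply_congr (y := y) fun b hb => ?_]
      · exact logPrior_le _ (mem_groupsOf.2 hx)
      · simp only [hy']; rw [if_pos (by rw [hb, hx])]
    · rw [h.apply_congr (y' := 0) fun b hb => ?_]
      · simpa using hnonpos _ _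
      · simp only [hy']; rw [if_neg (by rw [hb]; exact hx)]; rfl
  refine h1.trans (neg_le_neg (mul_le_mul_of_nonneg_left ?_ (by positivity)))
  refine (pi_norm_le_iff_of_nonneg (norm_nonneg _)).2 fun a => ?_
  have h2 := norm_le_pi_norm y' a.1
  simp only [hy', if_pos a.2] at h2
  exact h2

theorem GroupedCoords.dependsOn_logRemainder (h : GroupedCoords grp σ A)
    (hk : hlt C k = Finset.univ) (N j : ℕ) :
    DependsOn (logRemainder N grp σ A j) {b | (grp (σ b).1 : ℕ) ≠ j} := by
  intro y y' hy
  rw [logRemainder, logRemainder]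
  congr 1
  refine Finset.sum_congr rfl fun g hg => ?_
  have h1 : sepProb C (A y) g = sepProb C (A y') g := by
    refine dependsOn_sepProb hk g fun x (hx : x.1.1 < g.1) => h.apply_congr fun b hb => hy b ?_
    intro hb'
    have h2 : grp x.1 = grp g := by
      rw [← hb]; exact Fin.ext (hb'.trans (mem_groupsOf.1 hg).symm)
    exact hx.ne (h.clique_eq _ _ h2)
  rw [h1]

theorem continuous_logRemainder (N j : ℕ) : Continuous (logRemainder N grp σ A j) := by
  refine continuous_const.add (continuous_finsetSum _ fun g _ => ?_)
  refine (continuous_const.mul (continuous_const.add ?_)).add continuous_const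
  exact ((continuous_sepProb g).comp (continuous_linearMap A)).log fun y => (sepProb_pos _ _).ne'

theorem exists_logRemainder_le (hk : hlt C k = Finset.univ) (N : ℕ) :
    ∃ M, ∀ j < m, ∀ y, logRemainder N grp σ A j y ≤ M := by
  have h1 : ∀ j, ∃ M, ∀ y, logRemainder N grp σ A j y ≤ M := by
    intro j
    refine ⟨Real.log (((coordMatrix σ A).toSquareBlock (fun b => (grp (σ b).1 : ℕ)) j).det ^ 2) +
      ∑ g ∈ groupsOf grp j, (Fintype.card (NZ L (res C g.1)) * (Real.log N + 0) +
        Real.log ((zetaMatrix L (res C g.1)).det ^ 2)), fun y => ?_⟩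
    rw [logRemainder]
    gcongr with g _
    exact Real.log_nonpos (sepProb_pos _ _).le (sepProb_le_one hk _ _)
  choose M hM using h1
  refine ⟨∑ j ∈ Finset.range m, |M j|, fun j hj y => (hM j y).trans ((le_abs_self _).trans ?_)⟩
  exact Finset.single_le_sum (f := fun j => |M j|) (fun _ _ => abs_nonneg _) (Finset.mem_range.2 hj)

theorem exists_le_logRemainder (N : ℕ) :
    ∃ M, ∀ j < m, ∀ y, -(M * (1 + ‖y‖)) ≤ logRemainder N grp σ A j y := by
  obtain ⟨M₁, hM₁, h₁⟩ := exists_le_log_sepProb L C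
  obtain ⟨c, hc, hA⟩ := GroupedCoords.exists_apply_le A
  have h1 : ∀ j, ∃ M, ∀ y, -(M * (1 + ‖y‖)) ≤ logRemainder N grp σ A j y := by
    intro j
    set c₀ := Real.log (((coordMatrix σ A).toSquareBlock (fun b => (grp (σ b).1 : ℕ)) j).det ^ 2) +
      ∑ g ∈ groupsOf grp j, (Fintype.card (NZ L (res C g.1)) * Real.log N +
        Real.log ((zetaMatrix L (res C g.1)).det ^ 2)) with hc₀
    set c₁ : ℝ := ∑ g ∈ groupsOf grp j, (Fintype.card (NZ L (res C g.1)) : ℝ) with hc₁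
    have hc₁0 : 0 ≤ c₁ := Finset.sum_nonneg fun _ _ => Nat.cast_nonneg _
    refine ⟨|c₀| + c₁ * (M₁ * c), fun y => ?_⟩
    have h2 : ∀ g, -(M₁ * (c * (1 + ‖y‖))) ≤ Real.log (sepProb C (A y) g) := fun g =>
      le_trans (neg_le_neg (mul_le_mul_of_nonneg_left (hA y) hM₁)) (h₁ (A y) g)
    have h3 : c₀ + c₁ * -(M₁ * (c * (1 + ‖y‖))) ≤ logRemainder N grp σ A j y := by
      rw [logRemainder, hc₀, hc₁, Finset.sum_mul, add_assoc, ← Finset.sum_add_distrib]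
      refine add_le_add le_rfl (Finset.sum_le_sum fun g _ => ?_)
      have := mul_le_mul_of_nonneg_left (h2 g)
        (Nat.cast_nonneg (α := ℝ) (Fintype.card (NZ L (res C g.1))))
      linarith
    have h4 : -(|c₀| * (1 + ‖y‖)) ≤ c₀ := by
      have := neg_abs_le c₀
      have : 0 ≤ |c₀| * ‖y‖ := by positivity
      linarith
    linarith
  choose M hM using h1
  refine ⟨∑ j ∈ Finset.range m, |M j|, fun j hj y => le_trans (neg_le_neg ?_) (hM j y)⟩
  refine mul_le_mul_of_nonneg_right ((le_abs_self _).trans ?_) (by positivity)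
  exact Finset.single_le_sum (f := fun j => |M j|) (fun _ _ => abs_nonneg _) (Finset.mem_range.2 hj)

theorem GroupedCoords.shearModel (h : GroupedCoords grp σ A)
    (hT : IsShear (fun b => (grp (σ b).1 : ℕ)) T) (hk : hlt C k = Finset.univ) {N : ℕ}
    (hN : 1 ≤ N) :
    ShearModel (fun b => (grp (σ b).1 : ℕ)) m
      (fun j θ => Real.log (infoBlock (multinomialInfo N (fun θ => pCond C (A (T θ))) θ)
        (fun b => (grp (σ b).1 : ℕ)) j).det) T
      (fun j y => Real.exp (logPrior C (groupsOf grp j) (A y))) (logRemainder N grp σ A) where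
  eq j _ θ := by rw [Real.log_exp]; exact h.log_det_infoBlock hT hk hN j θ
  continuous_T := hT.contDiff.continuous
  shear := hT.shear
  growth := hT.growth
  continuous_F j _ :=
    Real.continuous_exp.comp ((continuous_logPrior _).comp (continuous_linearMap A))
  dependsOn_F j _ y y' hy := by
    simp only
    rw [dependsOn_logPrior (groupsOf grp j) fun x (hx : x.1 ∈ groupsOf grp j) =>
      h.apply_congr fun b hb => hy b ?_]
    change (grp (σ b).1 : ℕ) = j
    rw [hb]; exact mem_groupsOf.1 hx
  F_lower := by
    obtain ⟨M, hM, h1⟩ := exists_le_logPrior L C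
    obtain ⟨c, hc, hA⟩ := GroupedCoords.exists_apply_le A
    refine ⟨M * c, by positivity, fun j _ y => Real.exp_le_exp.2 (le_trans ?_ (h1 _ _))⟩
    rw [mul_assoc]
    exact neg_le_neg (mul_le_mul_of_nonneg_left (hA y) hM)
  F_upper := by
    obtain ⟨ε, hε, -, h1⟩ := h.exists_logPrior_le
    refine ⟨0, ε, hε, fun j _ y => Real.exp_le_exp.2 ?_⟩
    rw [zero_sub]
    exact h1 j y
  continuous_β j _ := continuous_logRemainder N j
  dependsOn_β j _ := h.dependsOn_logRemainder hk N j
  β_le := exists_logRemainder_le hk N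
  le_β := exists_le_logRemainder N

theorem GroupedCoords.isReferencePrior (h : GroupedCoords grp σ A)
    (hT : IsShear (fun b => (grp (σ b).1 : ℕ)) T) (hk : hlt C k = Finset.univ) {N : ℕ}
    (hN : 1 ≤ N) :
    IsReferencePrior (multinomialInfo N (fun θ => pCond C (A (T θ)))) m (fun b => grp (σ b).1)
      (fun θ => refDensity C (pCond C (A (T θ)))) := by
  refine ShearModel.isReferencePrior (h.shearModel hT hk hN) fun θ => ?_
  rw [refDensity_pCond_eq_exp_logPrior hk, ← Real.exp_sum]
  congr 1
  exact (Finset.sum_fiberwise_of_maps_to (t := Finset.range m) (g := fun g => (grp g : ℕ))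
    (fun g _ => Finset.mem_range.2 (grp g).2) _).symm

theorem GroupedCoords.integrable_refDensity (h : GroupedCoords grp σ A)
    (hT : IsShear (fun b => (grp (σ b).1 : ℕ)) T) (hk : hlt C k = Finset.univ) :
    Integrable fun θ => refDensity C (pCond C (A (T θ))) := by
  obtain ⟨ε, hε, h1, -⟩ := h.exists_logPrior_le
  refine hT.integrable_comp (f := fun y => refDensity C (pCond C (A y))) ?_
  simp_rw [refDensity_pCond_eq_exp_logPrior hk]
  refine (integrable_exp_neg_mul_norm hε).mono' ?_ (Eventually.of_forall fun y => ?_)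
  · exact (Real.continuous_exp.comp
      ((continuous_logPrior _).comp (continuous_linearMap A))).aestronglyMeasurable
  · rw [Real.norm_of_nonneg (Real.exp_pos _).le]
    exact Real.exp_le_exp.2 (h1 y)

end Grouped

/-! ### The reference priors of the three parametrizations -/

section Parametrizations

variable {V : Type*} [Fintype V] [DecidableEq V] {L : V → Type*} [∀ v, Fintype (L v)]
  [∀ v, DecidableEq (L v)] [∀ v, Zero (L v)] {k : ℕ} {C : Fin k → Finset V} {m : ℕ}

theorem groupedCoords_cond (e : CondGroup L C ≃ Fin m) :
    GroupedCoords (fun g => e g) (Equiv.refl (CondIdx L C)) LinearMap.id where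
  injective := Function.injective_id
  clique_eq g g' h := by rw [e.injective h]
  apply_eq_zero b x h := by
    have : x ≠ b := by rintro rfl; exact h rfl
    simp [this]

theorem groupedCoords_cliq (hk : hlt C k = Finset.univ) (e : Equiv.Perm (Fin k)) :
    GroupedCoords (fun g : CondGroup L C => e g.1) (idxEquiv C) (condOfCliqLin L C) where
  injective := condOfCliq_injective hk
  clique_eq g g' h := e.injective h
  apply_eq_zero b x h := by
    refine Finset.sum_eq_zero fun c _ => ?_
    have : (⟨x.1.1, c⟩ : CliqIdx L C) ≠ b := by rintro rfl; exact h rfl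
    simp [this]

/-- The difference of `θ^cliq` and `θ^mod` at `b`. -/
theorem cliqOfMod_sub (θ : CliqIdx L C → ℝ) (b : CliqIdx L C) :
    cliqOfMod C θ b - θ b = ∑ F ∈ (supp b.2.1).powerset, (-1) ^ (supp b.2.1 \ F).card *
      Real.log (1 + ∑ j : NZ L (Finset.univ \ hist C b.1), Real.exp
        (∑ a : CliqIdx L C with
          SubCell a.2.1 (glue (hist C b.1) (restrict F b.2.1) j.1) ∧
            ∃ v ∉ hist C b.1, a.2.1 v ≠ 0, θ a)) := by
  rw [cliqOfMod, add_sub_cancel_left]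

theorem abs_cliqOfMod_sub_le (θ : CliqIdx L C → ℝ) (b : CliqIdx L C) :
    |cliqOfMod C θ b - θ b| ≤ 2 ^ Fintype.card V *
      (Real.log (1 + Fintype.card (Cell L)) + Fintype.card (CliqIdx L C) * ‖θ‖) := by
  have hlog : 0 ≤ Real.log (1 + (Fintype.card (Cell L) : ℝ)) :=
    Real.log_nonneg (by have : (0 : ℝ) ≤ Fintype.card (Cell L) := Nat.cast_nonneg _
                        linarith)
  rw [cliqOfMod_sub]
  refine (Finset.abs_sum_le_sum_abs _ _).trans ((Finset.sum_le_card_nsmul _ _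
    (Real.log (1 + Fintype.card (Cell L)) + Fintype.card (CliqIdx L C) * ‖θ‖)
    fun F _ => ?_).trans ?_)
  · rw [abs_mul, abs_pow, abs_neg, abs_one, one_pow, one_mul, abs_of_nonneg (Real.log_nonneg
      (le_add_of_nonneg_right (Finset.sum_nonneg fun _ _ => (Real.exp_pos _).le)))]
    refine log_one_add_sum_exp_le (by positivity) fun j => ?_
    refine (Finset.sum_le_card_nsmul _ _ ‖θ‖ fun a _ =>
      (le_abs_self _).trans (norm_le_pi_norm θ a)).trans ?_
    rw [nsmul_eq_mul]
    exact mul_le_mul_of_nonneg_right (Nat.cast_le.2 (Finset.card_le_univ _)) (norm_nonneg _)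
  · rw [nsmul_eq_mul, Finset.card_powerset]
    refine mul_le_mul_of_nonneg_right ?_ (by positivity)
    push_cast
    exact pow_le_pow_right₀ one_le_two (Finset.card_le_univ _)

/-- The passage from `θ^mod` to `θ^cliq` shifts the parameters of a clique by a function of those of
the later cliques: it collects the effect of summing out the residuals of the latter. -/
theorem isShear_cliqOfMod {G : SimpleGraph V} (hC : IsPerfectOrder G C) :
    IsShear (fun b : CliqIdx L C => (b.1 : ℕ)) (cliqOfMod C) where
  contDiff := by
    refine contDiff_pi.2 fun b => (contDiff_apply ℝ ℝ b).add
      (ContDiff.sum fun F _ => contDiff_const.mul (ContDiff.log (contDiff_const.add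
        (ContDiff.sum fun j _ => ContDiff.exp (ContDiff.sum fun a _ => contDiff_apply ℝ ℝ a)))
        fun θ => (one_add_sum_exp_pos _ _).ne'))
  shear b θ θ' h := by
    rw [cliqOfMod_sub, cliqOfMod_sub]
    refine Finset.sum_congr rfl fun F _ => ?_
    congr 3
    refine Finset.sum_congr rfl fun j _ => ?_
    congr 1
    refine Finset.sum_congr rfl fun a ha => h a ?_
    obtain ⟨v, hv, hav⟩ := (Finset.mem_filter.1 ha).2.2
    rw [hist_eq, mem_hlt] at hv
    have hva : v ∈ C a.1 := by by_contra hv'; exact hav (a.2.2.1 v hv')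
    by_contra hlt'
    exact hv ⟨a.1, by omega, hva⟩
  growth := by
    set c : ℝ := Real.log (1 + Fintype.card (Cell L)) with hc
    have hlog : 0 ≤ c :=
      Real.log_nonneg (by have : (0 : ℝ) ≤ Fintype.card (Cell L) := Nat.cast_nonneg _
                          linarith)
    refine ⟨1 + 2 ^ Fintype.card V * (c + Fintype.card (CliqIdx L C)), by positivity, fun θ => ?_⟩
    refine (pi_norm_le_iff_of_nonneg (by positivity)).2 fun b => ?_
    have h1 := abs_cliqOfMod_sub_le θ b
    have h2 : |cliqOfMod C θ b| ≤ |cliqOfMod C θ b - θ b| + |θ b| := by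
      have := abs_add_le (cliqOfMod C θ b - θ b) (θ b)
      rwa [sub_add_cancel] at this
    have h3 : |θ b| ≤ ‖θ‖ := norm_le_pi_norm θ b
    have h4 : 0 ≤ 2 ^ Fintype.card V * c * ‖θ‖ := by positivity
    have h5 : 0 ≤ (2 : ℝ) ^ Fintype.card V * Fintype.card (CliqIdx L C) := by positivity
    rw [Real.norm_eq_abs]
    rw [← hc] at h1
    nlinarith
  injective θ θ' h := by
    rw [← thetaMod_pMod hC θ, ← thetaMod_pMod hC θ', pMod_eq_pCliq hC, pMod_eq_pCliq hC, h]

end Parametrizations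

end RefPrior

end

open RefPrior in
theorem theorem3p1 {V : Type*} [Fintype V] [DecidableEq V] (L : V → Type*)
    [∀ v, Fintype (L v)] [∀ v, DecidableEq (L v)] [∀ v, Zero (L v)]
    (G : SimpleGraph V) {k : ℕ} (C : Fin k → Finset V) (hC : IsPerfectOrder G C)
    (N : ℕ) (hN : 1 ≤ N) :
    -- the three log-odds-ratio vectors parametrize the Markov model
    (IsParametrization (L := L) (markovModel G) (pCond C) (thetaCond C) ∧
      IsParametrization (L := L) (markovModel G) (pCliq C) (thetaCliq C) ∧
      IsParametrization (L := L) (markovModel G) (pMod C) (thetaMod C)) ∧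
    -- the reference priors; for the first two, whatever the order of the groups
    ((∀ (m : ℕ) (e : CondGroup L C ≃ Fin m),
        IsReferencePrior (multinomialInfo N (pCond C)) m (fun a : CondIdx L C => e a.1)
          (fun θ => refDensity C (pCond C θ))) ∧
      (∀ e : Equiv.Perm (Fin k),
        IsReferencePrior (multinomialInfo N (pCliq C)) k (fun a : CliqIdx L C => e a.1)
          (fun θ => refDensity C (pCliq C θ))) ∧
      IsReferencePrior (multinomialInfo N (pMod C)) k (fun a : CliqIdx L C => a.1)
        (fun θ => refDensity C (pMod C θ))) ∧
    -- explicit form of the priors, with the fictitious prior counts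
    ((∀ θ : CondIdx L C → ℝ, refDensity C (pCond C θ) =
        nefCond C
          (fun a => (Fintype.card (Table L (res C a.1.1 \ supp a.2.1)) : ℝ) / 2)
          (fun g => (Fintype.card (Table L (res C g.1)) : ℝ) / 2) θ) ∧
      (∀ θ : CliqIdx L C → ℝ, refDensity C (pCliq C θ) =
        nefCliq C
          (fun a => (Fintype.card (Table L (sep C a.1 \ supp a.2.1)) : ℝ) *
            (Fintype.card (Table L (res C a.1 \ supp a.2.1)) : ℝ) / 2)
          (fun g => (Fintype.card (Table L (sep C g.1 \ supp g.2.1)) : ℝ) *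
            (Fintype.card (Table L (res C g.1)) : ℝ) / 2) θ) ∧
      (∀ θ : CliqIdx L C → ℝ, thetaCliq C (pMod C θ) = cliqOfMod C θ ∧
        refDensity C (pMod C θ) =
        nefCliq C
          (fun a => (Fintype.card (Table L (sep C a.1 \ supp a.2.1)) : ℝ) *
            (Fintype.card (Table L (res C a.1 \ supp a.2.1)) : ℝ) / 2)
          (fun g => (Fintype.card (Table L (sep C g.1 \ supp g.2.1)) : ℝ) *
            (Fintype.card (Table L (res C g.1)) : ℝ) / 2) (cliqOfMod C θ))) ∧
    -- conjugacy: the likelihood has the same form, with the observed counts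
    (∀ n : Cell L → ℕ,
      (∀ θ : CondIdx L C → ℝ, ∏ i, pCond C θ i ^ n i =
        nefCond C
          (fun a => marg (fun i => (n i : ℝ)) (sep C a.1.1 ∪ supp a.2.1)
            (glue (sep C a.1.1) a.1.2.1 a.2.1))
          (fun g => marg (fun i => (n i : ℝ)) (sep C g.1) g.2.1) θ) ∧
      (∀ θ : CliqIdx L C → ℝ, ∏ i, pCliq C θ i ^ n i =
        nefCliq C
          (fun a => marg (fun i => (n i : ℝ)) (supp a.2.1) a.2.1)
          (fun g => marg (fun i => (n i : ℝ)) (supp g.2.1) g.2.1) θ) ∧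
      (∀ θ : CliqIdx L C → ℝ, ∏ i, pMod C θ i ^ n i =
        nefCliq C
          (fun a => marg (fun i => (n i : ℝ)) (supp a.2.1) a.2.1)
          (fun g => marg (fun i => (n i : ℝ)) (supp g.2.1) g.2.1) (cliqOfMod C θ))) ∧
    -- properness
    (MeasureTheory.Integrable (fun θ : CondIdx L C → ℝ => refDensity C (pCond C θ)) ∧
      MeasureTheory.Integrable (fun θ : CliqIdx L C → ℝ => refDensity C (pCliq C θ)) ∧
      MeasureTheory.Integrable (fun θ : CliqIdx L C → ℝ => refDensity C (pMod C θ))) := by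
  have hk := hC.hlt_eq_univ
  have hmod : pMod (L := L) C = fun θ => pCond C (condOfCliqLin L C (cliqOfMod C θ)) :=
    funext fun θ => pMod_eq_pCliq hC θ
  refine ⟨⟨isParametrization_pCond hC, isParametrization_pCliq hC, isParametrization_pMod hC⟩,
    ⟨fun m e => ?_, fun e => ?_, ?_⟩,
    ⟨refDensity_pCond hk, refDensity_pCliq hk, fun θ => ⟨thetaCliq_pMod hC θ, ?_⟩⟩,
    fun n => ⟨prod_pCond_pow n, prod_pCliq_pow n, fun θ => ?_⟩, ?_, ?_, ?_⟩
  · exact (groupedCoords_cond e).isReferencePrior (isShear_id _) hk hN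
  · exact (groupedCoords_cliq hk e).isReferencePrior (isShear_id _) hk hN
  · rw [hmod]
    exact (groupedCoords_cliq hk (Equiv.refl _)).isReferencePrior (isShear_cliqOfMod hC) hk hN
  · rw [pMod_eq_pCliq hC]
    exact refDensity_pCliq hk _
  · simp_rw [pMod_eq_pCliq hC]
    exact prod_pCliq_pow n _
  · exact (groupedCoords_cond (Fintype.equivFin _)).integrable_refDensity (isShear_id _) hk
  · exact (groupedCoords_cliq hk (Equiv.refl _)).integrable_refDensity (isShear_id _) hk
  · rw [hmod]
    exact (groupedCoords_cliq hk (Equiv.refl _)).integrable_refDensity (isShear_cliqOfMod hC) hk
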